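/- **Setting.** Let $S^1=\Delta[1]/\partial\Delta[1]$ be the simplicial circle, whose $n$-simplices are the classes of $\langle 0^i,1^{n+1-i}\rangle$, $0\le i\le n+1$, those with $i=0$ and $i=n+1$ being the base point $*$. For a pointed simplicial set $X$, Milnor's simplicial group $F[X]$ is, in degree $n$, the group generated by the set $X_n$ with the single relation $s_0^n(*)=1$; let $K[X]$ be its degreewise quotient by the normal subgroup generated by all $[x,gxg^{-1}]$ with $x\in X_n$, $g\in F[X]_n$, where $[a,b]=aba^{-1}b^{-1}$. Let $F_n$ be the free group on $x_1,\dots,x_n$ and let $K_n=F_n/\Lambda_n$ be the reduced free group, where $\Lambda_n$ is the normal subgroup generated by all $[x_i,gx_ig^{-1}]$, $1\le i\le n$, $g\in F_n$. Let $\mathrm{Lie}(n)$ be the multilinear part of the free Lie ring on $x_1,\dots,x_n$, i.e. the subgroup spanned by the brackets $[[\cdots[x_{\sigma(1)},x_{\sigma(2)}],\cdots],x_{\sigma(n)}]$, $\sigma\in\Sigma_n$. Let $P_n$ be the pure braid group on $n$ strands, i.e. the kernel of $B_n\to\Sigma_n$. The homotopy groups $\pi_n$ of a simplicial group are those of its Moore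 complex. **Theorem.** For every $n\ge 0$ there are isomorphisms $F_n\cong F[S^1]_n$, taking $x_i$ to the generator $\langle 0^i,1^{n+1-i}\rangle$, and $K_n\cong K[S^1]_n$, under which the quotient map $F_n\to K_n$ becomes the degree $n$ part of the quotient morphism of simplicial groups $\rho:F[S^1]\to K[S^1]$. Let $\Gamma[S^1]=\ker\rho$. Then: 1. $\rho$ is surjective in each degree, it is a Kan fibration, and its fibre $\Gamma[S^1]$ is a free group in each degree. 2. For every $n\ge 1$ there are isomorphisms of abelian groups $\pi_nK[S^1]\cong\mathrm{Lie}(n)\cong\bigoplus_{(n-1)!}\mathbb Z\cong H_{n-1}(P_n;\mathbb Z)$. 3. The induced map $\pi_n(\rho):\pi_nF[S^1]\to\pi_nK[S^1]$ is an isomorphism for $n=1$ and $n=2$, and it is zero for every $n>2$. 4. For every $n>2$ there is a short exact sequence $$0\to\mathrm{Lie}(n+1)\to\pi_n\Gamma[S^1]\to\pi_nF[S^1]\to 0$$ in which the second map is induced by the inclusion $\Gamma[S^1]\subset F[S^1]$. -/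

import Mathlib

open CategoryTheory Opposite Simplicial

noncomputable section

namespace FreeToK

/-! ### The simplicial circle -/

/-- Two `n`-simplices of `Δ[1]` are related if both of them lie in the boundary `∂Δ[1]`. -/
def circleRel (n : SimplexCategoryᵒᵖ) (a b : (Δ[1] : SSet.{0}).obj n) : Prop :=
  a ∈ (∂Δ[1] : (Δ[1] : SSet.{0}).Subcomplex).obj n ∧
    b ∈ (∂Δ[1] : (Δ[1] : SSet.{0}).Subcomplex).obj n

/-- The simplicial circle `S¹ = Δ[1] / ∂Δ[1]`. -/
def circle : SSet.{0} where
  obj n := Quot (circleRel n)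
  map {m n} f := ↾(Quot.map ((Δ[1] : SSet.{0}).map f) fun _ _ h =>
    ⟨(∂Δ[1] : (Δ[1] : SSet.{0}).Subcomplex).map f h.1,
      (∂Δ[1] : (Δ[1] : SSet.{0}).Subcomplex).map f h.2⟩)
  map_id n := by
    ext ⟨a⟩
    simp [Quot.map]
  map_comp f g := by
    ext ⟨a⟩
    simp [Quot.map]

/-- The `n`-simplex `⟨0^i, 1^{n+1-i}⟩` of the simplicial circle, for `0 ≤ i ≤ n + 1`. -/
def circleSimplex (n : ℕ) (i : Fin (n + 2)) : circle _⦋n⦌ :=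
  Quot.mk _ (SSet.stdSimplex.objMk₁ i)

/-- The base point of the simplicial circle: the class of the vertex `⟨0⟩`. -/
def circlePt : circle _⦋0⦌ := circleSimplex 0 1

/-! ### Milnor's construction `F[X]` and its reduced quotient `K[X]` -/

section Constructions

variable (X : SSet.{0}) (x₀ : X _⦋0⦌)

/-- The base point in degree `n`, the iterated degeneracy `s₀ⁿ(x₀)`. -/
def basePt (n : SimplexCategoryᵒᵖ) : X.obj n :=
  X.map (SimplexCategory.const n.unop ⦋0⦌ 0).op x₀

lemma map_basePt {m n : SimplexCategoryᵒᵖ} (f : m ⟶ n) :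
    X.map f (basePt X x₀ m) = basePt X x₀ n := by
  simp only [basePt, ← Functor.map_comp_apply]
  rfl

/-- The group `F[X]_n`: generated by the `n`-simplices of `X`, with the single relation that
the base point is trivial. -/
abbrev MilnorGroup (n : SimplexCategoryᵒᵖ) : Type :=
  PresentedGroup ({FreeGroup.of (basePt X x₀ n)} : Set (FreeGroup (X.obj n)))

variable {X} in
/-- The generator of `F[X]_n` given by an `n`-simplex of `X`. -/
def gen {n : SimplexCategoryᵒᵖ} (x : X.obj n) : MilnorGroup X x₀ n := PresentedGroup.of x

/-- The homomorphism `F[X]_m → F[X]_n` which sends the generator `x` to `f^* x`. -/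
def milnorMap {m n : SimplexCategoryᵒᵖ} (f : m ⟶ n) :
    MilnorGroup X x₀ m →* MilnorGroup X x₀ n :=
  PresentedGroup.toGroup (f := fun x => gen x₀ (X.map f x)) (by
    rintro r rfl
    rw [FreeGroup.lift_apply_of, map_basePt]
    exact PresentedGroup.one_of_mem (Set.mem_singleton _))

@[simp]
lemma milnorMap_gen {m n : SimplexCategoryᵒᵖ} (f : m ⟶ n) (x : X.obj m) :
    milnorMap X x₀ f (gen x₀ x) = gen x₀ (X.map f x) :=
  PresentedGroup.toGroup.of _

/-- Milnor's simplicial group `F[X]` of a pointed simplicial set `(X, x₀)`. -/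
def milnor : SimplicialObject GrpCat.{0} where
  obj n := GrpCat.of (MilnorGroup X x₀ n)
  map f := GrpCat.ofHom (milnorMap X x₀ f)
  map_id n := by
    ext : 1
    refine PresentedGroup.ext fun x => ?_
    change milnorMap X x₀ (𝟙 n) (gen x₀ x) = gen x₀ x
    simp
  map_comp f g := by
    ext : 1
    refine PresentedGroup.ext fun x => ?_
    change milnorMap X x₀ (f ≫ g) (gen x₀ x) =
      milnorMap X x₀ g (milnorMap X x₀ f (gen x₀ x))
    simp

/-- The normal subgroup of `F[X]_n` generated by the commutators `[x, g x g⁻¹]`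
(with `[a, b] = a b a⁻¹ b⁻¹`), where `x` is a
generator and `g` is any element. -/
def reducedRel (n : SimplexCategoryᵒᵖ) : Subgroup (MilnorGroup X x₀ n) :=
  Subgroup.normalClosure
    {w | ∃ (x : X.obj n) (g : MilnorGroup X x₀ n),
      w = gen x₀ x * (g * gen x₀ x * g⁻¹) * (gen x₀ x)⁻¹ * (g * gen x₀ x * g⁻¹)⁻¹}

instance (n : SimplexCategoryᵒᵖ) : (reducedRel X x₀ n).Normal :=
  Subgroup.normalClosure_normal

lemma reducedRel_le_comap {m n : SimplexCategoryᵒᵖ} (f : m ⟶ n) :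
    reducedRel X x₀ m ≤ (reducedRel X x₀ n).comap (milnorMap X x₀ f) := by
  refine Subgroup.normalClosure_le_normal ?_
  rintro _ ⟨x, g, rfl⟩
  refine Subgroup.subset_normalClosure ⟨X.map f x, milnorMap X x₀ f g, ?_⟩
  simp

/-- The simplicial group `K[X]`, the degreewise quotient of `F[X]` by the relations
`[x, g x g⁻¹] = 1`. -/
def reduced : SimplicialObject GrpCat.{0} where
  obj n := GrpCat.of (MilnorGroup X x₀ n ⧸ reducedRel X x₀ n)
  map f := GrpCat.ofHom
    (QuotientGroup.map _ _ (milnorMap X x₀ f) (reducedRel_le_comap X x₀ f))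
  map_id n := by
    ext : 1
    refine QuotientGroup.monoidHom_ext _ ?_
    refine PresentedGroup.ext fun x => ?_
    change ((milnorMap X x₀ (𝟙 n) (gen x₀ x) : MilnorGroup X x₀ n) : _ ⧸ reducedRel X x₀ n) =
      (gen x₀ x : MilnorGroup X x₀ n)
    simp
  map_comp {l m n} f g := by
    ext : 1
    refine QuotientGroup.monoidHom_ext _ ?_
    refine PresentedGroup.ext fun x => ?_
    change ((milnorMap X x₀ (f ≫ g) (gen x₀ x) : MilnorGroup X x₀ n) : _ ⧸ reducedRel X x₀ n) =
      (milnorMap X x₀ g (milnorMap X x₀ f (gen x₀ x)) : MilnorGroup X x₀ n)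
    simp

/-- The quotient morphism `ρ : F[X] → K[X]`. -/
def quotientMap : milnor X x₀ ⟶ reduced X x₀ where
  app n := GrpCat.ofHom (QuotientGroup.mk' (reducedRel X x₀ n))
  naturality _ _ _ := rfl

end Constructions

/-! ### Simplicial groups: kernels, underlying simplicial sets, homotopy groups -/

section SimplicialGroups

variable {G H : SimplicialObject GrpCat.{0}}

/-- The kernel of a morphism of simplicial groups, formed degreewise. -/
def kernel (f : G ⟶ H) : SimplicialObject GrpCat.{0} where
  obj n := GrpCat.of (f.app n).hom.ker
  map {m n} a := GrpCat.ofHom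
    (((G.map a).hom.comp (f.app m).hom.ker.subtype).codRestrict (f.app n).hom.ker fun x => by
      have h := ConcreteCategory.congr_hom (f.naturality a) x.1
      have hx : (f.app m).hom x.1 = 1 := x.2
      change (f.app n).hom ((G.map a).hom x.1) = (H.map a).hom ((f.app m).hom x.1) at h
      rw [MonoidHom.mem_ker]
      change (f.app n).hom ((G.map a).hom x.1) = 1
      rw [h, hx, map_one])
  map_id n := by
    ext x
    change (G.map (𝟙 n)).hom x.1 = x.1
    simp
  map_comp a b := by
    ext x
    change (G.map (a ≫ b)).hom x.1 = (G.map b).hom ((G.map a).hom x.1)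
    simp

/-- The inclusion of the kernel. -/
def kernelι (f : G ⟶ H) : kernel f ⟶ G where
  app n := GrpCat.ofHom (f.app n).hom.ker.subtype
  naturality _ _ _ := rfl

/-- The map of underlying simplicial sets of a morphism of simplicial groups. -/
def toSSetMap (f : G ⟶ H) :
    ((SimplicialObject.whiskering GrpCat.{0} (Type 0)).obj (forget GrpCat.{0})).obj G ⟶
      ((SimplicialObject.whiskering GrpCat.{0} (Type 0)).obj (forget GrpCat.{0})).obj H :=
  ((SimplicialObject.whiskering GrpCat.{0} (Type 0)).obj (forget GrpCat.{0})).map f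

/-- A morphism of simplicial groups is a fibration if the underlying map of simplicial sets is a
Kan fibration, that is, it has the right lifting property with respect to all horn inclusions. -/
def IsKanFibration (f : G ⟶ H) : Prop :=
  SSet.modelCategoryQuillen.J.{0}.rlp (toSSetMap f)

variable (G) in
/-- The `n`-cycles of a simplicial group: the elements of `G_n` all of whose faces are trivial
(every element, for `n = 0`). -/
def cycles (n : ℕ) : Subgroup (G _⦋n⦌) :=
  match n with
  | 0 => ⊤
  | _ + 1 => ⨅ i, (G.δ i).hom.ker

variable (G) in
/-- The `n`-boundaries of a simplicial group: the elements `d₀ y`, where `y ∈ G_{n+1}` and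
`d_i y = 1` for all `i > 0`. -/
def boundaries (n : ℕ) : Subgroup (G _⦋n⦌) :=
  (⨅ i : Fin (n + 1), (G.δ i.succ).hom.ker).map (G.δ 0).hom

instance (n : ℕ) : (boundaries G n).Normal := by
  refine ⟨?_⟩
  rintro _ ⟨y, hy, rfl⟩ g
  have hg : (G.δ (0 : Fin (n + 2))).hom ((G.σ 0).hom g) = g :=
    ConcreteCategory.congr_hom (G.δ_comp_σ_self (i := (0 : Fin (n + 1)))) g
  refine ⟨(G.σ 0).hom g * y * ((G.σ 0).hom g)⁻¹, ?_, ?_⟩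
  · simp only [Subgroup.coe_iInf, Set.mem_iInter, SetLike.mem_coe, MonoidHom.mem_ker] at hy ⊢
    intro i
    simp [hy i]
  · simp only [map_mul, map_inv]
    rw [hg]

variable (G) in
/-- The homotopy group `π_n G` of a simplicial group: the homology in degree `n` of its Moore
complex. -/
abbrev HomotopyGroup (n : ℕ) : Type :=
  cycles G n ⧸ (boundaries G n).subgroupOf (cycles G n)

lemma cycles_le_comap (f : G ⟶ H) (n : ℕ) :
    cycles G n ≤ (cycles H n).comap (f.app (op ⦋n⦌)).hom := by
  cases n with
  | zero => exact fun _ _ => Subgroup.mem_top _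
  | succ n =>
    intro x hx
    simp only [cycles, Subgroup.mem_comap, Subgroup.mem_iInf, MonoidHom.mem_ker] at hx ⊢
    intro i
    have h := ConcreteCategory.congr_hom (SimplicialObject.δ_naturality f i) x
    exact h.symm.trans ((congrArg (f.app (op ⦋n⦌)).hom (hx i)).trans (map_one _))

lemma boundaries_le_comap (f : G ⟶ H) (n : ℕ) :
    boundaries G n ≤ (boundaries H n).comap (f.app (op ⦋n⦌)).hom := by
  rintro _ ⟨y, hy, rfl⟩
  have h := ConcreteCategory.congr_hom (SimplicialObject.δ_naturality f (0 : Fin (n + 2))) y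
  refine ⟨(f.app (op ⦋n + 1⦌)).hom y, ?_, h.symm⟩
  simp only [Subgroup.coe_iInf, Set.mem_iInter, SetLike.mem_coe, MonoidHom.mem_ker] at hy ⊢
  intro i
  have h' := ConcreteCategory.congr_hom (SimplicialObject.δ_naturality f i.succ) y
  exact h'.symm.trans ((congrArg (f.app (op ⦋n⦌)).hom (hy i)).trans (map_one _))

/-- The homomorphism of `n`-cycles induced by a morphism of simplicial groups. -/
def cyclesMap (f : G ⟶ H) (n : ℕ) : cycles G n →* cycles H n :=
  ((f.app (op ⦋n⦌)).hom.comp (cycles G n).subtype).codRestrict _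
    fun x => cycles_le_comap f n x.2

/-- The homomorphism `π_n(f) : π_n G → π_n H` induced by a morphism of simplicial groups. -/
def homotopyMap (f : G ⟶ H) (n : ℕ) : HomotopyGroup G n →* HomotopyGroup H n :=
  QuotientGroup.map _ _ (cyclesMap f n) fun _ hx => boundaries_le_comap f n hx

end SimplicialGroups

/-! ### The reduced free group `K_n` -/

/-- The normal subgroup `Λ_n` of the free group `F_n` generated by all `[x_i, g x_i g⁻¹]`,
where `[a, b] = a b a⁻¹ b⁻¹`. -/
def reducedFreeRel (n : ℕ) : Subgroup (FreeGroup (Fin n)) :=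
  Subgroup.normalClosure
    {w | ∃ (i : Fin n) (g : FreeGroup (Fin n)),
      w = FreeGroup.of i * (g * FreeGroup.of i * g⁻¹) * (FreeGroup.of i)⁻¹ *
        (g * FreeGroup.of i * g⁻¹)⁻¹}

instance (n : ℕ) : (reducedFreeRel n).Normal := Subgroup.normalClosure_normal

/-- The reduced free group `K_n = F_n / Λ_n`. -/
abbrev ReducedFreeGroup (n : ℕ) : Type := FreeGroup (Fin n) ⧸ reducedFreeRel n

/-! ### The abelian groups `Lie(n)` -/

/-- The left-normed bracket `[[…[[a₁, a₂], a₃], …], a_k]` of a list of elements. -/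
def leftNormed {L : Type} [LieRing L] (l : List L) : L :=
  match l with
  | [] => 0
  | a :: l => l.foldl (fun x y => ⁅x, y⁆) a

/-- `Lie(n)`: the multilinear part of the free Lie ring on `x_1, …, x_n`, that is, the subgroup
spanned by the brackets `[[…[x_{σ(1)}, x_{σ(2)}], …], x_{σ(n)}]` for `σ` in the symmetric
group. -/
def LieMultilinear (n : ℕ) : Submodule ℤ (FreeLieAlgebra ℤ (Fin n)) :=
  Submodule.span ℤ (Set.range fun σ : Equiv.Perm (Fin n) =>
    leftNormed (List.ofFn fun i => FreeLieAlgebra.of ℤ (σ i)))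

/-! ### Pure braid groups -/

/-- Artin's relations on `σ_1, …, σ_{n-1}`; the index `i : Fin (n - 1)` stands for `σ_{i+1}`. -/
def braidRels (n : ℕ) : Set (FreeGroup (Fin (n - 1))) :=
  {w | ∃ i j : Fin (n - 1), i.1 + 2 ≤ j.1 ∧
      w = FreeGroup.of i * FreeGroup.of j * (FreeGroup.of j * FreeGroup.of i)⁻¹} ∪
  {w | ∃ i j : Fin (n - 1), i.1 + 1 = j.1 ∧
      w = FreeGroup.of i * FreeGroup.of j * FreeGroup.of i *
        (FreeGroup.of j * FreeGroup.of i * FreeGroup.of j)⁻¹}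

/-- The braid group `B_n` on `n` strands. -/
abbrev BraidGroup (n : ℕ) : Type := PresentedGroup (braidRels n)

/-- The transposition of `i` and `i + 1`. -/
def adjSwap (n : ℕ) (i : Fin (n - 1)) : Equiv.Perm (Fin n) :=
  Equiv.swap ⟨i.1, by omega⟩ ⟨i.1 + 1, by omega⟩

lemma adjSwap_rels (n : ℕ) : ∀ r ∈ braidRels n, FreeGroup.lift (adjSwap n) r = 1 := by
  rintro r (⟨i, j, hij, rfl⟩ | ⟨i, j, hij, rfl⟩)
  · simp only [map_mul, map_inv, FreeGroup.lift_apply_of, mul_inv_eq_one]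
    ext k
    simp only [adjSwap, Equiv.Perm.mul_apply, Equiv.swap_apply_def]
    grind
  · simp only [map_mul, map_inv, FreeGroup.lift_apply_of, mul_inv_eq_one]
    ext k
    simp only [adjSwap, Equiv.Perm.mul_apply, Equiv.swap_apply_def]
    grind

/-- The natural homomorphism from the braid group to the symmetric group. -/
def braidToPerm (n : ℕ) : BraidGroup n →* Equiv.Perm (Fin n) :=
  PresentedGroup.toGroup (adjSwap_rels n)

/-- The pure braid group `P_n`, the kernel of `B_n → Σ_n`. -/
abbrev PureBraidGroup (n : ℕ) : Type := (braidToPerm n).ker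

/-! ### The objects of the theorem -/

/-- The simplicial group `F[S¹]`. -/
abbrev FS1 : SimplicialObject GrpCat.{0} := milnor circle circlePt

/-- The simplicial group `K[S¹]`. -/
abbrev KS1 : SimplicialObject GrpCat.{0} := reduced circle circlePt

/-- The quotient morphism `ρ : F[S¹] → K[S¹]`. -/
abbrev rho : FS1 ⟶ KS1 := quotientMap circle circlePt

/-- The simplicial group `Γ[S¹]`, the kernel of `ρ`. -/
abbrev GammaS1 : SimplicialObject GrpCat.{0} := kernel rho

end FreeToK

end

/-! The Moore complex of $K[S^1]$ can be computed completely by the Magnus expansion, in which $x_a$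
acts on noncommutative power series as $1+a$. Coefficients at words without repeated letters depend
only on the class in $K_n$ (`reducedFreeRel_le_fixSubgroup`). Each face is a partial map of letters:
an inner face merges two neighbouring letters, an outer face deletes the first or the last letter.
If a face of $w$ is trivial, then the sum of the coefficients of $w$ over each fibre of this map
vanishes (`sum_magnus_eq_zero`). For a Moore chain this kills every coefficient at a nonempty
repetition-free word which misses a letter (`magnus_eq_zero_of_notMem`). Moore chains of $K[S^1]$
lie in the normal closure of the last generator. That normal closure is abelian and generated by the
iterated commutators $[x_{u_1},[x_{u_2},\dots,x_z]]$, and these are dual to the coefficients at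
words ending in $z$ (`lastCoeff_commWord`, `eq_one_of_reducedCoeff`). So the Moore chains in degree
$n$ are free abelian on the $(n-1)!$ commutators which use every letter once. Every face kills such
a commutator, because it deletes a letter or identifies two. Hence the differential is zero
(`reducedMoore_eq_reducedCycles`), and $\pi_nK[S^1]$ is the group of Moore chains.

The isomorphisms with $\mathrm{Lie}(n)$ and with braid homology come from comparing ranks. In
$\mathrm{Lie}(n)$ the left-normed brackets which begin with one fixed letter form a basis
(`lieMultilinear_equiv`). For braids, $P_{n+1}\cong F_n\rtimes P_n$ (`pureBraidEquiv`), with trivial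
action on the abelianization of $F_n$. The sequence $0\to I\to\mathbb Z[F]\to\mathbb Z\to 0$ then
gives $H_n(P_{n+1})\cong H_{n-1}(P_n)^n$ (`homology_semidirect`): both $I$ and $\mathbb Z[F]$ are
acyclic over $F$, with coinvariants $F^{ab}$ and $\mathbb Z$. The passage to coinvariants rests on
dimension shifting (`isIso_coinf`) and needs no spectral sequence.

For the vanishing of $\pi_n(\rho)$, let $w$ be a cycle of $F[S^1]$. Its multilinear coefficients are
alternating (`magnus_ofFn_perm`), so they all equal $\pm c$. Sending $x_a$ to $1+e_a$ in the
exterior algebra gives a group of class at most two. This representation factors through $K_n$ and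
for $n>2$ kills the commutators in all letters, hence kills $w$. Its top coefficient on $w$ is
$n!\,c$, so $c=0$ and $w$ dies in $K_n$. In degree $1$ there are no relations, and in degree $2$ the
relations $\Lambda_2$ are boundaries by two explicit Moore chains. Finally $\rho$ is a fibration by
Moore's filling argument, and its long exact sequence breaks into short ones because $\rho$ kills
the cycles in degrees $n$ and $n+1$ (`exists_exact_of_cycles`). -/

noncomputable section

namespace FreeToK

/-! ### Relatively projective representations have no higher homology -/

section RelProj

open Finsupp

variable {k G : Type} [CommRing k]

/-- A representation is relatively projective if it is a retract of the representation induced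
from the underlying module. -/
def IsRelProj [Group G] {V : Type} [AddCommGroup V] [Module k V] (ρ : Representation k G V) :
    Prop :=
  ∃ P : V →ₗ[k] (G →₀ V), (∀ (h : G) (a : V), P (ρ h a) = (P a).mapDomain (· * h⁻¹)) ∧
    ∀ a, (P a).sum (fun g b => ρ g⁻¹ b) = a

/-- The contracting homotopy of the complex of inhomogeneous chains given by a linear map
`V → (G →₀ V)`. -/
def chainContraction {V : Type} [AddCommGroup V] [Module k V] (P : V →ₗ[k] (G →₀ V)) (n : ℕ) :
    ((Fin n → G) →₀ V) →ₗ[k] ((Fin (n + 1) → G) →₀ V) :=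
  lsum (R := k) k fun g =>
    lmapDomain V k (fun x => (Fin.cons x g : Fin (n + 1) → G)) ∘ₗ P

lemma chainContraction_single {V : Type} [AddCommGroup V] [Module k V] (P : V →ₗ[k] (G →₀ V))
    (n : ℕ) (g : Fin n → G) (a : V) :
    chainContraction P n (single g a) =
      (P a).mapDomain (fun x => (Fin.cons x g : Fin (n + 1) → G)) := by
  simp [chainContraction]

variable [Group G]

lemma contractNth_zero_cons {n : ℕ} (x : G) (g : Fin (n + 1) → G) :
    Fin.contractNth (0 : Fin (n + 2)) (· * ·) (Fin.cons x g : Fin (n + 2) → G) =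
      Fin.cons (x * g 0) (fun i => g i.succ) := by
  funext i
  refine Fin.cases ?_ (fun i => ?_) i
  · simp [Fin.contractNth]
  · simp [Fin.contractNth]

lemma contractNth_succ_cons {n : ℕ} (x : G) (g : Fin (n + 1) → G) (j : Fin (n + 1)) :
    Fin.contractNth j.succ (· * ·) (Fin.cons x g : Fin (n + 2) → G) =
      Fin.cons x (Fin.contractNth j (· * ·) g) := by
  funext i
  refine Fin.cases ?_ (fun i => ?_) i
  · simp [Fin.contractNth]
  · simp only [Fin.contractNth, Fin.val_succ, Fin.cons_succ, Fin.castSucc_succ]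
    simp

/-- The differential of chains with a new first entry `x` splits into three kinds of terms: `x` is
dropped and acts on the coefficient, `x` is merged with `g 0`, or `x` is untouched. -/
lemma d_mapDomain_cons (A : Rep k G) (n : ℕ) (g : Fin (n + 1) → G) (q : G →₀ A) :
    groupHomology.inhomogeneousChains.d A (n + 1)
        (q.mapDomain (fun x => (Fin.cons x g : Fin (n + 2) → G))) =
      single g (q.sum fun x b => A.ρ x⁻¹ b) -
        q.mapDomain (fun x => (Fin.cons (x * g 0) (fun i => g i.succ) : Fin (n + 1) → G)) -
        ∑ j : Fin (n + 1), (-1 : k) ^ ((j : ℕ) + 1) •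
          q.mapDomain (fun x => (Fin.cons x (Fin.contractNth j (· * ·) g) : Fin (n + 1) → G)) := by
  induction q using Finsupp.induction_linear with
  | zero => simp
  | add p q hp hq =>
    rw [mapDomain_add, map_add, hp, hq, Finsupp.sum_add_index' (by simp) (by simp)]
    simp only [mapDomain_add, smul_add, Finset.sum_add_distrib, single_add]
    abel
  | single x b =>
    simp only [mapDomain_single]
    erw [groupHomology.inhomogeneousChains.d_single]
    rw [Fin.sum_univ_succ]
    simp only [contractNth_zero_cons, contractNth_succ_cons, Fin.cons_zero, Fin.cons_succ]
    simp [pow_succ, Finset.sum_neg_distrib]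
    abel

/-- Dropping the new entry gives back the chain because `P` is a section. Merging it with `g 0`
cancels the leading term of the other composite because `P` is equivariant. The remaining terms
cancel by sign. -/
lemma d_chainContraction (A : Rep k G) (P : A →ₗ[k] (G →₀ A))
    (hP : ∀ (h : G) (a : A), P (A.ρ h a) = (P a).mapDomain (· * h⁻¹))
    (hP' : ∀ a, (P a).sum (fun g b => A.ρ g⁻¹ b) = a) (n : ℕ) (c : (Fin (n + 1) → G) →₀ A) :
    groupHomology.inhomogeneousChains.d A (n + 1) (chainContraction P (n + 1) c) +
      chainContraction P n (groupHomology.inhomogeneousChains.d A n c) = c := by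
  induction c using Finsupp.induction_linear with
  | zero => simp
  | add p q hp hq =>
    nth_rw 3 [← hp, ← hq]
    simp only [map_add]
    abel
  | single g a =>
    rw [chainContraction_single, d_mapDomain_cons, hP']
    erw [groupHomology.inhomogeneousChains.d_single]
    rw [map_add, map_sum]
    simp only [map_smul, chainContraction_single, hP, ← mapDomain_comp, inv_inv]
    simp [Function.comp_def]

lemma isZero_groupHomology_of_isRelProj (A : Rep k G) (hA : IsRelProj A.ρ) (n : ℕ) :
    Limits.IsZero (groupHomology A (n + 1)) := by
  obtain ⟨P, hP, hP'⟩ := hA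
  refine (HomologicalComplex.exactAt_iff_isZero_homology _ _).1 ?_
  rw [HomologicalComplex.exactAt_iff' _ (n + 2) (n + 1) n (by simp) (by simp),
    ShortComplex.moduleCat_exact_iff]
  intro x hx
  refine ⟨chainContraction P (n + 1) x, ?_⟩
  have h := d_chainContraction A P hP hP' n x
  have hx' : groupHomology.inhomogeneousChains.d A n x = 0 := by
    rw [← groupHomology.inhomogeneousChains.d_def]; exact hx
  rw [hx', map_zero, add_zero] at h
  refine Eq.trans ?_ h
  rw [← groupHomology.inhomogeneousChains.d_def]
  rfl

end RelProj

end FreeToK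
end

noncomputable section

namespace FreeToK

/-! ### Coinflation is an isomorphism for representations acyclic over the normal subgroup -/

section Coinflation

open Finsupp Limits

variable {k G : Type} [CommRing k] [Group G]

/-- The representation on `G →₀ V` which is induced from the module `V`. -/
def coverRep (G V : Type) [Group G] [AddCommGroup V] [Module k V] :
    Representation k G (G →₀ V) where
  toFun h := lmapDomain V k (· * h⁻¹)
  map_one' := by
    ext x v : 2
    simp
  map_mul' h h' := by
    ext x v : 2
    simp [mul_assoc]

@[simp]
lemma coverRep_single {V : Type} [AddCommGroup V] [Module k V] (h x : G) (v : V) :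
    coverRep (k := k) G V h (single x v) = single (x * h⁻¹) v := by
  simp [coverRep]

lemma coverRep_isRelProj (V : Type) [AddCommGroup V] [Module k V] :
    IsRelProj (coverRep (k := k) G V) := by
  refine ⟨lsum (R := k) k fun x => lsingle x ∘ₗ lsingle 1, fun h a => ?_, fun a => ?_⟩
  · induction a using Finsupp.induction_linear with
    | zero => simp
    | add p q hp hq => simp only [map_add, hp, hq, mapDomain_add]
    | single x v => simp [mapDomain_single]
  · induction a using Finsupp.induction_linear with
    | zero => simp
    | add p q hp hq =>
      rw [map_add, Finsupp.sum_add_index' (by simp) (by simp), hp, hq]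
    | single x v => simp

variable (S : Subgroup G)

/-- Over a subgroup an induced representation is still induced: `G` is the union of the cosets `t
S`, and the representatives `t x` absorb the rest into the coefficients. -/
lemma coverRep_restrict_isRelProj (V : Type) [AddCommGroup V] [Module k V] :
    IsRelProj ((coverRep (k := k) G V).comp S.subtype) := by
  classical
  let t : G → G := fun x => (QuotientGroup.mk x : G ⧸ S).out
  have ht : ∀ x, (t x)⁻¹ * x ∈ S := fun x =>
    QuotientGroup.eq.1 (QuotientGroup.out_eq' (QuotientGroup.mk x : G ⧸ S))
  have ht' : ∀ x, ∀ s ∈ S, t (x * s) = t x := fun x s hs => by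
    have : (QuotientGroup.mk (x * s) : G ⧸ S) = QuotientGroup.mk x := by
      rw [eq_comm, QuotientGroup.eq]; simpa using hs
    simp only [t, this]
  -- Writing `x = t x * s` with `s` in `S`, the section sends `x ⊗ v` to `s ⊗ (t x ⊗ v)`.
  refine ⟨lsum (R := k) k fun x => lsingle ⟨(t x)⁻¹ * x, ht x⟩ ∘ₗ lsingle (t x),
    fun h a => ?_, fun a => ?_⟩
  · induction a using Finsupp.induction_linear with
    | zero => simp
    | add p q hp hq => simp only [map_add, hp, hq, mapDomain_add]
    | single x v =>
      have h1 := ht' x _ (S.inv_mem h.2)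
      simp only [MonoidHom.coe_comp, Function.comp_apply, Subgroup.subtype_apply,
        coverRep_single, lsum_single, LinearMap.comp_apply, lsingle_apply, mapDomain_single]
      congr 1
      · ext; simp [h1, mul_assoc]
      · rw [h1]
  · induction a using Finsupp.induction_linear with
    | zero => simp
    | add p q hp hq =>
      rw [map_add, Finsupp.sum_add_index' (by simp) (by simp), hp, hq]
    | single x v => simp

/-- The rep. `G →₀ A` as an object of `Rep k G`. -/
abbrev cover (A : Rep k G) : Rep k G := Rep.of (coverRep (k := k) G A)

/-- The canonical surjection `G →₀ A → A`. -/
def coverMap (A : Rep k G) : cover A ⟶ A :=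
  Rep.ofHom ⟨lsum (R := k) k fun x => A.ρ x⁻¹, fun h => by
    ext x v : 2
    simp⟩

lemma coverMap_single (A : Rep k G) (x : G) (v : A) :
    (coverMap A).hom (single x v) = A.ρ x⁻¹ v := by
  simp [coverMap]

instance (A : Rep k G) : Epi (coverMap A) :=
  (Rep.epi_iff_surjective _).2 fun a => ⟨single 1 a, by
    have := coverMap_single A 1 a
    simpa using this⟩

/-- The short exact sequence `0 → A' → (G →₀ A) → A → 0`. -/
def coverSeq (A : Rep k G) : ShortComplex (Rep k G) :=
  ShortComplex.mk (kernel.ι (coverMap A)) (coverMap A) (kernel.condition _)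

lemma coverSeq_shortExact (A : Rep k G) : (coverSeq A).ShortExact where
  exact := ShortComplex.exact_kernel _
  mono_f := by dsimp [coverSeq]; infer_instance
  epi_g := by dsimp [coverSeq]; infer_instance

/-- A representation of `G` is acyclic over the subgroup `S` if its homology over `S` vanishes in
positive degrees. -/
def IsAcyclicOver (A : Rep k G) : Prop :=
  ∀ n : ℕ, IsZero (groupHomology (Rep.res S.subtype A) (n + 1))

lemma isAcyclicOver_cover (A : Rep k G) : IsAcyclicOver S (cover A) := fun n =>
  isZero_groupHomology_of_isRelProj _ (coverRep_restrict_isRelProj S A) n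

/-- The kernel sits between a group one degree higher for `A` and one for the cover, both zero. This
is what allows dimension shifting to be iterated. -/
lemma isAcyclicOver_kernel (A : Rep k G) (hA : IsAcyclicOver S A) :
    IsAcyclicOver S (coverSeq A).X₁ := fun n => by
  have h := (Rep.shortExact_res S.subtype).2 (coverSeq_shortExact A)
  have h1 := groupHomology.mapShortComplex₁_exact h (i := n + 2) (j := n + 1) rfl
  exact h1.isZero_X₂ ((hA (n + 1)).eq_of_src _ _) ((isAcyclicOver_cover S A n).eq_of_tgt _ _)

variable [S.Normal]

/-- The coinvariants of `G →₀ A` under `S` are again induced, now from the trivial subgroup of `G ⧸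
S`. The section sends the class of `x ⊗ v` to the coset of `x` tensored with the class of `1 ⊗ v`.
-/
lemma coverRep_coinvariants_isRelProj (A : Rep k G) :
    IsRelProj ((cover A).quotientToCoinvariants S).ρ := by
  let Q : (G →₀ A) →ₗ[k] ((G ⧸ S) →₀ ((cover A).quotientToCoinvariants S).V) :=
    lsum (R := k) k fun x => lsingle (QuotientGroup.mk x) ∘ₗ
      Representation.Coinvariants.mk ((coverRep (k := k) G A).comp S.subtype) ∘ₗ lsingle 1
  have hQ : ∀ x v, Q (single x v) = single (QuotientGroup.mk x : G ⧸ S)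
      (Representation.Coinvariants.mk ((coverRep (k := k) G A).comp S.subtype) (single 1 v)) :=
    fun x v => by simp [Q]
  refine ⟨Representation.Coinvariants.lift _ Q fun s => ?_, fun h a => ?_, fun a => ?_⟩
  · ext x v : 2
    simp only [LinearMap.comp_apply, lsingle_apply, MonoidHom.comp_apply, Subgroup.subtype_apply,
      coverRep_single, hQ]
    congr 1
    rw [eq_comm, QuotientGroup.eq]
    simp
  · induction h using QuotientGroup.induction_on with | _ h
    obtain ⟨a, rfl⟩ := Representation.Coinvariants.mk_surjective _ a
    change Q (coverRep G A h a) = mapDomain _ (Q a)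
    induction a using Finsupp.induction_linear with
    | zero => simp
    | add p q hp hq => simp only [map_add, hp, hq, mapDomain_add]
    | single x v =>
      simp only [coverRep_single, hQ, mapDomain_single]
      rfl
  · obtain ⟨a, rfl⟩ := Representation.Coinvariants.mk_surjective _ a
    change (Q a).sum _ = _
    induction a using Finsupp.induction_linear with
    | zero => simp
    | add p q hp hq =>
      rw [map_add, Finsupp.sum_add_index' (by simp) (by simp), hp, hq, map_add]
    | single x v =>
      rw [hQ, Finsupp.sum_single_index (by simp)]
      change Representation.Coinvariants.mk _ (coverRep G A x⁻¹ (single 1 v)) = _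
      simp

lemma chainsMap_comp_of_comm {H : Type} [Group H] {A B : Rep k G} {C D : Rep k H} (π : G →* H)
    (f : A ⟶ B) (f' : C ⟶ D) (φ : A ⟶ Rep.res π C) (ψ : B ⟶ Rep.res π D)
    (h : ∀ a, ψ.hom (f.hom a) = f'.hom (φ.hom a)) :
    groupHomology.chainsMap (MonoidHom.id G) f ≫ groupHomology.chainsMap π ψ =
      groupHomology.chainsMap π φ ≫ groupHomology.chainsMap (MonoidHom.id H) f' := by
  refine HomologicalComplex.hom_ext _ _ fun n => ?_
  refine groupHomology.inhomogeneousChains.ext fun g => ?_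
  refine ModuleCat.hom_ext (LinearMap.ext fun a => ?_)
  have h1 := groupHomology.chainsMap_f_single (MonoidHom.id G) f n g a
  have h2 := groupHomology.chainsMap_f_single π ψ n (MonoidHom.id G ∘ g) (f.hom a)
  have h3 := groupHomology.chainsMap_f_single π φ n g a
  have h4 := groupHomology.chainsMap_f_single (MonoidHom.id H) f' n (π ∘ g) (φ.hom a)
  refine ((congrArg ((groupHomology.chainsMap π ψ).f n).hom h1).trans h2).trans ?_
  refine Eq.trans ?_ ((congrArg ((groupHomology.chainsMap (MonoidHom.id H) f').f n).hom h3).trans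
    h4).symm
  rw [h]
  rfl

/-- The quotient map from a representation to its coinvariants under a normal subgroup. -/
def coinfMk (A : Rep k G) :
    A ⟶ Rep.res (QuotientGroup.mk' S) ((Rep.quotientToCoinvariantsFunctor k S).obj A) :=
  Rep.toCoinvariantsMkQ A S

/-- The morphism of complexes inducing coinflation. -/
def coinfChains : groupHomology.chainsFunctor k G ⟶
    Rep.quotientToCoinvariantsFunctor k S ⋙ groupHomology.chainsFunctor k (G ⧸ S) where
  app A := groupHomology.chainsMap (QuotientGroup.mk' S) (coinfMk S A)
  naturality A B f := chainsMap_comp_of_comm (QuotientGroup.mk' S) f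
    ((Rep.quotientToCoinvariantsFunctor k S).map f) (coinfMk S A) (coinfMk S B) fun _ => rfl

instance : (Rep.quotientToCoinvariantsFunctor k S).PreservesZeroMorphisms where
  map_zero A B := by
    refine Rep.hom_ext (DFunLike.ext _ _ fun x => ?_)
    obtain ⟨x, rfl⟩ := Representation.Coinvariants.mk_surjective _ x
    exact map_zero (Representation.Coinvariants.mk (B.ρ.comp S.subtype))

lemma coinvariantsMap_injective_of_isZero {X : ShortComplex (Rep k G)} (hX : X.ShortExact)
    (h : IsZero (groupHomology X.X₃ 1)) :
    Mono ((Rep.coinvariantsFunctor k G).map X.f) := by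
  have h1 := (groupHomology.mapShortComplex₁_exact hX (i := 1) (j := 0) rfl).mono_g
    (h.eq_of_src _ _)
  have h2 : Mono (groupHomology.map (MonoidHom.id G) X.f 0) := h1
  have h3 := groupHomology.map_id_comp_H0Iso_hom X.f
  rw [← Iso.inv_comp_eq] at h3
  rw [← h3]
  infer_instance

lemma mk_eq_zero_iff_of_H1 {X : ShortComplex (Rep k G)} (hX : X.ShortExact)
    (h : IsZero (groupHomology (Rep.res S.subtype X.X₃) 1)) :
    Function.Injective ((Rep.quotientToCoinvariantsFunctor k S).map X.f).hom := by
  have hX' := (Rep.shortExact_res S.subtype).2 hX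
  exact (ModuleCat.mono_iff_injective _).1 (coinvariantsMap_injective_of_isZero hX' h)

/-- Coinvariants are right exact; the only obstruction to injectivity on the left is the first
homology of `S` with coefficients in the third term. -/
lemma coinvariants_shortExact {X : ShortComplex (Rep k G)} (hX : X.ShortExact)
    (h : IsZero (groupHomology (Rep.res S.subtype X.X₃) 1)) :
    (X.map (Rep.quotientToCoinvariantsFunctor k S)).ShortExact where
  mono_f := (Rep.mono_iff_injective _).2 (mk_eq_zero_iff_of_H1 S hX h)
  epi_g := (Rep.epi_iff_surjective _).2 fun y => by
    obtain ⟨y, rfl⟩ := Representation.Coinvariants.mk_surjective _ y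
    obtain ⟨x, rfl⟩ := (Rep.epi_iff_surjective _).1 hX.epi_g y
    exact ⟨Representation.Coinvariants.mk _ x, rfl⟩
  exact := by
    refine (forget₂ (Rep k (G ⧸ S)) (ModuleCat k)).reflects_exact_of_faithful _ ?_
    refine (ShortComplex.moduleCat_exact_iff _).2 fun y hy => ?_
    obtain ⟨y, rfl⟩ := Representation.Coinvariants.mk_surjective _ y
    have hy' : X.g.hom y ∈ Representation.Coinvariants.ker (X.X₃.ρ.comp S.subtype) :=
      (Representation.Coinvariants.mk_eq_zero _).1 hy
    have hex := (ShortComplex.moduleCat_exact_iff _).1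
      (hX.exact.map (forget₂ (Rep k G) (ModuleCat k)))
    have key : Representation.Coinvariants.ker (X.X₃.ρ.comp S.subtype) ≤
        (Representation.Coinvariants.ker (X.X₂.ρ.comp S.subtype)).map X.g.hom.toLinearMap := by
      refine Submodule.span_le.2 ?_
      rintro _ ⟨⟨s, z⟩, rfl⟩
      obtain ⟨x, rfl⟩ := (Rep.epi_iff_surjective _).1 hX.epi_g z
      refine ⟨_, Representation.Coinvariants.sub_mem_ker s x, ?_⟩
      have := Rep.hom_comm_apply X.g (s : G) x
      simpa using this
    obtain ⟨z, hz, hzy⟩ := key hy'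
    obtain ⟨w, hw⟩ := hex (y - z) (by
      have : X.g.hom z = X.g.hom y := hzy
      change X.g.hom (y - z) = 0
      rw [map_sub, this, sub_self])
    refine ⟨Representation.Coinvariants.mk _ w, ?_⟩
    change Representation.Coinvariants.mk _ (X.f.hom w) = _
    refine (Representation.Coinvariants.mk_eq_iff _).2 ?_
    have hw' : X.f.hom w = y - z := hw
    rw [hw']
    simpa using hz

/-- Coinvariants may be taken in two stages, first under `S` and then under `G ⧸ S`; this is the
injectivity half. -/
lemma mem_ker_of_mk_mem_ker (A : Rep k G) (a : A)
    (h : (coinfMk S A).hom a ∈ Representation.Coinvariants.ker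
      ((Rep.quotientToCoinvariantsFunctor k S).obj A).ρ) :
    a ∈ Representation.Coinvariants.ker A.ρ := by
  have key : Representation.Coinvariants.ker ((Rep.quotientToCoinvariantsFunctor k S).obj A).ρ ≤
      (Representation.Coinvariants.ker A.ρ).map (coinfMk S A).hom.toLinearMap := by
    refine Submodule.span_le.2 ?_
    rintro _ ⟨⟨g, z⟩, rfl⟩
    induction g using QuotientGroup.induction_on with | _ g
    obtain ⟨x, rfl⟩ := Representation.Coinvariants.mk_surjective _ z
    exact ⟨_, Representation.Coinvariants.sub_mem_ker g x, rfl⟩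
  obtain ⟨c, hc, hca⟩ := key h
  have h1 : a - c ∈ Representation.Coinvariants.ker (A.ρ.comp S.subtype) :=
    (Representation.Coinvariants.mk_eq_iff _).1 hca.symm
  have h2 : Representation.Coinvariants.ker (A.ρ.comp S.subtype) ≤
      Representation.Coinvariants.ker A.ρ := by
    refine Submodule.span_le.2 ?_
    rintro _ ⟨⟨g, z⟩, rfl⟩
    exact Representation.Coinvariants.sub_mem_ker (g : G) z
  have := add_mem (h2 h1) hc
  simpa using this

lemma H0π_surjective (A : Rep k G) : Function.Surjective (groupHomology.H0π A) :=
  (ModuleCat.epi_iff_surjective _).1 inferInstance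

lemma H0π_eq_zero_iff (A : Rep k G) (a : A) :
    groupHomology.H0π A a = 0 ↔ a ∈ Representation.Coinvariants.ker A.ρ := by
  rw [← Representation.Coinvariants.mk_eq_zero]
  have h := ConcreteCategory.congr_hom (groupHomology.H0π_comp_H0Iso_hom A) a
  have h' : (groupHomology.H0Iso A).hom (groupHomology.H0π A a) =
    Representation.Coinvariants.mk A.ρ a := h
  rw [← h']
  have hi : Function.Injective (groupHomology.H0Iso A).hom :=
    (ModuleCat.mono_iff_injective _).1 inferInstance
  exact (map_eq_zero_iff (groupHomology.H0Iso A).hom.hom hi).symm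

/-- Coinflation in degree `0` is an isomorphism. -/
lemma isIso_coinf_zero (A : Rep k G) :
    IsIso (HomologicalComplex.homologyMap ((coinfChains S).app A) 0) := by
  have hcomm : ∀ a : A, groupHomology.map (QuotientGroup.mk' S) (coinfMk S A) 0
      (groupHomology.H0π A a) = groupHomology.H0π _ ((coinfMk S A).hom a) := fun a =>
    ConcreteCategory.congr_hom
      (groupHomology.H0π_comp_map (QuotientGroup.mk' S) (coinfMk S A)) a
  have hb : Function.Bijective (groupHomology.map (QuotientGroup.mk' S) (coinfMk S A) 0) := by
    constructor
    · refine (injective_iff_map_eq_zero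
        (groupHomology.map (QuotientGroup.mk' S) (coinfMk S A) 0).hom).2 fun x hx => ?_
      obtain ⟨a, rfl⟩ := H0π_surjective A x
      rw [H0π_eq_zero_iff]
      refine mem_ker_of_mk_mem_ker S A a ((H0π_eq_zero_iff _ _).1 ?_)
      rw [← hcomm]
      exact hx
    · intro y
      obtain ⟨b, rfl⟩ := H0π_surjective _ y
      obtain ⟨a, rfl⟩ := Representation.Coinvariants.mk_surjective _ b
      exact ⟨groupHomology.H0π A a, hcomm a⟩
  exact (ConcreteCategory.isIso_iff_bijective _).2 hb

/-- Dimension shifting: the sequence from the kernel through the cover to `A` stays exact after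
coinvariants, and the cover has no higher homology over `G`, nor its coinvariants over `G ⧸ S`. The
five lemma then compares the two long exact sequences. -/
lemma isIso_coinf (n : ℕ) : ∀ A : Rep k G, IsAcyclicOver S A →
    IsIso (HomologicalComplex.homologyMap ((coinfChains S).app A) n) := by
  induction n with
  | zero => exact fun A _ => isIso_coinf_zero S A
  | succ n ih =>
    have hcov : ∀ (A : Rep k G) (j : ℕ),
        IsIso (HomologicalComplex.homologyMap ((coinfChains S).app (cover A)) j) := by
      intro A j
      cases j with
      | zero => exact isIso_coinf_zero S _
      | succ j =>
        have h1 : IsZero (groupHomology (cover A) (j + 1)) :=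
          isZero_groupHomology_of_isRelProj _ (coverRep_isRelProj A) j
        have h2 : IsZero (groupHomology ((cover A).quotientToCoinvariants S) (j + 1)) :=
          isZero_groupHomology_of_isRelProj _ (coverRep_coinvariants_isRelProj S A) j
        exact h1.isIso h2 _
    -- Surjectivity in degree `n + 1` comes first, for all acyclic coefficients at once: the five
    -- lemma for bijectivity at `A` uses it for the kernel in the same degree.
    have hseq : ∀ A : Rep k G, IsAcyclicOver S A →
        Epi (HomologicalComplex.homologyMap ((coinfChains S).app A) (n + 1)) := by
      intro A hA
      have e1 := groupHomology.map_chainsFunctor_shortExact (coverSeq_shortExact A)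
      have e2 := groupHomology.map_chainsFunctor_shortExact
        (coinvariants_shortExact S (coverSeq_shortExact A) (hA 0))
      refine HomologicalComplex.HomologySequence.epi_homologyMap_τ₃
        ((coverSeq A).mapNatTrans (coinfChains S)) e1 e2 (n + 1) ?_ ?_ ?_
      · exact @IsIso.epi_of_iso _ _ _ _ _ (hcov A (n + 1))
      · intro j hj
        obtain rfl : j = n := by simpa using hj
        exact @IsIso.epi_of_iso _ _ _ _ _ (ih _ (isAcyclicOver_kernel S A hA))
      · intro j _
        exact @IsIso.mono_of_iso _ _ _ _ _ (hcov A j)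
    intro A hA
    have e1 := groupHomology.map_chainsFunctor_shortExact (coverSeq_shortExact A)
    have e2 := groupHomology.map_chainsFunctor_shortExact
      (coinvariants_shortExact S (coverSeq_shortExact A) (hA 0))
    refine HomologicalComplex.HomologySequence.isIso_homologyMap_τ₃
      ((coverSeq A).mapNatTrans (coinfChains S)) e1 e2 (n + 1) ?_ ?_ ?_ ?_
    · exact hseq _ (isAcyclicOver_kernel S A hA)
    · exact hcov A (n + 1)
    · intro j hj
      obtain rfl : j = n := by simpa using hj
      exact ih _ (isAcyclicOver_kernel S A hA)
    · intro j _
      exact @IsIso.mono_of_iso _ _ _ _ _ (hcov A j)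

end Coinflation

end FreeToK
end

noncomputable section

namespace FreeToK

/-! ### Homology of a semidirect product with a free group -/

section CrossedHom

variable {ι k V : Type} [CommRing k] [AddCommGroup V] [Module k V]

/-- The affine action of a free group determined by a linear action and the values of a crossed
homomorphism on the generators. -/
def affineAction (ρ : Representation k (FreeGroup ι) V) (d : ι → V) :
    FreeGroup ι →* Equiv.Perm V :=
  FreeGroup.lift fun i =>
    { toFun := fun w => d i + ρ (FreeGroup.of i) w
      invFun := fun w => ρ (FreeGroup.of i)⁻¹ (w - d i)
      left_inv := fun w => by simp
      right_inv := fun w => by simp }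

/-- Every `f` acts by an affine map with linear part `ρ f`. Its translation part is the crossed
homomorphism, so the universal property for homomorphisms also yields one for crossed homomorphisms.
-/
lemma affineAction_apply (ρ : Representation k (FreeGroup ι) V) (d : ι → V) (f : FreeGroup ι) :
    ∀ w, affineAction ρ d f w = affineAction ρ d f 0 + ρ f w := by
  induction f using FreeGroup.induction_on with
  | C1 => simp
  | of i => intro w; simp [affineAction]
  | inv_of i _ =>
    intro w
    have : ∀ v, affineAction ρ d (FreeGroup.of i)⁻¹ v = ρ (FreeGroup.of i)⁻¹ (v - d i) := by
      intro v
      rw [map_inv]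
      simp only [affineAction, FreeGroup.lift_apply_of]
      rfl
    rw [this, this]
    simp [sub_eq_neg_add]
  | mul x y hx hy =>
    intro w
    simp only [map_mul, Equiv.Perm.mul_apply, Module.End.mul_apply]
    rw [hy w, hx, hx (affineAction ρ d y 0), map_add, add_assoc]

/-- The crossed homomorphism on a free group with given values on the generators. -/
def crossedHom (ρ : Representation k (FreeGroup ι) V) (d : ι → V) (f : FreeGroup ι) : V :=
  affineAction ρ d f 0

@[simp]
lemma crossedHom_of (ρ : Representation k (FreeGroup ι) V) (d : ι → V) (i : ι) :
    crossedHom ρ d (FreeGroup.of i) = d i := by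
  simp [crossedHom, affineAction]

lemma crossedHom_mul (ρ : Representation k (FreeGroup ι) V) (d : ι → V) (f g : FreeGroup ι) :
    crossedHom ρ d (f * g) = crossedHom ρ d f + ρ f (crossedHom ρ d g) := by
  simp only [crossedHom, map_mul, Equiv.Perm.mul_apply]
  rw [affineAction_apply]

lemma crossedHom_unique (ρ : Representation k (FreeGroup ι) V) (D D' : FreeGroup ι → V)
    (h : ∀ f g, D (f * g) = D f + ρ f (D g)) (h' : ∀ f g, D' (f * g) = D' f + ρ f (D' g))
    (hD : ∀ i, D (FreeGroup.of i) = D' (FreeGroup.of i)) (f : FreeGroup ι) : D f = D' f := by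
  have h1 : D 1 = 0 := by simpa using h 1 1
  have h1' : D' 1 = 0 := by simpa using h' 1 1
  induction f using FreeGroup.induction_on with
  | C1 => rw [h1, h1']
  | of i => exact hD i
  | inv_of i _ =>
    have e := h (FreeGroup.of i)⁻¹ (FreeGroup.of i)
    have e' := h' (FreeGroup.of i)⁻¹ (FreeGroup.of i)
    rw [inv_mul_cancel, h1] at e
    rw [inv_mul_cancel, h1', ← hD] at e'
    exact add_right_cancel (e.symm.trans e')
  | mul x y hx hy => rw [h, h', hx, hy]

end CrossedHom

lemma IsRelProj.of_surjective {k F S V : Type} [CommRing k] [Group F] [Group S] [AddCommGroup V]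
    [Module k V] (f : F →* S) (hf : Function.Surjective f) (ρ : Representation k S V)
    (h : IsRelProj (ρ.comp f)) : IsRelProj ρ := by
  obtain ⟨P, hP, hP'⟩ := h
  refine ⟨Finsupp.lmapDomain V k f ∘ₗ P, fun s a => ?_, fun a => ?_⟩
  · obtain ⟨y, rfl⟩ := hf s
    have := hP y a
    simp only [MonoidHom.comp_apply] at this
    simp only [LinearMap.comp_apply, this, Finsupp.lmapDomain_apply, ← Finsupp.mapDomain_comp]
    congr 1
    funext x
    simp
  · rw [LinearMap.comp_apply, Finsupp.lmapDomain_apply,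
      Finsupp.sum_mapDomain_index (by simp) (by simp)]
    simpa using hP' a

lemma shortExact_of_exact {k G : Type} [CommRing k] [Group G] {X : ShortComplex (Rep k G)}
    (hf : Function.Injective X.f.hom) (hg : Function.Surjective X.g.hom)
    (h : ∀ y, X.g.hom y = 0 → ∃ x, X.f.hom x = y) : X.ShortExact where
  mono_f := (Rep.mono_iff_injective _).2 hf
  epi_g := (Rep.epi_iff_surjective _).2 hg
  exact := (forget₂ (Rep k G) (ModuleCat k)).reflects_exact_of_faithful _
    ((ShortComplex.moduleCat_exact_iff _).2 fun y hy => h y hy)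

section Semidirect

open Finsupp Limits

variable {r : ℕ} {P : Type} [Group P] (φ : P →* MulAut (FreeGroup (Fin r)))

/-- The representation of `F ⋊ P` on the group ring `ℤ[F]`. -/
def groupRingRep : Representation ℤ (FreeGroup (Fin r) ⋊[φ] P) (FreeGroup (Fin r) →₀ ℤ) where
  toFun g := lmapDomain ℤ ℤ (fun x => g.left * φ g.right x)
  map_one' := by
    ext x : 2
    simp
  map_mul' g h := by
    ext x : 2
    simp [mul_assoc]

lemma groupRingRep_single (g : FreeGroup (Fin r) ⋊[φ] P) (x : FreeGroup (Fin r)) (c : ℤ) :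
    groupRingRep φ g (single x c) = single (g.left * φ g.right x) c := by
  simp [groupRingRep]

/-- The augmentation `ℤ[F] → ℤ`. -/
def augmentation (r : ℕ) : (FreeGroup (Fin r) →₀ ℤ) →ₗ[ℤ] ℤ :=
  linearCombination ℤ fun _ => (1 : ℤ)

@[simp]
lemma augmentation_single (x : FreeGroup (Fin r)) (c : ℤ) : augmentation r (single x c) = c := by
  simp [augmentation]

lemma augmentation_rep (g : FreeGroup (Fin r) ⋊[φ] P) (a : FreeGroup (Fin r) →₀ ℤ) :
    augmentation r (groupRingRep φ g a) = augmentation r a := by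
  induction a using Finsupp.induction_linear with
  | zero => simp
  | add p q hp hq => simp only [map_add, hp, hq]
  | single x c => rw [groupRingRep_single, augmentation_single, augmentation_single]

/-- The representation of `F ⋊ P` on the augmentation ideal of `F`. -/
def augIdealRep : Representation ℤ (FreeGroup (Fin r) ⋊[φ] P) (LinearMap.ker (augmentation r)) where
  toFun g := (groupRingRep φ g).restrict fun a ha => by
    rw [LinearMap.mem_ker] at ha ⊢
    rw [augmentation_rep, ha]
  map_one' := by
    ext a : 2
    simp [LinearMap.restrict_apply]
  map_mul' g h := by
    ext a : 2
    simp [LinearMap.restrict_apply]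

lemma augIdealRep_coe (g : FreeGroup (Fin r) ⋊[φ] P) (a : LinearMap.ker (augmentation r)) :
    (augIdealRep φ g a : FreeGroup (Fin r) →₀ ℤ) = groupRingRep φ g a := rfl

/-- The element `x - 1` of the augmentation ideal. -/
def augElem (x : FreeGroup (Fin r)) : LinearMap.ker (augmentation r) :=
  ⟨single x 1 - single 1 1, by simp⟩

/-- The section sends `x` to `x⁻¹ ⊗ 1`, since the group element `(x⁻¹)⁻¹` carries `1` back to `x`.
-/
lemma groupRingRep_isRelProj :
    IsRelProj ((groupRingRep φ).comp
      (SemidirectProduct.inl : FreeGroup (Fin r) →* FreeGroup (Fin r) ⋊[φ] P)) := by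
  refine ⟨linearCombination ℤ fun x => single x⁻¹ (single 1 1), fun h a => ?_, fun a => ?_⟩
  · induction a using Finsupp.induction_linear with
    | zero => simp
    | add p q hp hq => simp only [map_add, hp, hq, mapDomain_add]
    | single x c =>
      simp [groupRingRep_single, mapDomain_single]
  · induction a using Finsupp.induction_linear with
    | zero => simp
    | add p q hp hq =>
      rw [map_add, Finsupp.sum_add_index' (by simp) (by simp), hp, hq]
    | single x c =>
      simp [groupRingRep_single]

/-- The universal crossed homomorphism of `F` with values in `F →₀ I`. -/
def augCrossed : FreeGroup (Fin r) →
    (FreeGroup (Fin r) →₀ LinearMap.ker (augmentation r)) :=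
  crossedHom (coverRep (k := ℤ) (FreeGroup (Fin r)) (LinearMap.ker (augmentation r)))
    fun i => single 1 (augElem (FreeGroup.of i))

/-- The map `F →₀ I → ℤ[F]`, `g ⊗ b ↦ g⁻¹ b`. -/
def augSum : (FreeGroup (Fin r) →₀ LinearMap.ker (augmentation r)) →ₗ[ℤ]
    (FreeGroup (Fin r) →₀ ℤ) :=
  lsum (R := ℤ) ℤ fun g => groupRingRep φ (SemidirectProduct.inl g⁻¹) ∘ₗ
    (LinearMap.ker (augmentation r)).subtype

lemma augSum_single (g : FreeGroup (Fin r)) (b : LinearMap.ker (augmentation r)) :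
    augSum φ (single g b) =
      groupRingRep φ (SemidirectProduct.inl g⁻¹) (b : FreeGroup (Fin r) →₀ ℤ) := by
  simp [augSum]

lemma augSum_cover (h : FreeGroup (Fin r))
    (q : FreeGroup (Fin r) →₀ LinearMap.ker (augmentation r)) :
    augSum φ (coverRep (k := ℤ) _ _ h q) =
      groupRingRep φ (SemidirectProduct.inl h) (augSum φ q) := by
  induction q using Finsupp.induction_linear with
  | zero => rw [map_zero, map_zero, map_zero]
  | add p q hp hq => rw [map_add, map_add, hp, hq, map_add, map_add]
  | single x b =>
    rw [coverRep_single, augSum_single, augSum_single, mul_inv_rev, inv_inv, map_mul, map_mul]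
    rfl

/-- This is the fundamental formula of Fox calculus: both sides are crossed homomorphisms, and they
agree on the generators. -/
lemma augSum_augCrossed (f : FreeGroup (Fin r)) :
    augSum φ (augCrossed f) = single f 1 - single 1 1 := by
  refine crossedHom_unique ((groupRingRep φ).comp SemidirectProduct.inl)
    (fun f => augSum φ (augCrossed f))
    (fun f => single f 1 - single 1 1) (fun f g => ?_) (fun f g => ?_) (fun i => ?_) f
  · simp only [augCrossed, crossedHom_mul]
    rw [map_add, augSum_cover]
    rfl
  · simp [groupRingRep_single]
  · simp only [augCrossed, crossedHom_of]
    rw [augSum_single]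
    simp [augElem]

lemma augSum_linearCombination (a : FreeGroup (Fin r) →₀ ℤ) :
    augSum φ (linearCombination ℤ augCrossed a) = a - single 1 (augmentation r a) := by
  induction a using Finsupp.induction_linear with
  | zero => rw [map_zero, map_zero, map_zero, single_zero, sub_zero]
  | add p q hp hq =>
    rw [map_add, map_add, hp, hq, map_add, single_add]
    abel
  | single x c =>
    rw [linearCombination_single, map_smul, augSum_augCrossed]
    simp [smul_sub]

/-- The linear extension of a crossed homomorphism fails to be equivariant by a term proportional to
the augmentation. On the augmentation ideal the defect disappears. -/
lemma linearCombination_augCrossed (h : FreeGroup (Fin r)) (a : FreeGroup (Fin r) →₀ ℤ) :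
    linearCombination ℤ augCrossed (groupRingRep φ (SemidirectProduct.inl h) a) =
      coverRep (k := ℤ) _ _ h (linearCombination ℤ augCrossed a) +
        linearCombination ℤ (fun _ : Unit => augCrossed h) (single () (augmentation r a)) := by
  induction a using Finsupp.induction_linear with
  | zero => rw [map_zero, map_zero, map_zero, map_zero, single_zero, map_zero, add_zero]
  | add p q hp hq =>
    rw [map_add, map_add, hp, hq, map_add, map_add, map_add, single_add, map_add]
    abel
  | single x c =>
    rw [groupRingRep_single, linearCombination_single, linearCombination_single,
      linearCombination_single, augmentation_single, SemidirectProduct.left_inl,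
      SemidirectProduct.right_inl, map_one, MulAut.one_apply, augCrossed, crossedHom_mul,
      smul_add, map_smul, add_comm]

/-- The augmentation ideal of a free group is a free module on the elements `x_i - 1`. Here this
enters as a section, the universal crossed homomorphism extended linearly and restricted to the
ideal. -/
lemma augIdealRep_isRelProj :
    IsRelProj ((augIdealRep φ).comp
      (SemidirectProduct.inl : FreeGroup (Fin r) →* FreeGroup (Fin r) ⋊[φ] P)) := by
  refine ⟨linearCombination ℤ augCrossed ∘ₗ (LinearMap.ker (augmentation r)).subtype,
    fun h a => ?_, fun a => ?_⟩
  · have := linearCombination_augCrossed φ h (a : FreeGroup (Fin r) →₀ ℤ)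
    have ha : augmentation r (a : FreeGroup (Fin r) →₀ ℤ) = 0 := a.2
    rw [ha, single_zero, map_zero, add_zero] at this
    exact this
  · have ha : augmentation r (a : FreeGroup (Fin r) →₀ ℤ) = 0 := a.2
    have h1 := augSum_linearCombination φ a
    rw [ha, single_zero, sub_zero] at h1
    refine Subtype.ext (Eq.trans ?_ h1)
    rw [augSum, lsum_apply]
    change (LinearMap.ker (augmentation r)).subtype _ = _
    rw [map_finsuppSum]
    rfl

/-- The normal subgroup `F` of `F ⋊ P`. -/
abbrev freePart : Subgroup (FreeGroup (Fin r) ⋊[φ] P) := SemidirectProduct.rightHom.ker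

lemma isRelProj_restrict_freePart {V : Type} [AddCommGroup V]
    {ρ : Representation ℤ (FreeGroup (Fin r) ⋊[φ] P) V}
    (h : IsRelProj (ρ.comp SemidirectProduct.inl)) : IsRelProj (ρ.comp (freePart φ).subtype) := by
  refine IsRelProj.of_surjective
    ((SemidirectProduct.inl : FreeGroup (Fin r) →* FreeGroup (Fin r) ⋊[φ] P).codRestrict
      (freePart φ) fun x => by simp [freePart]) ?_ _ h
  rintro ⟨s, hs⟩
  refine ⟨s.left, Subtype.ext ?_⟩
  have : s.right = 1 := hs
  ext <;> simp [this]

/-- The group ring `ℤ[F]` as a representation of `F ⋊ P`. -/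
abbrev groupRing : Rep ℤ (FreeGroup (Fin r) ⋊[φ] P) := Rep.of (groupRingRep φ)

/-- The augmentation ideal of `ℤ[F]` as a representation of `F ⋊ P`. -/
abbrev augIdeal : Rep ℤ (FreeGroup (Fin r) ⋊[φ] P) := Rep.of (augIdealRep φ)

/-- The short exact sequence `0 → I → ℤ[F] → ℤ → 0`. -/
def augSeq : ShortComplex (Rep ℤ (FreeGroup (Fin r) ⋊[φ] P)) where
  X₁ := augIdeal φ
  X₂ := groupRing φ
  X₃ := Rep.trivial ℤ (FreeGroup (Fin r) ⋊[φ] P) ℤ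
  f := Rep.ofHom ⟨(LinearMap.ker (augmentation r)).subtype, fun g => rfl⟩
  g := Rep.ofHom ⟨augmentation r, fun g => LinearMap.ext fun a => augmentation_rep φ g a⟩
  zero := by
    refine Rep.hom_ext (DFunLike.ext _ _ fun x => ?_)
    exact x.2

lemma augSeq_shortExact : (augSeq φ).ShortExact :=
  shortExact_of_exact Subtype.val_injective (fun c => ⟨single 1 c, augmentation_single _ _⟩)
    fun y hy => ⟨⟨y, hy⟩, rfl⟩

lemma isAcyclicOver_groupRing : IsAcyclicOver (freePart φ) (groupRing φ) := fun n =>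
  isZero_groupHomology_of_isRelProj _ (isRelProj_restrict_freePart φ (groupRingRep_isRelProj φ)) n

lemma isAcyclicOver_augIdeal : IsAcyclicOver (freePart φ) (augIdeal φ) := fun n =>
  isZero_groupHomology_of_isRelProj _ (isRelProj_restrict_freePart φ (augIdealRep_isRelProj φ)) n

end Semidirect

end FreeToK
end

noncomputable section

namespace FreeToK

/-! ### Coinflation along a surjection with identified coinvariants -/

section CoinflationConcrete

open Limits

variable {k G P : Type} [CommRing k] [Group G] [Group P]

lemma coinvariants_lift_bijective (π : G →* P) (A : Rep k G) (N : Rep k P)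
    (θ : A ⟶ Rep.res π N) (hθ : Function.Surjective θ.hom)
    (hker : ∀ a, θ.hom a = 0 → a ∈ Representation.Coinvariants.ker (A.ρ.comp π.ker.subtype))
    (h : ∀ s : π.ker, θ.hom.toLinearMap ∘ₗ (A.ρ.comp π.ker.subtype) s = θ.hom.toLinearMap) :
    Function.Bijective (Representation.Coinvariants.lift _ θ.hom.toLinearMap h) := by
  constructor
  · rw [injective_iff_map_eq_zero]
    intro x hx
    obtain ⟨a, rfl⟩ := Representation.Coinvariants.mk_surjective _ x
    exact (Representation.Coinvariants.mk_eq_zero _).2 (hker a hx)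
  · intro y
    obtain ⟨a, ha⟩ := hθ y
    exact ⟨Representation.Coinvariants.mk _ a, ha⟩

/-- The hypotheses on `θ` say that it identifies `N` with the coinvariants of `A` under the kernel,
so the map is coinflation followed by an isomorphism of pairs. -/
lemma isIso_map_of_coinvariants (π : G →* P) (hπ : Function.Surjective π) (A : Rep k G)
    (N : Rep k P) (θ : A ⟶ Rep.res π N) (hθ : Function.Surjective θ.hom)
    (hker : ∀ a, θ.hom a = 0 → a ∈ Representation.Coinvariants.ker (A.ρ.comp π.ker.subtype))
    (hA : IsAcyclicOver π.ker A) (n : ℕ) : IsIso (groupHomology.map π θ n) := by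
  have h : ∀ s : π.ker, θ.hom.toLinearMap ∘ₗ (A.ρ.comp π.ker.subtype) s = θ.hom.toLinearMap := by
    intro s
    refine LinearMap.ext fun a => ?_
    have h1 := Rep.hom_comm_apply θ (s : G) a
    refine h1.trans ?_
    change N.ρ (π s) (θ.hom a) = θ.hom a
    rw [show π s = 1 from s.2, map_one]
    rfl
  let e : G ⧸ π.ker ≃* P := QuotientGroup.quotientKerEquivOfSurjective π hπ
  let e' : ((Rep.quotientToCoinvariantsFunctor k π.ker).obj A).V ≃ₗ[k] N.V :=
    LinearEquiv.ofBijective _ (coinvariants_lift_bijective π A N θ hθ hker h)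
  have he : ∀ g, e' ∘ₗ ((Rep.quotientToCoinvariantsFunctor k π.ker).obj A).ρ g =
      N.ρ (e g) ∘ₗ e' := by
    intro g
    induction g using QuotientGroup.induction_on with | _ g
    refine LinearMap.ext fun x => ?_
    obtain ⟨a, rfl⟩ := Representation.Coinvariants.mk_surjective _ x
    exact Rep.hom_comm_apply θ g a
  have h1 : IsIso (groupHomology.map (QuotientGroup.mk' π.ker) (coinfMk π.ker A) n) :=
    isIso_coinf π.ker n A hA
  have h2 : groupHomology.map π θ n =
      groupHomology.map (QuotientGroup.mk' π.ker) (coinfMk π.ker A) n ≫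
        (groupHomology.mapIso e e' he n).hom := by
    rw [groupHomology.mapIso_hom, ← groupHomology.map_comp]
    exact groupHomology.map_congr (by ext; rfl) (by ext; rfl) n
  rw [h2]
  infer_instance

/-- The isomorphism induced by `θ` factors through the map induced by `f`. -/
lemma mono_functor_map (π : G →* P) {A B : Rep k G} {N : Rep k P} (f : A ⟶ B)
    (ψ : B ⟶ Rep.res π N) (θ : A ⟶ Rep.res π N) (h : ∀ a, θ.hom a = ψ.hom (f.hom a)) (n : ℕ)
    (hθ : IsIso (groupHomology.map π θ n)) : Mono ((groupHomology.functor k G n).map f) := by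
  have h2 : groupHomology.map π θ n =
      groupHomology.map (MonoidHom.id G) f n ≫ groupHomology.map π ψ n := by
    rw [← groupHomology.map_comp]
    exact groupHomology.map_congr rfl (LinearMap.ext h) n
  have h3 : Mono (groupHomology.map (MonoidHom.id G) f n ≫ groupHomology.map π ψ n) := by
    rw [← h2]
    infer_instance
  exact mono_of_mono (groupHomology.map (MonoidHom.id G) f n) (groupHomology.map π ψ n)

end CoinflationConcrete

/-! ### Additivity of homology in the coefficients -/

section Additive

variable {k G : Type} [CommRing k] [Group G]

lemma chainsMap_add {A B : Rep k G} (f g : A ⟶ B) :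
    groupHomology.chainsMap (MonoidHom.id G) (f + g) =
      groupHomology.chainsMap (MonoidHom.id G) f + groupHomology.chainsMap (MonoidHom.id G) g := by
  refine HomologicalComplex.hom_ext _ _ fun n => ?_
  refine groupHomology.inhomogeneousChains.ext fun x => ?_
  refine ModuleCat.hom_ext (LinearMap.ext fun a => ?_)
  have h1 := groupHomology.chainsMap_f_single (MonoidHom.id G) f n x a
  have h2 := groupHomology.chainsMap_f_single (MonoidHom.id G) g n x a
  have h3 := groupHomology.chainsMap_f_single (MonoidHom.id G) (f + g) n x a
  refine h3.trans ?_
  refine Eq.trans ?_ (congrArg₂ (· + ·) h1 h2).symm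
  exact Finsupp.single_add _ _ _

lemma groupHomology_map_add {A B : Rep k G} (f g : A ⟶ B) (n : ℕ) :
    groupHomology.map (MonoidHom.id G) (f + g) n =
      groupHomology.map (MonoidHom.id G) f n + groupHomology.map (MonoidHom.id G) g n := by
  rw [groupHomology.map, chainsMap_add, HomologicalComplex.homologyMap_add]
  rfl

instance functor_additive (n : ℕ) : (groupHomology.functor k G n).Additive where
  map_add {_ _ f g} := groupHomology_map_add f g n

/-- A linear map as a morphism of trivial representations. -/
def trivialMap (G : Type) [Group G] {V W : Type} [AddCommGroup V] [AddCommGroup W] [Module k V]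
    [Module k W] (f : V →ₗ[k] W) : Rep.trivial k G V ⟶ Rep.trivial k G W :=
  Rep.ofHom ⟨f, fun _ => rfl⟩

lemma trivialMap_comp {V W U : Type} [AddCommGroup V] [AddCommGroup W] [AddCommGroup U]
    [Module k V] [Module k W] [Module k U] (f : V →ₗ[k] W) (g : W →ₗ[k] U) :
    trivialMap G f ≫ trivialMap G g = trivialMap G (g ∘ₗ f) := rfl

lemma trivialMap_id {V : Type} [AddCommGroup V] [Module k V] :
    trivialMap G (LinearMap.id : V →ₗ[k] V) = 𝟙 _ := rfl

lemma trivialMap_sum {V W : Type} [AddCommGroup V] [AddCommGroup W] [Module k V] [Module k W]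
    {ι : Type} (s : Finset ι) (f : ι → (V →ₗ[k] W)) :
    trivialMap G (∑ i ∈ s, f i) = ∑ i ∈ s, trivialMap G (f i) := by
  classical
  induction s using Finset.induction_on with
  | empty => rfl
  | insert i s hi ih =>
    rw [Finset.sum_insert hi, Finset.sum_insert hi, ← ih]
    rfl

/-- A module decomposed by a complete system of orthogonal idempotents. -/
def piEquivOfDecomposition {r : ℕ} {W U : Type} [AddCommGroup W] [AddCommGroup U] [Module k W]
    [Module k U] (p : Fin r → (W →ₗ[k] U)) (q : Fin r → (U →ₗ[k] W))
    (hqp : ∀ i j x, p j (q i x) = if i = j then x else 0) (hpq : ∀ x, ∑ i, q i (p i x) = x) :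
    W ≃ₗ[k] (Fin r → U) where
  toFun x i := p i x
  invFun y := ∑ i, q i (y i)
  map_add' x y := by ext; simp
  map_smul' c x := by ext; simp
  left_inv x := hpq x
  right_inv y := by
    ext j
    change p j (∑ i, q i (y i)) = y j
    rw [map_sum]
    simp [hqp]

/-- Homology with coefficients in a trivial representation `k^r`. -/
def homologyPi (r n : ℕ) :
    groupHomology (Rep.trivial k G (Fin r → k)) n ≃ₗ[k]
      (Fin r → groupHomology (Rep.trivial k G k) n) :=
  piEquivOfDecomposition
    (fun i => ((groupHomology.functor k G n).map
      (trivialMap G (LinearMap.proj (φ := fun _ => k) i))).hom)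
    (fun i => ((groupHomology.functor k G n).map
      (trivialMap G (LinearMap.single k (fun _ : Fin r => k) i))).hom)
    (fun i j x => by
      have h0 : (LinearMap.proj (φ := fun _ => k) j) ∘ₗ
          (LinearMap.single k (fun _ : Fin r => k) i) =
          if i = j then LinearMap.id else (0 : k →ₗ[k] k) := by
        split_ifs with h
        · subst h
          ext
          simp
        · ext
          simp [Pi.single_eq_of_ne (Ne.symm h)]
      have h1 := (groupHomology.functor k G n).map_comp
        (trivialMap G (LinearMap.single k (fun _ : Fin r => k) i))
        (trivialMap G (LinearMap.proj (φ := fun _ => k) j))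
      rw [trivialMap_comp, h0] at h1
      refine (ConcreteCategory.congr_hom h1 x).symm.trans ?_
      split_ifs with h
      · rw [trivialMap_id, (groupHomology.functor k G n).map_id]
        rfl
      · have h2 : trivialMap G (0 : k →ₗ[k] k) = 0 := rfl
        rw [h2, (groupHomology.functor k G n).map_zero]
        rfl)
    (fun x => by
      have h0 : ∑ i, (LinearMap.single k (fun _ : Fin r => k) i) ∘ₗ
          (LinearMap.proj (φ := fun _ => k) i) = LinearMap.id := by
        refine LinearMap.ext fun x => ?_
        simp only [LinearMap.sum_apply, LinearMap.comp_apply, LinearMap.proj_apply,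
          LinearMap.id_apply]
        exact Finset.univ_sum_single x
      have h1 : ∑ i, (groupHomology.functor k G n).map (trivialMap G
          ((LinearMap.single k (fun _ : Fin r => k) i) ∘ₗ
            (LinearMap.proj (φ := fun _ => k) i))) = 𝟙 _ := by
        rw [← Functor.map_sum, ← trivialMap_sum, h0, trivialMap_id]
        exact (groupHomology.functor k G n).map_id _
      have h2 := congrArg ModuleCat.Hom.hom h1
      rw [ModuleCat.hom_sum] at h2
      have h3 := (LinearMap.sum_apply _ _ x).symm.trans (LinearMap.congr_fun h2 x)
      refine Eq.trans (Finset.sum_congr rfl fun i _ => ?_) h3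
      have h4 := (groupHomology.functor k G n).map_comp
        (trivialMap G (LinearMap.proj (φ := fun _ => k) i))
        (trivialMap G (LinearMap.single k (fun _ : Fin r => k) i))
      exact (ConcreteCategory.congr_hom h4 x).symm)

/-- The additive equivalence underlying `homologyPi`. -/
def homologyPiAdd (k G : Type) [CommRing k] [Group G] (r n : ℕ) :
    groupHomology (Rep.trivial k G (Fin r → k)) n ≃+
      (Fin r → groupHomology (Rep.trivial k G k) n) :=
  (homologyPi r n).toAddEquiv

end Additive

/-! ### The exact sequence of the augmentation ideal -/

section Semidirect

open Finsupp Limits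

variable {r : ℕ} {P : Type} [Group P] (φ : P →* MulAut (FreeGroup (Fin r)))

/-- The exponent sums of the letters of an element of a free group. -/
def exponentSums (r : ℕ) : FreeGroup (Fin r) →* Multiplicative (Fin r → ℤ) :=
  FreeGroup.lift fun i => Multiplicative.ofAdd (Pi.single i 1)

/-- The map `ℤ[F] → ℤ` as a morphism to the trivial representation of `P`. -/
def groupRingToTrivial :
    groupRing φ ⟶ Rep.res SemidirectProduct.rightHom (Rep.trivial ℤ P ℤ) :=
  Rep.ofHom ⟨augmentation r, fun g => LinearMap.ext fun a => augmentation_rep φ g a⟩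

lemma sub_mem_ker_freePart {V : Type} [AddCommGroup V]
    (ρ : Representation ℤ (FreeGroup (Fin r) ⋊[φ] P) V) (x : FreeGroup (Fin r)) (v : V) :
    ρ (SemidirectProduct.inl x) v - v ∈
      Representation.Coinvariants.ker (ρ.comp (freePart φ).subtype) :=
  Representation.Coinvariants.sub_mem_ker (ρ := ρ.comp (freePart φ).subtype)
    (⟨SemidirectProduct.inl x, by simp [freePart]⟩ : freePart φ) v

/-- An instance of Shapiro's lemma: the coinvariants of `ℤ[F]` under `F` are `ℤ`, since every `x -
1` vanishes there. -/
lemma isIso_groupRingToTrivial (n : ℕ) :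
    IsIso (groupHomology.map SemidirectProduct.rightHom (groupRingToTrivial φ) n) := by
  refine isIso_map_of_coinvariants _ SemidirectProduct.rightHom_surjective _ _ _
    (fun c => ⟨single 1 c, augmentation_single _ _⟩) (fun a ha => ?_)
    (isAcyclicOver_groupRing φ) n
  have key : ∀ a : FreeGroup (Fin r) →₀ ℤ, a - single 1 (augmentation r a) ∈
      Representation.Coinvariants.ker ((groupRingRep φ).comp (freePart φ).subtype) := by
    intro a
    induction a using Finsupp.induction_linear with
    | zero => simp
    | add p q hp hq =>
      have := add_mem hp hq
      rwa [sub_add_sub_comm, ← single_add, ← _root_.map_add] at this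
    | single x c =>
      have := sub_mem_ker_freePart φ (groupRingRep φ) x (single 1 c)
      simpa [groupRingRep_single] using this
  have h0 : augmentation r a = 0 := ha
  have := key a
  rwa [h0, single_zero, sub_zero] at this

/-- The linear map `I → ℤ^r` sending `x - 1` to the exponent sums of `x`. -/
def augToAbelianization (r : ℕ) : (FreeGroup (Fin r) →₀ ℤ) →ₗ[ℤ] (Fin r → ℤ) :=
  linearCombination ℤ fun x => (exponentSums r x).toAdd

lemma augToAbelianization_rep
    (hφ : ∀ p x, exponentSums r (φ p x) = exponentSums r x)
    (g : FreeGroup (Fin r) ⋊[φ] P) (a : FreeGroup (Fin r) →₀ ℤ) :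
    augToAbelianization r (groupRingRep φ g a) = augToAbelianization r a +
      augmentation r a • (exponentSums r g.left).toAdd := by
  induction a using Finsupp.induction_linear with
  | zero => simp
  | add p q hp hq =>
    simp only [_root_.map_add, hp, hq, add_smul]
    abel
  | single x c =>
    rw [groupRingRep_single]
    simp [augToAbelianization, hφ, add_comm, smul_add]

/-- The map `I → ℤ^r` as a morphism to the trivial representation of `P`. -/
def augIdealToTrivial (hφ : ∀ p x, exponentSums r (φ p x) = exponentSums r x) :
    augIdeal φ ⟶ Rep.res SemidirectProduct.rightHom (Rep.trivial ℤ P (Fin r → ℤ)) :=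
  Rep.ofHom ⟨augToAbelianization r ∘ₗ (LinearMap.ker (augmentation r)).subtype, fun g =>
    LinearMap.ext fun a => by
      have := augToAbelianization_rep φ hφ g a
      rw [show augmentation r a = 0 from a.2, zero_smul, add_zero] at this
      exact this⟩

/-- The class of `x - 1` in the coinvariants of the augmentation ideal. -/
def augClass : FreeGroup (Fin r) →*
    Multiplicative (Representation.Coinvariants ((augIdealRep φ).comp (freePart φ).subtype)) where
  toFun x := Multiplicative.ofAdd (Representation.Coinvariants.mk _ (augElem x))
  map_one' := by
    rw [show augElem (1 : FreeGroup (Fin r)) = 0 from Subtype.ext (sub_self _)]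
    simp
  map_mul' x y := by
    rw [← ofAdd_add, ← _root_.map_add]
    congr 1
    rw [Representation.Coinvariants.mk_eq_iff]
    -- The identity used is `xy - 1 = (x - 1) + x(y - 1)`, and `x` acts trivially on coinvariants.
    have := sub_mem_ker_freePart φ (augIdealRep φ) x (augElem y)
    convert this using 1
    refine Subtype.ext ?_
    rw [Submodule.coe_sub, Submodule.coe_sub, Submodule.coe_add, augIdealRep_coe]
    simp only [augElem, map_sub, groupRingRep_single, SemidirectProduct.left_inl,
      SemidirectProduct.right_inl, _root_.map_one, MulAut.one_apply, mul_one]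
    abel

/-- A homomorphism from a free group to an abelian group depends only on exponent sums. -/
lemma augClass_eq (x : FreeGroup (Fin r)) :
    Representation.Coinvariants.mk ((augIdealRep φ).comp (freePart φ).subtype) (augElem x) =
      ∑ i, (exponentSums r x).toAdd i • Representation.Coinvariants.mk
        ((augIdealRep φ).comp (freePart φ).subtype) (augElem (FreeGroup.of i)) := by
  let L : (Fin r → ℤ) →+ Representation.Coinvariants ((augIdealRep φ).comp (freePart φ).subtype) :=
    { toFun := fun v => ∑ i, v i • Representation.Coinvariants.mk
        ((augIdealRep φ).comp (freePart φ).subtype) (augElem (FreeGroup.of i))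
      map_zero' := by simp
      map_add' := fun v w => by simp [add_smul, Finset.sum_add_distrib] }
  have h : augClass φ = (AddMonoidHom.toMultiplicative L).comp (exponentSums r) := by
    refine FreeGroup.ext_hom _ _ fun i => ?_
    simp [augClass, exponentSums, L, Pi.single_apply, ite_smul]
  exact congrArg Multiplicative.toAdd (DFunLike.congr_fun h x)

/-- The coinvariants of the augmentation ideal are the abelianization of `F`. The hypothesis on `φ`
makes this a trivial representation of `P`. -/
lemma isIso_augIdealToTrivial (hφ : ∀ p x, exponentSums r (φ p x) = exponentSums r x) (n : ℕ) :
    IsIso (groupHomology.map SemidirectProduct.rightHom (augIdealToTrivial φ hφ) n) := by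
  refine isIso_map_of_coinvariants _ SemidirectProduct.rightHom_surjective _ _ _
    (fun v => ?_) (fun a ha => ?_) (isAcyclicOver_augIdeal φ) n
  · refine ⟨∑ i, v i • augElem (FreeGroup.of i), ?_⟩
    change augToAbelianization r ((LinearMap.ker (augmentation r)).subtype _) = v
    ext j
    simp [augElem, augToAbelianization, exponentSums, Pi.single_apply]
  · rw [← Representation.Coinvariants.mk_eq_zero]
    -- The claim is stated for all of `ℤ[F]`, projected to the ideal by subtracting the
    -- augmentation, so that it can be checked on single group elements.
    have key : ∀ (a : FreeGroup (Fin r) →₀ ℤ) (b : LinearMap.ker (augmentation r)),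
        (b : FreeGroup (Fin r) →₀ ℤ) = a - single 1 (augmentation r a) →
        Representation.Coinvariants.mk ((augIdealRep φ).comp (freePart φ).subtype) b =
          ∑ i, augToAbelianization r a i • Representation.Coinvariants.mk
            ((augIdealRep φ).comp (freePart φ).subtype) (augElem (FreeGroup.of i)) := by
      intro a
      induction a using Finsupp.induction_linear with
      | zero =>
        intro b hb
        have : b = 0 := Subtype.ext (by rw [hb]; simp)
        simp [this]
      | add p q hp hq =>
        intro b hb
        have : b = ⟨p - single 1 (augmentation r p), by simp⟩ +
            ⟨q - single 1 (augmentation r q), by simp⟩ := by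
          refine Subtype.ext ?_
          rw [hb, Submodule.coe_add, _root_.map_add, single_add]
          exact add_sub_add_comm _ _ _ _
        rw [this, _root_.map_add, hp _ rfl, hq _ rfl, _root_.map_add, ← Finset.sum_add_distrib]
        simp [add_smul]
      | single x c =>
        intro b hb
        have : b = c • augElem x := by
          refine Subtype.ext ?_
          rw [hb]
          simp [augElem, smul_sub]
        rw [this, map_smul, augClass_eq, Finset.smul_sum]
        simp [augToAbelianization, mul_smul]
    have h0 : augToAbelianization r (a : FreeGroup (Fin r) →₀ ℤ) = 0 := ha
    have := key a a (by rw [show augmentation r (a : FreeGroup (Fin r) →₀ ℤ) = 0 from a.2]; simp)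
    rw [h0] at this
    simpa using this

/-- The homology of `F ⋊ P` for `F` free of rank `r` and `P` acting trivially on the
abelianization of `F`, in degrees above the homological dimension of `P`. -/
theorem homology_semidirect (hφ : ∀ p x, exponentSums r (φ p x) = exponentSums r x) (n : ℕ)
    (h : IsZero (groupHomology (Rep.trivial ℤ P ℤ) (n + 1))) :
    Nonempty (groupHomology (Rep.trivial ℤ (FreeGroup (Fin r) ⋊[φ] P) ℤ) (n + 1) ≃+
      (Fin r → groupHomology (Rep.trivial ℤ P ℤ) n)) := by
  have hX := augSeq_shortExact φ
  have hz : IsZero (groupHomology (augSeq φ).X₂ (n + 1)) := by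
    exact h.of_iso (@asIso _ _ _ _ _ (isIso_groupRingToTrivial φ (n + 1)))
  -- Composing the augmentation with the projection to `P` gives an isomorphism in homology, so the
  -- augmentation itself is injective. By exactness the map from the ideal is then zero and the
  -- connecting map is onto.
  have hmono : Mono ((groupHomology.functor ℤ _ n).map (augSeq φ).g) :=
    mono_functor_map SemidirectProduct.rightHom (augSeq φ).g
      (Rep.ofHom ⟨LinearMap.id, fun _ => rfl⟩) (groupRingToTrivial φ) (fun _ => rfl) n
      (isIso_groupRingToTrivial φ n)
  have hδm := groupHomology.mono_δ_of_isZero hX n hz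
  have hδe : Epi (groupHomology.δ hX (n + 1) n rfl) := by
    have e2 := groupHomology.mapShortComplex₁_exact hX (i := n + 1) (j := n) rfl
    have hf : (groupHomology.functor ℤ _ n).map (augSeq φ).f = 0 := by
      rw [← cancel_mono ((groupHomology.functor ℤ _ n).map (augSeq φ).g), zero_comp]
      exact (groupHomology.mapShortComplex₂ (augSeq φ) n).zero
    exact e2.epi_f hf
  have hiso : IsIso (groupHomology.δ hX (n + 1) n rfl) := isIso_of_mono_of_epi _
  have hI := isIso_augIdealToTrivial φ hφ n
  exact ⟨(asIso (groupHomology.δ hX (n + 1) n rfl)).toLinearEquiv.toAddEquiv.trans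
    ((asIso (groupHomology.map SemidirectProduct.rightHom
      (augIdealToTrivial φ hφ) n)).toLinearEquiv.toAddEquiv.trans
        (homologyPiAdd ℤ P r n))⟩

end Semidirect

end FreeToK
end

noncomputable section

namespace FreeToK

/-! ### Generators of braid groups indexed by natural numbers -/

section BraidBasics

/-- The generator `σ_i` of the braid group (trivial if `i` is out of range). -/
def braidGen (n i : ℕ) : BraidGroup n :=
  if h : i < n - 1 then PresentedGroup.of ⟨i, h⟩ else 1

lemma braidGen_of_lt {n i : ℕ} (h : i < n - 1) :
    braidGen n i = PresentedGroup.of (⟨i, h⟩ : Fin (n - 1)) := dif_pos h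

lemma braidGen_comm (n : ℕ) {i j : ℕ} (hij : i + 2 ≤ j) :
    braidGen n i * braidGen n j = braidGen n j * braidGen n i := by
  by_cases hj : j < n - 1
  · have hi : i < n - 1 := by omega
    rw [braidGen_of_lt hi, braidGen_of_lt hj, ← mul_inv_eq_one]
    exact PresentedGroup.one_of_mem (rels := braidRels n) (Or.inl ⟨⟨i, hi⟩, ⟨j, hj⟩, hij, rfl⟩)
  · simp [braidGen, hj]

lemma braidGen_braid {n i : ℕ} (h : i + 1 < n - 1) :
    braidGen n i * braidGen n (i + 1) * braidGen n i =
      braidGen n (i + 1) * braidGen n i * braidGen n (i + 1) := by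
  have hi : i < n - 1 := by omega
  rw [braidGen_of_lt hi, braidGen_of_lt h, ← mul_inv_eq_one]
  exact PresentedGroup.one_of_mem (rels := braidRels n) (Or.inr ⟨⟨i, hi⟩, ⟨i + 1, h⟩, rfl, rfl⟩)

/-- The homomorphism from a braid group given by elements satisfying the braid relations. -/
def braidLift (n : ℕ) {H : Type} [Group H] (s : ℕ → H)
    (hc : ∀ i j, i + 2 ≤ j → j < n - 1 → s i * s j = s j * s i)
    (hb : ∀ i, i + 1 < n - 1 → s i * s (i + 1) * s i = s (i + 1) * s i * s (i + 1)) :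
    BraidGroup n →* H :=
  PresentedGroup.toGroup (rels := braidRels n) (f := fun i : Fin (n - 1) => s i) (by
    rintro r (⟨i, j, hij, rfl⟩ | ⟨i, j, hij, rfl⟩)
    · simp only [map_mul, map_inv, FreeGroup.lift_apply_of, mul_inv_eq_one]
      exact hc i j hij j.2
    · simp only [map_mul, map_inv, FreeGroup.lift_apply_of, mul_inv_eq_one]
      rw [← hij]
      exact hb i (by omega))

lemma braidLift_gen (n : ℕ) {H : Type} [Group H] (s : ℕ → H)
    (hc : ∀ i j, i + 2 ≤ j → j < n - 1 → s i * s j = s j * s i)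
    (hb : ∀ i, i + 1 < n - 1 → s i * s (i + 1) * s i = s (i + 1) * s i * s (i + 1))
    {i : ℕ} (hi : i < n - 1) : braidLift n s hc hb (braidGen n i) = s i := by
  rw [braidGen_of_lt hi]
  exact PresentedGroup.toGroup.of _

lemma braid_induction {n : ℕ} {C : BraidGroup n → Prop} (b : BraidGroup n) (one : C 1)
    (gen : ∀ i, i < n - 1 → C (braidGen n i)) (mul : ∀ a b, C a → C b → C (a * b))
    (inv : ∀ a, C a → C a⁻¹) : C b := by
  have hb : b ∈ Subgroup.closure (Set.range (PresentedGroup.of (rels := braidRels n))) := by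
    rw [PresentedGroup.closure_range_of]
    trivial
  induction hb using Subgroup.closure_induction with
  | mem x hx =>
    obtain ⟨i, rfl⟩ := hx
    have := gen i i.2
    rwa [braidGen_of_lt i.2] at this
  | one => exact one
  | mul x y _ _ hx hy => exact mul x y hx hy
  | inv x _ hx => exact inv x hx

lemma braidToPerm_gen {n i : ℕ} (hi : i < n - 1) :
    braidToPerm n (braidGen n i) = adjSwap n ⟨i, hi⟩ := by
  rw [braidGen_of_lt hi]
  exact PresentedGroup.toGroup.of _

/-- The transposition of `i` and `i + 1` on natural numbers. -/
def natSwap (i k : ℕ) : ℕ := if k = i then i + 1 else if k = i + 1 then i else k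

lemma adjSwap_val {n : ℕ} (i : Fin (n - 1)) (k : Fin n) :
    (adjSwap n i k : ℕ) = natSwap i k := by
  simp only [adjSwap, Equiv.swap_apply_def, natSwap, Fin.ext_iff]
  split_ifs <;> rfl

end BraidBasics

/-! ### Artin's action of the braid group on the free group -/

section ArtinAction

/-- The generator `x_k` of a free group (trivial if `k` is out of range). -/
def freeGen (n k : ℕ) : FreeGroup (Fin n) := if h : k < n then FreeGroup.of ⟨k, h⟩ else 1

lemma freeGen_of_lt {n k : ℕ} (h : k < n) : freeGen n k = FreeGroup.of (⟨k, h⟩ : Fin n) :=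
  dif_pos h

lemma freeGroup_ext {n : ℕ} {H : Type} [Group H] (f g : FreeGroup (Fin n) →* H)
    (h : ∀ k, k < n → f (freeGen n k) = g (freeGen n k)) : f = g :=
  FreeGroup.ext_hom _ _ fun k => by
    have := h k k.2
    rwa [freeGen_of_lt k.2] at this

/-- The endomorphism `x_i ↦ x_i⁻¹ x_{i+1} x_i`, `x_{i+1} ↦ x_i`. -/
def artinHom (n i : ℕ) : FreeGroup (Fin n) →* FreeGroup (Fin n) :=
  FreeGroup.lift fun k => if (k : ℕ) = i then (freeGen n i)⁻¹ * freeGen n (i + 1) * freeGen n i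
    else if (k : ℕ) = i + 1 then freeGen n i else freeGen n k

/-- The endomorphism `x_i ↦ x_{i+1}`, `x_{i+1} ↦ x_{i+1} x_i x_{i+1}⁻¹`. -/
def artinInv (n i : ℕ) : FreeGroup (Fin n) →* FreeGroup (Fin n) :=
  FreeGroup.lift fun k => if (k : ℕ) = i then freeGen n (i + 1)
    else if (k : ℕ) = i + 1 then freeGen n (i + 1) * freeGen n i * (freeGen n (i + 1))⁻¹
    else freeGen n k

variable {n i : ℕ}

lemma artinHom_self (hi : i + 1 < n) : artinHom n i (freeGen n i) =
    (freeGen n i)⁻¹ * freeGen n (i + 1) * freeGen n i := by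
  rw [freeGen_of_lt (show i < n by omega)]
  simp [artinHom, freeGen_of_lt (show i < n by omega)]

lemma artinHom_succ (hi : i + 1 < n) : artinHom n i (freeGen n (i + 1)) = freeGen n i := by
  rw [freeGen_of_lt hi]
  simp [artinHom]

lemma artinHom_of_ne {k : ℕ} (h : k ≠ i) (h' : k ≠ i + 1) :
    artinHom n i (freeGen n k) = freeGen n k := by
  by_cases hk : k < n
  · rw [freeGen_of_lt hk]
    simp [artinHom, h, h', freeGen_of_lt hk]
  · simp [freeGen, hk]

lemma artinInv_self (hi : i + 1 < n) : artinInv n i (freeGen n i) = freeGen n (i + 1) := by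
  rw [freeGen_of_lt (show i < n by omega)]
  simp [artinInv]

lemma artinInv_succ (hi : i + 1 < n) : artinInv n i (freeGen n (i + 1)) =
    freeGen n (i + 1) * freeGen n i * (freeGen n (i + 1))⁻¹ := by
  rw [freeGen_of_lt hi]
  simp [artinInv, freeGen_of_lt hi]

lemma artinInv_of_ne {k : ℕ} (h : k ≠ i) (h' : k ≠ i + 1) :
    artinInv n i (freeGen n k) = freeGen n k := by
  by_cases hk : k < n
  · rw [freeGen_of_lt hk]
    simp [artinInv, h, h', freeGen_of_lt hk]
  · simp [freeGen, hk]

lemma artinInv_comp_artinHom (hi : i + 1 < n) :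
    (artinInv n i).comp (artinHom n i) = MonoidHom.id _ := by
  refine freeGroup_ext _ _ fun k hk => ?_
  simp only [MonoidHom.comp_apply, MonoidHom.id_apply]
  rcases eq_or_ne k i with rfl | h
  · simp only [artinHom_self hi, map_mul, map_inv, artinInv_self hi, artinInv_succ hi]
    group
  rcases eq_or_ne k (i + 1) with rfl | h'
  · rw [artinHom_succ hi, artinInv_self hi]
  · rw [artinHom_of_ne h h', artinInv_of_ne h h']

lemma artinHom_comp_artinInv (hi : i + 1 < n) :
    (artinHom n i).comp (artinInv n i) = MonoidHom.id _ := by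
  refine freeGroup_ext _ _ fun k hk => ?_
  simp only [MonoidHom.comp_apply, MonoidHom.id_apply]
  rcases eq_or_ne k i with rfl | h
  · rw [artinInv_self hi, artinHom_succ hi]
  rcases eq_or_ne k (i + 1) with rfl | hne
  · simp only [artinInv_succ hi, map_mul, map_inv, artinHom_self hi, artinHom_succ hi]
    group
  · rw [artinInv_of_ne h hne, artinHom_of_ne h hne]

/-- The automorphism of the free group given by a generator of the braid group. -/
def artinAut (n i : ℕ) : MulAut (FreeGroup (Fin n)) :=
  if h : i + 1 < n then
    MonoidHom.toMulEquiv (artinHom n i) (artinInv n i) (artinInv_comp_artinHom h)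
      (artinHom_comp_artinInv h)
  else 1

lemma artinAut_apply (hi : i + 1 < n) (x : FreeGroup (Fin n)) :
    artinAut n i x = artinHom n i x := by
  simp [artinAut, hi]

lemma mulAut_ext {σ τ : MulAut (FreeGroup (Fin n))}
    (h : ∀ k, k < n → σ (freeGen n k) = τ (freeGen n k)) : σ = τ := by
  have := freeGroup_ext σ.toMonoidHom τ.toMonoidHom h
  ext x
  exact DFunLike.congr_fun this x

lemma artinAut_comm {j : ℕ} (hij : i + 2 ≤ j) (hj : j < n - 1) :
    artinAut n i * artinAut n j = artinAut n j * artinAut n i := by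
  have hi : i + 1 < n := by omega
  have hj : j + 1 < n := by omega
  refine mulAut_ext fun k _ => ?_
  simp only [MulAut.mul_apply, artinAut_apply hi, artinAut_apply hj]
  rcases eq_or_ne k i with rfl | h1
  · simp only [artinHom_self hi, artinHom_of_ne (show k ≠ j by omega) (show k ≠ j + 1 by omega),
      artinHom_of_ne (show k + 1 ≠ j by omega) (show k + 1 ≠ j + 1 by omega), map_mul, map_inv]
  rcases eq_or_ne k (i + 1) with rfl | h2
  · simp only [artinHom_succ hi,
      artinHom_of_ne (show i ≠ j by omega) (show i ≠ j + 1 by omega),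
      artinHom_of_ne (show i + 1 ≠ j by omega) (show i + 1 ≠ j + 1 by omega)]
  rcases eq_or_ne k j with rfl | h3
  · simp only [artinHom_self hj, artinHom_of_ne h1 h2,
      artinHom_of_ne (show k + 1 ≠ i by omega) (show k + 1 ≠ i + 1 by omega), map_mul, map_inv]
  rcases eq_or_ne k (j + 1) with rfl | h4
  · simp only [artinHom_succ hj, artinHom_of_ne h1 h2,
      artinHom_of_ne (show j ≠ i by omega) (show j ≠ i + 1 by omega)]
  · simp only [artinHom_of_ne h1 h2, artinHom_of_ne h3 h4]

lemma artinAut_braid (h : i + 1 < n - 1) :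
    artinAut n i * artinAut n (i + 1) * artinAut n i =
      artinAut n (i + 1) * artinAut n i * artinAut n (i + 1) := by
  have hi : i + 1 < n := by omega
  have hj : i + 1 + 1 < n := by omega
  refine mulAut_ext fun k _ => ?_
  simp only [MulAut.mul_apply, artinAut_apply hi, artinAut_apply hj]
  have e1 : artinHom n (i + 1) (freeGen n i) = freeGen n i :=
    artinHom_of_ne (by omega) (by omega)
  have e2 : artinHom n i (freeGen n (i + 1 + 1)) = freeGen n (i + 1 + 1) :=
    artinHom_of_ne (by omega) (by omega)
  rcases eq_or_ne k i with rfl | h1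
  · simp only [artinHom_self hi, artinHom_self hj, artinHom_succ hi, e1, e2,
      map_mul, map_inv]
    group
  rcases eq_or_ne k (i + 1) with rfl | h2
  · simp only [artinHom_self hi, artinHom_self hj, artinHom_succ hi, artinHom_succ hj, e1, e2,
      map_mul, map_inv]
  rcases eq_or_ne k (i + 1 + 1) with rfl | h3
  · simp only [artinHom_succ hi, artinHom_succ hj, e1, e2]
  · simp only [artinHom_of_ne h1 h2, artinHom_of_ne h2 h3]

/-- Artin's action of the braid group on the free group. -/
def artinAction (n : ℕ) : BraidGroup n →* MulAut (FreeGroup (Fin n)) :=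
  braidLift n (artinAut n) (fun _ _ h h' => artinAut_comm h h') (fun _ h => artinAut_braid h)

lemma artinAction_gen (hi : i < n - 1) (x : FreeGroup (Fin n)) :
    artinAction n (braidGen n i) x = artinHom n i x := by
  rw [artinAction, braidLift_gen _ _ _ _ hi, artinAut_apply (by omega)]

/-- A braid sends each generator to a conjugate of a generator, permuted as by the underlying
permutation. So pure braids act trivially on the abelianization. -/
lemma exponentSums_artinAction (b : BraidGroup n) : ∀ (x : FreeGroup (Fin n)) (k : Fin n),
    (exponentSums n (artinAction n b x)).toAdd (braidToPerm n b k) =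
      (exponentSums n x).toAdd k := by
  induction b using braid_induction with
  | one => simp
  | mul a b ha hb =>
    intro x k
    rw [map_mul, map_mul, MulAut.mul_apply, Equiv.Perm.mul_apply, ha, hb]
  | inv a ha =>
    intro x k
    have := ha (artinAction n a⁻¹ x) (braidToPerm n a⁻¹ k)
    simpa using this.symm
  | gen i hi =>
    intro x k
    have hi' : i + 1 < n := by omega
    let p : Equiv.Perm (Fin n) := braidToPerm n (braidGen n i)
    let E : (Fin n → ℤ) →+ (Fin n → ℤ) :=
      { toFun := fun v k => v (p k), map_zero' := rfl, map_add' := fun _ _ => rfl }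
    have key : ((AddMonoidHom.toMultiplicative E).comp (exponentSums n)).comp (artinHom n i) =
        exponentSums n := by
      refine freeGroup_ext _ _ fun l hl => ?_
      have hgen : ∀ m (hm : m < n), exponentSums n (freeGen n m) =
          Multiplicative.ofAdd (Pi.single ⟨m, hm⟩ 1) := by
        intro m hm
        rw [freeGen_of_lt hm]
        simp [exponentSums]
      have hE : ∀ m m' (hm : m < n) (hm' : m' < n), natSwap i m' = m →
          AddMonoidHom.toMultiplicative E (exponentSums n (freeGen n m)) =
          exponentSums n (freeGen n m') := by
        intro m m' hm hm' h
        rw [hgen m hm, hgen m' hm']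
        refine congrArg Multiplicative.ofAdd ?_
        funext k
        change (Pi.single ⟨m, hm⟩ 1 : Fin n → ℤ) (p k) = (Pi.single ⟨m', hm'⟩ 1 : Fin n → ℤ) k
        have hp : p ⟨m', hm'⟩ = ⟨m, hm⟩ := by
          refine Fin.ext ?_
          simp only [p, braidToPerm_gen hi, adjSwap_val]
          exact h
        rw [← hp]
        simp [Pi.single_apply]
      simp only [MonoidHom.comp_apply]
      rcases eq_or_ne l i with rfl | h1
      · rw [artinHom_self hi']
        simp only [map_mul, map_inv]
        rw [mul_comm, mul_inv_cancel_left]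
        exact hE _ _ hi' hl (by simp [natSwap])
      rcases eq_or_ne l (i + 1) with rfl | h2
      · rw [artinHom_succ hi']
        exact hE _ _ (by omega) hl (by simp [natSwap])
      · rw [artinHom_of_ne h1 h2]
        exact hE _ _ hl hl (by simp [natSwap, h1, h2])
    rw [artinAction_gen hi]
    exact congrArg (fun m : Multiplicative (Fin n → ℤ) => (Multiplicative.toAdd m) k)
      (DFunLike.congr_fun key x)

end ArtinAction

end FreeToK
end

noncomputable section

namespace FreeToK

/-! ### The semidirect product of the free group and the braid group -/

section ArtinSemidirect

/-- The semidirect product of the free group and the braid group for Artin's action. -/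
abbrev ArtinGroup (n : ℕ) : Type := FreeGroup (Fin n) ⋊[artinAction n] BraidGroup n

/-- The generator `x_k` of the semidirect product. -/
def artinX (n k : ℕ) : ArtinGroup n := SemidirectProduct.inl (freeGen n k)

/-- The generator `σ_i` of the semidirect product. -/
def artinS (n i : ℕ) : ArtinGroup n := SemidirectProduct.inr (braidGen n i)

variable {n i : ℕ}

lemma artinS_mul_inl (hi : i + 1 < n) (x : FreeGroup (Fin n)) :
    artinS n i * SemidirectProduct.inl x = SemidirectProduct.inl (artinHom n i x) * artinS n i := by
  rw [← artinAction_gen (show i < n - 1 by omega), SemidirectProduct.inl_aut, artinS]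
  simp

lemma artinS_mul_artinX_succ (hi : i + 1 < n) :
    artinS n i * artinX n (i + 1) = artinX n i * artinS n i := by
  rw [artinX, artinS_mul_inl hi, artinHom_succ hi]
  rfl

/-- Artin's automorphism fixes the product `x_{i+1} x_i`. -/
lemma artinS_mul_artinX_mul (hi : i + 1 < n) :
    artinS n i * artinX n (i + 1) * artinX n i = artinX n (i + 1) * artinX n i * artinS n i := by
  rw [artinS_mul_artinX_succ hi, mul_assoc, artinX, artinS_mul_inl hi, artinHom_self hi]
  simp only [map_mul, map_inv, artinX]
  group

lemma artinS_mul_artinX_of_ne {k : ℕ} (h : k ≠ i) (h' : k ≠ i + 1) :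
    artinS n i * artinX n k = artinX n k * artinS n i := by
  by_cases hi : i + 1 < n
  · rw [artinX, artinS_mul_inl hi, artinHom_of_ne h h']
  · have : artinS n i = 1 := by
      rw [artinS, braidGen, dif_neg (by omega), map_one]
    simp [this]

lemma artinS_comm {j : ℕ} (hij : i + 2 ≤ j) :
    artinS n i * artinS n j = artinS n j * artinS n i := by
  simp only [artinS, ← map_mul, braidGen_comm n hij]

lemma artinS_braid (h : i + 1 < n - 1) :
    artinS n i * artinS n (i + 1) * artinS n i =
      artinS n (i + 1) * artinS n i * artinS n (i + 1) := by
  simp only [artinS, ← map_mul, braidGen_braid h]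

/-- The coefficients of the monomial action of the braid group. -/
def monoCoeff (n i k : ℕ) : ArtinGroup n :=
  if k < i then artinS n (i - 1) else if k = i then artinX n i else if k = i + 1 then 1
    else artinS n i

lemma monoCoeff_lt {k : ℕ} (h : k < i) : monoCoeff n i k = artinS n (i - 1) := if_pos h

lemma monoCoeff_self : monoCoeff n i i = artinX n i := by simp [monoCoeff]

lemma monoCoeff_succ : monoCoeff n i (i + 1) = 1 := by simp [monoCoeff]

lemma monoCoeff_gt {k : ℕ} (h : i + 1 < k) : monoCoeff n i k = artinS n i := by
  rw [monoCoeff, if_neg (by omega), if_neg (by omega), if_neg (by omega)]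

lemma natSwap_self : natSwap i i = i + 1 := by simp [natSwap]

lemma natSwap_succ : natSwap i (i + 1) = i := by simp [natSwap]

lemma natSwap_of_ne {k : ℕ} (h : k ≠ i) (h' : k ≠ i + 1) : natSwap i k = k := by
  simp [natSwap, h, h']

/-- The coefficients are read off from `σ_i U_k = U_{τ_i k} c` for the coset representatives `U_k =
σ_k ⋯ σ_{n-1}` of the stabilizer of the last strand. Checking the braid relations inside the
abstract semidirect product produces an action of `B_{n+1}` before the semidirect product is known
to embed. -/
lemma monoCoeff_comm {j k : ℕ} (hij : i + 2 ≤ j) :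
    monoCoeff n i (natSwap j k) * monoCoeff n j k =
      monoCoeff n j (natSwap i k) * monoCoeff n i k := by
  rcases lt_trichotomy k i with h | rfl | h
  · rw [natSwap_of_ne (by omega) (by omega), natSwap_of_ne (by omega) (by omega),
      monoCoeff_lt h, monoCoeff_lt (by omega), artinS_comm (by omega)]
  · rw [natSwap_self, natSwap_of_ne (by omega) (by omega), monoCoeff_self,
      monoCoeff_lt (by omega), monoCoeff_lt (by omega),
      artinS_mul_artinX_of_ne (by omega) (by omega)]
  obtain rfl | h := eq_or_lt_of_le (Nat.succ_le_of_lt h)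
  · rw [Nat.succ_eq_add_one, natSwap_succ, natSwap_of_ne (by omega) (by omega), monoCoeff_succ,
      monoCoeff_lt (by omega), monoCoeff_lt (by omega), one_mul, mul_one]
  rw [Nat.succ_eq_add_one] at h
  rw [natSwap_of_ne (i := i) (by omega) (by omega), monoCoeff_gt (k := k) h]
  rcases lt_trichotomy k j with h' | rfl | h'
  · rw [natSwap_of_ne (by omega) (by omega), monoCoeff_gt h, monoCoeff_lt h',
      artinS_comm (by omega)]
  · rw [natSwap_self, monoCoeff_self, monoCoeff_gt (by omega),
      artinS_mul_artinX_of_ne (by omega) (by omega)]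
  obtain rfl | h' := eq_or_lt_of_le (Nat.succ_le_of_lt h')
  · rw [Nat.succ_eq_add_one, natSwap_succ, monoCoeff_succ, monoCoeff_gt (by omega), one_mul,
      mul_one]
  rw [Nat.succ_eq_add_one] at h'
  rw [natSwap_of_ne (by omega) (by omega), monoCoeff_gt h, monoCoeff_gt h', artinS_comm hij]

/-- Away from the three moved points this is a braid relation of `B_n`. At `k = i` it says that
`σ_i` commutes with `x_{i+1} x_i`, at `k = i + 1` it is `σ_i x_{i+1} = x_i σ_i`, and at `k = i + 2`
both sides agree at once. -/
lemma monoCoeff_braid {k : ℕ} (hi : i + 1 < n) (hk : k ≤ n) :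
    monoCoeff n i (natSwap (i + 1) (natSwap i k)) * monoCoeff n (i + 1) (natSwap i k) *
        monoCoeff n i k =
      monoCoeff n (i + 1) (natSwap i (natSwap (i + 1) k)) * monoCoeff n i (natSwap (i + 1) k) *
        monoCoeff n (i + 1) k := by
  rcases lt_trichotomy k i with h | rfl | h
  · obtain ⟨i, rfl⟩ : ∃ i', i = i' + 1 := ⟨i - 1, by omega⟩
    rw [natSwap_of_ne (i := i + 1) (by omega) (by omega),
      natSwap_of_ne (by omega) (by omega), natSwap_of_ne (by omega) (by omega), monoCoeff_lt h,
      monoCoeff_lt (by omega)]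
    exact artinS_braid (by omega)
  · rw [natSwap_of_ne (i := k + 1) (k := k) (by omega) (by omega), natSwap_self, natSwap_self,
      monoCoeff_gt (by omega), monoCoeff_self, monoCoeff_self, monoCoeff_lt (by omega)]
    exact artinS_mul_artinX_mul hi
  obtain rfl | h := eq_or_lt_of_le (Nat.succ_le_of_lt h)
  · rw [Nat.succ_eq_add_one, natSwap_succ, natSwap_self,
      natSwap_of_ne (i := i + 1) (k := i) (by omega) (by omega),
      natSwap_of_ne (i := i) (k := i + 1 + 1) (by omega) (by omega), monoCoeff_self,
      monoCoeff_self, monoCoeff_succ, monoCoeff_succ, monoCoeff_lt (by omega),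
      monoCoeff_gt (by omega), one_mul, mul_one]
    exact (artinS_mul_artinX_succ hi).symm
  rw [Nat.succ_eq_add_one] at h
  obtain rfl | h := eq_or_lt_of_le (Nat.succ_le_of_lt h)
  · rw [Nat.succ_eq_add_one, natSwap_of_ne (i := i) (k := i + 1 + 1) (by omega) (by omega),
      natSwap_succ, natSwap_succ, monoCoeff_succ, monoCoeff_succ, monoCoeff_gt (by omega),
      monoCoeff_lt (by omega)]
    simp
  rw [Nat.succ_eq_add_one] at h
  rw [natSwap_of_ne (i := i) (k := k) (by omega) (by omega),
    natSwap_of_ne (i := i + 1) (by omega) (by omega),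
    natSwap_of_ne (i := i) (by omega) (by omega), monoCoeff_gt (by omega), monoCoeff_gt h]
  exact artinS_braid (by omega)

/-- The monomial permutation `(k, g) ↦ (τ k, c k * g)`. -/
def monoPerm {ι G : Type} [Group G] (τ : Equiv.Perm ι) (c : ι → G) : Equiv.Perm (ι × G) where
  toFun x := (τ x.1, c x.1 * x.2)
  invFun x := (τ.symm x.1, (c (τ.symm x.1))⁻¹ * x.2)
  left_inv x := by simp
  right_inv x := by simp

/-- The permutation by which `σ_i` acts. -/
def monoGen (n i : ℕ) : Equiv.Perm (Fin (n + 1) × ArtinGroup n) :=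
  if h : i < n then monoPerm (adjSwap (n + 1) ⟨i, h⟩) (fun k => monoCoeff n i k) else 1

lemma monoGen_apply (hi : i < n) (k : Fin (n + 1)) (g : ArtinGroup n) :
    monoGen n i (k, g) = (adjSwap (n + 1) ⟨i, hi⟩ k, monoCoeff n i k * g) := by
  simp [monoGen, hi, monoPerm]

lemma adjSwap_comm {j : ℕ} (hij : i + 2 ≤ j) (hi : i < n) (hj : j < n) (k : Fin (n + 1)) :
    adjSwap (n + 1) ⟨i, hi⟩ (adjSwap (n + 1) ⟨j, hj⟩ k) =
      adjSwap (n + 1) ⟨j, hj⟩ (adjSwap (n + 1) ⟨i, hi⟩ k) := by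
  refine Fin.ext ?_
  simp only [adjSwap_val, natSwap]
  grind

lemma adjSwap_braid (hi : i < n) (hj : i + 1 < n) (k : Fin (n + 1)) :
    adjSwap (n + 1) ⟨i, hi⟩ (adjSwap (n + 1) ⟨i + 1, hj⟩ (adjSwap (n + 1) ⟨i, hi⟩ k)) =
      adjSwap (n + 1) ⟨i + 1, hj⟩ (adjSwap (n + 1) ⟨i, hi⟩ (adjSwap (n + 1) ⟨i + 1, hj⟩ k)) := by
  refine Fin.ext ?_
  simp only [adjSwap_val, natSwap]
  grind

/-- The monomial action of `B_{n+1}`. -/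
def monoAction (n : ℕ) : BraidGroup (n + 1) →* Equiv.Perm (Fin (n + 1) × ArtinGroup n) :=
  braidLift (n + 1) (monoGen n)
    (fun i j hij hj => by
      have hj : j < n := hj
      have hi : i < n := by omega
      refine Equiv.ext fun ⟨k, g⟩ => ?_
      simp only [Equiv.Perm.mul_apply, monoGen_apply hi, monoGen_apply hj,
        adjSwap_comm hij hi hj, adjSwap_val, ← mul_assoc, monoCoeff_comm hij])
    (fun i hj => by
      have hj : i + 1 < n := hj
      have hi : i < n := by omega
      refine Equiv.ext fun ⟨k, g⟩ => ?_
      simp only [Equiv.Perm.mul_apply, monoGen_apply hi, monoGen_apply hj,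
        adjSwap_braid hi hj, adjSwap_val]
      simp only [← mul_assoc, monoCoeff_braid hj (Nat.le_of_lt_succ k.2)])

lemma monoAction_gen (hi : i < n) (k : Fin (n + 1)) (g : ArtinGroup n) :
    monoAction n (braidGen (n + 1) i) (k, g) =
      (adjSwap (n + 1) ⟨i, hi⟩ k, monoCoeff n i k * g) := by
  rw [monoAction, braidLift_gen _ _ _ _ (by omega), monoGen_apply hi]

lemma monoAction_fst (b : BraidGroup (n + 1)) : ∀ x : Fin (n + 1) × ArtinGroup n,
    (monoAction n b x).1 = braidToPerm (n + 1) b x.1 := by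
  induction b using braid_induction with
  | one => simp
  | mul a b ha hb =>
    intro x
    rw [map_mul, map_mul, Equiv.Perm.mul_apply, Equiv.Perm.mul_apply, ha, hb]
  | inv a ha =>
    intro x
    have := ha (monoAction n a⁻¹ x)
    rw [← Equiv.Perm.mul_apply, ← map_mul, mul_inv_cancel, map_one, Equiv.Perm.one_apply] at this
    rw [this, map_inv (braidToPerm (n + 1))]
    exact ((braidToPerm (n + 1) a).symm_apply_apply _).symm
  | gen i hi =>
    rintro ⟨k, g⟩
    have hi' : i < n := hi
    rw [monoAction_gen hi', braidToPerm_gen hi]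

end ArtinSemidirect

/-! ### The embedding into the braid group with one more strand -/

section Embedding

variable (n : ℕ)

/-- The product `σ_{n-m} ⋯ σ_{n-1}` in `B_{n+1}`. -/
def braidTailAux (m : ℕ) : BraidGroup (n + 1) :=
  match m with
  | 0 => 1
  | m + 1 => braidGen (n + 1) (n - (m + 1)) * braidTailAux m

/-- The product `σ_k ⋯ σ_{n-1}` in `B_{n+1}`. -/
def braidTail (k : ℕ) : BraidGroup (n + 1) := braidTailAux n (n - k)

lemma braidTail_of_le {k : ℕ} (h : n ≤ k) : braidTail n k = 1 := by
  rw [braidTail, Nat.sub_eq_zero_of_le h]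
  rfl

lemma braidTail_eq {k : ℕ} : braidTail n k = braidGen (n + 1) k * braidTail n (k + 1) := by
  by_cases h : k < n
  · rw [braidTail, show n - k = (n - (k + 1)) + 1 by omega, braidTailAux, braidTail,
      show n - (n - (k + 1) + 1) = k by omega]
  · rw [braidTail_of_le n (by omega), braidTail_of_le n (by omega), braidGen,
      dif_neg (by omega), one_mul]

lemma braidGen_mul_braidTail {i k : ℕ} (h : i + 2 ≤ k) :
    braidGen (n + 1) i * braidTail n k = braidTail n k * braidGen (n + 1) i := by
  by_cases hk : n ≤ k
  · simp [braidTail_of_le n hk]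
  · induction (not_le.1 hk).le using Nat.decreasingInduction with
    | self => simp at hk
    | of_succ k hk' ih =>
      rw [braidTail_eq, ← mul_assoc, braidGen_comm _ h, mul_assoc, mul_assoc]
      congr 1
      by_cases h' : n ≤ k + 1
      · simp [braidTail_of_le n h']
      · exact ih (by omega) h'

/-- Passing through the tail lowers the index by one: the braid relation acts at the factor `σ_j`,
and all other factors commute. -/
lemma braidGen_succ_mul_braidTail {j k : ℕ} (h : k ≤ j) (hj : j + 1 < n) :
    braidGen (n + 1) (j + 1) * braidTail n k = braidTail n k * braidGen (n + 1) j := by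
  induction h using Nat.decreasingInduction with
  | self =>
    rw [braidTail_eq, braidTail_eq, ← mul_assoc, ← mul_assoc, ← braidGen_braid (by omega),
      mul_assoc, braidGen_mul_braidTail n (by omega)]
    simp only [mul_assoc]
  | of_succ k hk ih =>
    rw [braidTail_eq, ← mul_assoc, ← braidGen_comm _ (by omega), mul_assoc, ih, mul_assoc]

/-- The pure braid `U_{k+1}⁻¹ σ_k² U_{k+1}`, with `U_k = σ_k ⋯ σ_{n-1}`. -/
def braidA (k : ℕ) : BraidGroup (n + 1) :=
  (braidTail n (k + 1))⁻¹ * (braidGen (n + 1) k * braidTail n k)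

lemma braidTail_mul_braidA (k : ℕ) :
    braidTail n (k + 1) * braidA n k = braidGen (n + 1) k * braidTail n k := by
  rw [braidA, mul_inv_cancel_left]

/-- With `a = σ_i`, `b = σ_{i+1}` and `V = U_{i+2}` this is `σ_i A_{i+1} = A_i σ_i`; only the braid
relation and the commutation of `a` with `V` matter. -/
lemma braid_identity₁ {B : Type} [Group B] {a b V : B} (hb : a * b * a = b * a * b)
    (hV : a * V = V * a) :
    a * (V⁻¹ * (b * (b * V))) = (b * V)⁻¹ * (a * (a * (b * V))) * a := by
  have hV' : a * V⁻¹ = V⁻¹ * a := by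
    rw [eq_inv_mul_iff_mul_eq, ← mul_assoc, ← hV, mul_assoc, mul_inv_cancel, mul_one]
  have h : b * a * b * b = a * a * b * a := by
    rw [← hb, mul_assoc (a * b), mul_assoc a b, ← mul_assoc b a b, ← hb]
    simp only [mul_assoc]
  have h' : a * b * b = b⁻¹ * a * a * b * a := by
    have := congrArg (b⁻¹ * ·) h
    simpa only [mul_assoc, inv_mul_cancel_left] using this
  calc a * (V⁻¹ * (b * (b * V))) = (a * V⁻¹) * (b * (b * V)) := by rw [mul_assoc]
    _ = V⁻¹ * (a * b * b) * V := by rw [hV']; simp only [mul_assoc]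
    _ = V⁻¹ * (b⁻¹ * a * a * b) * (a * V) := by rw [h']; simp only [mul_assoc]
    _ = _ := by rw [hV]; simp only [mul_assoc, mul_inv_rev]

lemma braid_identity₂ {B : Type} [Group B] {a b V : B} (hb : a * b * a = b * a * b)
    (hV : a * V = V * a) :
    a * (V⁻¹ * (b * (b * V))) * ((b * V)⁻¹ * (a * (a * (b * V)))) =
      V⁻¹ * (b * (b * V)) * ((b * V)⁻¹ * (a * (a * (b * V)))) * a := by
  have hV' : a * V⁻¹ = V⁻¹ * a := by
    rw [eq_inv_mul_iff_mul_eq, ← mul_assoc, ← hV, mul_assoc, mul_inv_cancel, mul_one]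
  have h : a * b * a * a * b = b * a * a * b * a := by
    rw [hb, mul_assoc (b * a), mul_assoc (b * a), ← hb]
    simp only [mul_assoc]
  have e : V⁻¹ * (b * (b * V)) * ((b * V)⁻¹ * (a * (a * (b * V)))) =
      V⁻¹ * (b * a * a * b * V) := by group
  rw [mul_assoc a, e, ← mul_assoc, hV', mul_assoc V⁻¹, mul_assoc V⁻¹]
  congr 1
  calc a * (b * a * a * b * V) = a * b * a * a * b * V := by simp only [mul_assoc]
    _ = b * a * a * b * (a * V) := by rw [h]; simp only [mul_assoc]
    _ = _ := by rw [hV]; simp only [mul_assoc]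

variable {n}

lemma braidGen_mul_braidA_succ {i : ℕ} (hi : i + 1 < n) :
    braidGen (n + 1) i * braidA n (i + 1) = braidA n i * braidGen (n + 1) i := by
  rw [braidA, braidA, braidTail_eq n (k := i), braidTail_eq n (k := i + 1)]
  exact braid_identity₁ (braidGen_braid (by omega)) (braidGen_mul_braidTail n (by omega))

lemma braidGen_mul_braidA_mul {i : ℕ} (hi : i + 1 < n) :
    braidGen (n + 1) i * braidA n (i + 1) * braidA n i =
      braidA n (i + 1) * braidA n i * braidGen (n + 1) i := by
  rw [braidA, braidA, braidTail_eq n (k := i), braidTail_eq n (k := i + 1)]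
  exact braid_identity₂ (braidGen_braid (by omega)) (braidGen_mul_braidTail n (by omega))

/-- For `k < i` the generator becomes `σ_{i+1}` while passing the inverse tail and returns to `σ_i`
at the other end; for `k > i + 1` it commutes with every factor. -/
lemma braidGen_mul_braidA_of_ne {i k : ℕ} (hi : i + 1 < n) (h : k ≠ i) (h' : k ≠ i + 1) :
    braidGen (n + 1) i * braidA n k = braidA n k * braidGen (n + 1) i := by
  rw [braidA, braidTail_eq n (k := k)]
  rcases lt_or_ge k i with hk | hk
  · have e := braidGen_succ_mul_braidTail n (j := i) (k := k + 1) hk hi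
    have c : Commute (braidGen (n + 1) k) (braidGen (n + 1) (i + 1)) :=
      braidGen_comm _ (by omega)
    have e' : braidGen (n + 1) i * (braidTail n (k + 1))⁻¹ =
        (braidTail n (k + 1))⁻¹ * braidGen (n + 1) (i + 1) := by
      rw [mul_inv_eq_iff_eq_mul, mul_assoc, e, inv_mul_cancel_left]
    rw [← mul_assoc, e', mul_assoc, mul_assoc, mul_assoc, mul_assoc, ← e]
    simp only [← mul_assoc]
    rw [mul_assoc _ (braidGen (n + 1) (i + 1)), ← c.eq, ← mul_assoc,
      mul_assoc _ (braidGen (n + 1) (i + 1)), ← c.eq, ← mul_assoc]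
  · have c : Commute (braidGen (n + 1) i) (braidGen (n + 1) k) := braidGen_comm _ (by omega)
    have d : Commute (braidGen (n + 1) i) (braidTail n (k + 1)) :=
      braidGen_mul_braidTail n (by omega)
    exact (d.inv_right.mul_right (c.mul_right (c.mul_right d))).eq

variable (n)

/-- The inclusion of braid groups which adds a strand. -/
def braidIncl : BraidGroup n →* BraidGroup (n + 1) :=
  braidLift n (braidGen (n + 1)) (fun _ _ h _ => braidGen_comm _ h)
    (fun _ h => braidGen_braid (by omega))

lemma braidIncl_gen {i : ℕ} (hi : i < n - 1) :
    braidIncl n (braidGen n i) = braidGen (n + 1) i := braidLift_gen _ _ _ _ hi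

/-- The homomorphism from the free group to the braid group. -/
def freeToBraid : FreeGroup (Fin n) →* BraidGroup (n + 1) :=
  FreeGroup.lift fun k => braidA n k

lemma freeToBraid_gen {k : ℕ} (hk : k < n) : freeToBraid n (freeGen n k) = braidA n k := by
  rw [freeGen_of_lt hk, freeToBraid, FreeGroup.lift_apply_of]

/-- The elements `A_k` satisfy in `B_{n+1}` the relations that define Artin's action. This
compatibility lets the semidirect product map to `B_{n+1}`. -/
lemma freeToBraid_artinAction (b : BraidGroup n) : ∀ x,
    freeToBraid n (artinAction n b x) = braidIncl n b * freeToBraid n x * (braidIncl n b)⁻¹ := by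
  induction b using braid_induction with
  | one => simp
  | mul a b ha hb =>
    intro x
    rw [map_mul, MulAut.mul_apply, ha, hb, map_mul]
    group
  | inv a ha =>
    intro x
    have := ha (artinAction n a⁻¹ x)
    rw [← MulAut.mul_apply, ← map_mul, mul_inv_cancel, map_one, MulAut.one_apply] at this
    rw [this, map_inv (braidIncl n)]
    group
  | gen i hi =>
    have hi' : i + 1 < n := by omega
    have key : (freeToBraid n).comp (artinHom n i) =
        (MulAut.conj (braidGen (n + 1) i)).toMonoidHom.comp (freeToBraid n) := by
      refine freeGroup_ext _ _ fun k hk => ?_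
      simp only [MonoidHom.comp_apply, MulEquiv.toMonoidHom_eq_coe, MonoidHom.coe_coe,
        MulAut.conj_apply]
      rcases eq_or_ne k i with rfl | h
      · rw [artinHom_self hi']
        simp only [map_mul, map_inv, freeToBraid_gen n hk, freeToBraid_gen n hi']
        rw [eq_mul_inv_iff_mul_eq, mul_assoc, mul_assoc, inv_mul_eq_iff_eq_mul, ← mul_assoc,
          ← mul_assoc, ← braidGen_mul_braidA_mul hi', braidGen_mul_braidA_succ hi', mul_assoc]
      rcases eq_or_ne k (i + 1) with rfl | h'
      · rw [artinHom_succ hi', freeToBraid_gen n (by omega), freeToBraid_gen n (by omega),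
          braidGen_mul_braidA_succ hi', mul_inv_cancel_right]
      · rw [artinHom_of_ne h h', freeToBraid_gen n hk, braidGen_mul_braidA_of_ne hi' h h',
          mul_inv_cancel_right]
    intro x
    rw [artinAction_gen hi, braidIncl_gen n hi]
    exact DFunLike.congr_fun key x

/-- The embedding of the semidirect product into `B_{n+1}`. -/
def artinToBraid : ArtinGroup n →* BraidGroup (n + 1) :=
  SemidirectProduct.lift (freeToBraid n) (braidIncl n) fun b =>
    MonoidHom.ext fun x => freeToBraid_artinAction n b x

lemma artinToBraid_artinX {k : ℕ} (hk : k < n) : artinToBraid n (artinX n k) = braidA n k := by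
  rw [artinToBraid, artinX, SemidirectProduct.lift_inl, freeToBraid_gen n hk]

lemma artinToBraid_artinS {i : ℕ} (hi : i < n - 1) :
    artinToBraid n (artinS n i) = braidGen (n + 1) i := by
  rw [artinToBraid, artinS, SemidirectProduct.lift_inr, braidIncl_gen n hi]

lemma braidGen_mul_braidTail_eq {i k : ℕ} (hi : i < n) (hk : k ≤ n) :
    braidGen (n + 1) i * braidTail n k =
      braidTail n (natSwap i k) * artinToBraid n (monoCoeff n i k) := by
  rcases lt_trichotomy k i with h | rfl | h
  · obtain ⟨i, rfl⟩ : ∃ i', i = i' + 1 := ⟨i - 1, by omega⟩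
    rw [natSwap_of_ne (by omega) (by omega), monoCoeff_lt h, artinToBraid_artinS n (by omega)]
    exact braidGen_succ_mul_braidTail n (by omega) hi
  · rw [natSwap_self, monoCoeff_self, artinToBraid_artinX n hi, braidTail_mul_braidA]
  obtain rfl | h := eq_or_lt_of_le (Nat.succ_le_of_lt h)
  · rw [Nat.succ_eq_add_one, natSwap_succ, monoCoeff_succ, map_one, mul_one, ← braidTail_eq]
  rw [Nat.succ_eq_add_one] at h
  rw [natSwap_of_ne (by omega) (by omega), monoCoeff_gt h, artinToBraid_artinS n (by omega)]
  exact braidGen_mul_braidTail n h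

/-- The evaluation map, which is equivariant for the monomial action. -/
def monoEval (x : Fin (n + 1) × ArtinGroup n) : BraidGroup (n + 1) :=
  braidTail n x.1 * artinToBraid n x.2

/-- Equivariance is what the coefficients were designed for; it recovers a braid from its action on
one point. -/
lemma monoEval_monoAction (b : BraidGroup (n + 1)) : ∀ x,
    monoEval n (monoAction n b x) = b * monoEval n x := by
  induction b using braid_induction with
  | one => simp
  | mul a b ha hb =>
    intro x
    rw [map_mul, Equiv.Perm.mul_apply, ha, hb, mul_assoc]
  | inv a ha =>
    intro x
    have := ha (monoAction n a⁻¹ x)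
    rw [← Equiv.Perm.mul_apply, ← map_mul, mul_inv_cancel, map_one, Equiv.Perm.one_apply] at this
    rw [this, inv_mul_cancel_left]
  | gen i hi =>
    rintro ⟨k, g⟩
    have hi' : i < n := hi
    rw [monoAction_gen hi', monoEval, monoEval]
    simp only [adjSwap_val, map_mul]
    rw [← mul_assoc, ← mul_assoc, braidGen_mul_braidTail_eq n hi (Nat.le_of_lt_succ k.2)]

lemma monoAction_braidTail {k : ℕ} (hk : k ≤ n) (h : ArtinGroup n) :
    monoAction n (braidTail n k) (Fin.last n, h) = (⟨k, Nat.lt_succ_of_le hk⟩, h) := by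
  induction hk using Nat.decreasingInduction with
  | self =>
    rw [braidTail_of_le n le_rfl, map_one]
    rfl
  | of_succ k hk ih =>
    rw [braidTail_eq, map_mul, Equiv.Perm.mul_apply, ih, monoAction_gen hk, monoCoeff_succ,
      one_mul]
    refine Prod.ext (Fin.ext ?_) rfl
    simp [adjSwap_val, natSwap_succ]

/-- On the fibre over the last strand the semidirect product acts by left translation. Translation
is faithful, which is the source of injectivity of the embedding. -/
lemma monoAction_artinToBraid (g : ArtinGroup n) : ∀ h,
    monoAction n (artinToBraid n g) (Fin.last n, h) = (Fin.last n, g * h) := by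
  let S : Subgroup (ArtinGroup n) :=
    { carrier := {g | ∀ h, monoAction n (artinToBraid n g) (Fin.last n, h) = (Fin.last n, g * h)}
      mul_mem' := fun {a b} ha hb h => by
        rw [map_mul, map_mul, Equiv.Perm.mul_apply, hb, ha, mul_assoc]
      one_mem' := fun h => by simp
      inv_mem' := fun {a} ha h => by
        rw [map_inv, map_inv, Equiv.Perm.inv_eq_iff_eq, ha, mul_inv_cancel_left] }
  suffices hS : g ∈ S from hS
  have hl : ∀ x, SemidirectProduct.inl x ∈ S := by
    intro x
    induction x using FreeGroup.induction_on with
    | C1 => rw [map_one]; exact S.one_mem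
    | of k =>
      have hk : FreeGroup.of k = freeGen n k := (freeGen_of_lt k.2).symm
      rw [hk]
      intro h
      change monoAction n (artinToBraid n (artinX n k)) _ = (_, artinX n k * h)
      rw [artinToBraid_artinX n k.2, braidA, map_mul, map_inv, Equiv.Perm.mul_apply,
        Equiv.Perm.inv_eq_iff_eq, monoAction_braidTail n k.2, map_mul, Equiv.Perm.mul_apply,
        monoAction_braidTail n k.2.le, monoAction_gen k.2, monoCoeff_self]
      refine Prod.ext (Fin.ext ?_) rfl
      simp [adjSwap_val, natSwap_self]
    | inv_of k hk => rw [map_inv]; exact S.inv_mem hk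
    | mul x y hx hy => rw [map_mul]; exact S.mul_mem hx hy
  have hr : ∀ b, SemidirectProduct.inr b ∈ S := by
    intro b
    induction b using braid_induction with
    | one => rw [map_one]; exact S.one_mem
    | mul x y hx hy => rw [map_mul]; exact S.mul_mem hx hy
    | inv x hx => rw [map_inv]; exact S.inv_mem hx
    | gen i hi =>
      intro h
      change monoAction n (artinToBraid n (artinS n i)) _ = (_, artinS n i * h)
      rw [artinToBraid_artinS n hi, monoAction_gen (show i < n by omega),
        monoCoeff_gt (show i + 1 < ((Fin.last n : Fin (n + 1)) : ℕ) by simp; omega)]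
      refine Prod.ext (Fin.ext ?_) rfl
      rw [adjSwap_val]
      exact natSwap_of_ne (by simp; omega) (by simp; omega)
  rw [← SemidirectProduct.inl_left_mul_inr_right g]
  exact S.mul_mem (hl _) (hr _)

lemma artinToBraid_injective : Function.Injective (artinToBraid n) := by
  refine (injective_iff_map_eq_one _).2 fun g hg => ?_
  have := monoAction_artinToBraid n g 1
  rw [hg, map_one, Equiv.Perm.one_apply, mul_one] at this
  exact (Prod.ext_iff.1 this).2.symm

/-- If `b` fixes the last strand, then its action on `(last, 1)` stays over the last strand, and
evaluating there writes `b` as the image of the second coordinate. -/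
lemma exists_artinToBraid_eq {b : BraidGroup (n + 1)}
    (hb : braidToPerm (n + 1) b (Fin.last n) = Fin.last n) : ∃ g, artinToBraid n g = b := by
  refine ⟨(monoAction n b (Fin.last n, 1)).2, ?_⟩
  have h := monoEval_monoAction n b (Fin.last n, 1)
  have h1 := monoAction_fst b (Fin.last n, 1)
  rw [monoEval, h1, hb, monoEval] at h
  simpa [braidTail_of_le n le_rfl] using h

end Embedding

end FreeToK
end

noncomputable section

namespace FreeToK

/-! ### The homology of pure braid groups -/

section PureBraid

variable (n : ℕ)

lemma braidToPerm_braidIncl (b : BraidGroup n) : ∀ k : Fin n,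
    braidToPerm (n + 1) (braidIncl n b) k.castSucc = (braidToPerm n b k).castSucc := by
  induction b using braid_induction with
  | one => simp
  | mul a b ha hb =>
    intro k
    rw [map_mul, map_mul, map_mul, Equiv.Perm.mul_apply, Equiv.Perm.mul_apply, hb, ha]
  | inv a ha =>
    intro k
    rw [map_inv, map_inv, map_inv, Equiv.Perm.inv_eq_iff_eq, ha]
    exact congrArg Fin.castSucc ((braidToPerm n a).apply_symm_apply k).symm
  | gen i hi =>
    intro k
    rw [braidIncl_gen n hi, braidToPerm_gen hi, braidToPerm_gen (show i < n + 1 - 1 by omega)]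
    refine Fin.ext ?_
    rw [Fin.val_castSucc, adjSwap_val, adjSwap_val]
    rfl

lemma braidToPerm_braidIncl_eq_one_iff (b : BraidGroup n) :
    braidToPerm (n + 1) (braidIncl n b) = 1 ↔ braidToPerm n b = 1 := by
  constructor
  · intro h
    refine Equiv.ext fun k => Fin.castSucc_injective n ?_
    rw [← braidToPerm_braidIncl, h]
    rfl
  · intro h
    have hc : ∀ k : Fin n, braidToPerm (n + 1) (braidIncl n b) k.castSucc = k.castSucc := by
      intro k
      rw [braidToPerm_braidIncl, h]
      rfl
    refine Equiv.ext fun k => ?_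
    rw [Equiv.Perm.one_apply]
    induction k using Fin.lastCases with
    | cast k => exact hc k
    | last =>
      generalize hl : braidToPerm (n + 1) (braidIncl n b) (Fin.last n) = l
      induction l using Fin.lastCases with
      | last => rfl
      | cast k =>
        rw [← hc k] at hl
        exact absurd ((braidToPerm (n + 1) (braidIncl n b)).injective hl)
          (Fin.castSucc_lt_last k).ne'

lemma braidToPerm_freeToBraid (x : FreeGroup (Fin n)) :
    braidToPerm (n + 1) (freeToBraid n x) = 1 := by
  have : (braidToPerm (n + 1)).comp (freeToBraid n) = 1 := by
    refine freeGroup_ext _ _ fun k hk => ?_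
    -- `A_k` is a conjugate of `σ_k²`, whose permutation is trivial.
    rw [MonoidHom.comp_apply, freeToBraid_gen n hk, braidA, braidTail_eq n (k := k), map_mul,
      map_mul, map_mul, ← mul_assoc (braidToPerm (n + 1) (braidGen (n + 1) k)),
      braidToPerm_gen (show k < n + 1 - 1 from hk), adjSwap, Equiv.swap_mul_self, one_mul, map_inv,
      inv_mul_cancel]
    rfl
  exact DFunLike.congr_fun this x

/-- Artin's action of the pure braid group on the free group. -/
abbrev pureAction : PureBraidGroup n →* MulAut (FreeGroup (Fin n)) :=
  (artinAction n).comp (braidToPerm n).ker.subtype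

/-- The homomorphism from the semidirect product to the braid group. -/
def pureToBraid : FreeGroup (Fin n) ⋊[pureAction n] PureBraidGroup n →* BraidGroup (n + 1) :=
  (artinToBraid n).comp
    (SemidirectProduct.map (MonoidHom.id _) (braidToPerm n).ker.subtype fun _ => rfl)

lemma pureToBraid_apply (x : FreeGroup (Fin n) ⋊[pureAction n] PureBraidGroup n) :
    pureToBraid n x = freeToBraid n x.left * braidIncl n x.right := rfl

/-- The pure braid group as an iterated semidirect product. -/
def pureBraidEquiv :
    FreeGroup (Fin n) ⋊[pureAction n] PureBraidGroup n ≃* PureBraidGroup (n + 1) :=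
  MulEquiv.ofBijective ((pureToBraid n).codRestrict _ fun x => by
      rw [MonoidHom.mem_ker, pureToBraid_apply, map_mul, braidToPerm_freeToBraid, one_mul,
        braidToPerm_braidIncl_eq_one_iff]
      exact x.right.2) (by
    constructor
    · intro x y h
      have h := artinToBraid_injective n (Subtype.ext_iff.1 h)
      refine SemidirectProduct.ext (congrArg (fun z : ArtinGroup n => z.left) h) ?_
      exact Subtype.ext (congrArg (fun z : ArtinGroup n => z.right) h)
    · rintro ⟨b, hb⟩
      have hb' : braidToPerm (n + 1) b = 1 := hb
      obtain ⟨g, rfl⟩ := exists_artinToBraid_eq n (b := b) (by rw [hb']; rfl)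
      have hg : braidToPerm n g.right = 1 := by
        rw [← braidToPerm_braidIncl_eq_one_iff]
        have : artinToBraid n g = freeToBraid n g.left * braidIncl n g.right := rfl
        rwa [this, map_mul, braidToPerm_freeToBraid, one_mul] at hb'
      exact ⟨⟨g.left, ⟨g.right, hg⟩⟩, rfl⟩)

lemma exponentSums_pureAction (p : PureBraidGroup n) (x : FreeGroup (Fin n)) :
    exponentSums n (pureAction n p x) = exponentSums n x := by
  have hp : braidToPerm n p.1 = 1 := p.2
  refine congrArg Multiplicative.ofAdd (a₁ := (exponentSums n (pureAction n p x)).toAdd)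
    (a₂ := (exponentSums n x).toAdd) (funext fun k => ?_)
  have := exponentSums_artinAction p.1 x k
  rwa [hp] at this

/-- Isomorphic groups have isomorphic homology with trivial coefficients. -/
def homologyIsoOfMulEquiv {G H : Type} [Group G] [Group H] (e : G ≃* H) (m : ℕ) :
    groupHomology (Rep.trivial ℤ G ℤ) m ≅ groupHomology (Rep.trivial ℤ H ℤ) m :=
  groupHomology.mapIso e (LinearEquiv.refl ℤ ℤ) (fun _ => rfl) m

lemma exists_homology_pureBraid_succ (m : ℕ)
    (h : Limits.IsZero (groupHomology (Rep.trivial ℤ (PureBraidGroup n) ℤ) (m + 1))) :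
    Nonempty (groupHomology (Rep.trivial ℤ (PureBraidGroup (n + 1)) ℤ) (m + 1) ≃+
      (Fin n → groupHomology (Rep.trivial ℤ (PureBraidGroup n) ℤ) m)) := by
  obtain ⟨e⟩ := homology_semidirect (pureAction n) (exponentSums_pureAction n) m h
  exact ⟨((homologyIsoOfMulEquiv (pureBraidEquiv n) (m + 1)).toLinearEquiv.toAddEquiv).symm.trans e⟩

instance : Subsingleton (BraidGroup 1) := by
  have : Subsingleton (FreeGroup (Fin (1 - 1))) :=
    inferInstanceAs (Subsingleton (FreeGroup (Fin 0)))
  exact (QuotientGroup.mk_surjective).subsingleton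

/-- The vanishing above degree `n` has to be carried along in the induction, because the semidirect
product formula is available only above the top degree of `P_n`. -/
lemma homology_pureBraid_aux :
    (∀ m, n < m → Limits.IsZero (groupHomology (Rep.trivial ℤ (PureBraidGroup (n + 1)) ℤ) m)) ∧
    Nonempty (groupHomology (Rep.trivial ℤ (PureBraidGroup (n + 1)) ℤ) n ≃+
      (Fin n.factorial → ℤ)) := by
  induction n with
  | zero =>
    have : Subsingleton (PureBraidGroup (0 + 1)) :=
      inferInstanceAs (Subsingleton (braidToPerm 1).ker)
    constructor
    · rintro (_ | m) hm
      · exact absurd hm (lt_irrefl 0)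
      · exact isZero_groupHomology_succ_of_subsingleton _ m
    · exact ⟨((groupHomology.H0IsoOfIsTrivial
        (Rep.trivial ℤ (PureBraidGroup (0 + 1)) ℤ)).toLinearEquiv.toAddEquiv).trans
        (LinearEquiv.funUnique (Fin 1) ℤ ℤ).symm.toAddEquiv⟩
  | succ n ih =>
    obtain ⟨h0, ⟨e⟩⟩ := ih
    constructor
    · rintro (_ | m) hm
      · omega
      · obtain ⟨f⟩ := exists_homology_pureBraid_succ (n + 1) m (h0 _ (by omega))
        have := ModuleCat.subsingleton_of_isZero (h0 m (by omega))
        have := f.toEquiv.subsingleton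
        exact ModuleCat.isZero_of_subsingleton _
    · obtain ⟨f⟩ := exists_homology_pureBraid_succ (n + 1) n (h0 _ (by omega))
      refine ⟨(f.trans (AddEquiv.piCongrRight fun _ => e)).trans ?_⟩
      have e' : Fin (n + 1) × Fin n.factorial ≃ Fin (n + 1).factorial :=
        finProdFinEquiv.trans (finCongr rfl)
      exact (LinearEquiv.curry ℤ ℤ (Fin (n + 1)) (Fin n.factorial)).symm.toAddEquiv.trans
        (LinearEquiv.funCongrLeft ℤ ℤ e'.symm).toAddEquiv

/-- `H_{n-1}(P_n; ℤ)` is free abelian of rank `(n - 1)!`. -/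
theorem homology_pureBraid (hn : 1 ≤ n) :
    Nonempty (groupHomology (Rep.trivial ℤ (PureBraidGroup n) ℤ) (n - 1) ≃+
      (Fin (n - 1).factorial → ℤ)) := by
  obtain ⟨n, rfl⟩ : ∃ m, n = m + 1 := ⟨n - 1, by omega⟩
  exact (homology_pureBraid_aux n).2

end PureBraid

end FreeToK
end

noncomputable section

namespace FreeToK

/-! ### Fillers in simplicial groups -/

section Fillers

variable (G : SimplicialObject GrpCat.{0})

/-- The face homomorphisms of a simplicial group. -/
abbrev faceHom {n : ℕ} (i : Fin (n + 2)) : G _⦋n + 1⦌ →* G _⦋n⦌ := (G.δ i).hom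

/-- The degeneracy homomorphisms of a simplicial group. -/
abbrev degHom {n : ℕ} (i : Fin (n + 1)) : G _⦋n⦌ →* G _⦋n + 1⦌ := (G.σ i).hom

variable {n : ℕ}

lemma faceHom_faceHom {i j : Fin (n + 2)} (h : i ≤ j) (g : G _⦋n + 2⦌) :
    faceHom G i (faceHom G j.succ g) = faceHom G j (faceHom G i.castSucc g) :=
  ConcreteCategory.congr_hom (G.δ_comp_δ h) g

lemma faceHom_degHom_of_le {i : Fin (n + 2)} {j : Fin (n + 1)} (h : i ≤ j.castSucc)
    (g : G _⦋n + 1⦌) :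
    faceHom G i.castSucc (degHom G j.succ g) = degHom G j (faceHom G i g) :=
  ConcreteCategory.congr_hom (G.δ_comp_σ_of_le h) g

lemma faceHom_degHom_of_gt {i : Fin (n + 2)} {j : Fin (n + 1)} (h : j.castSucc < i)
    (g : G _⦋n + 1⦌) :
    faceHom G i.succ (degHom G j.castSucc g) = degHom G j (faceHom G i g) :=
  ConcreteCategory.congr_hom (G.δ_comp_σ_of_gt h) g

lemma faceHom_degHom_self {i : Fin (n + 1)} (g : G _⦋n⦌) :
    faceHom G i.castSucc (degHom G i g) = g :=
  ConcreteCategory.congr_hom G.δ_comp_σ_self g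

lemma faceHom_degHom_succ {i : Fin (n + 1)} (g : G _⦋n⦌) :
    faceHom G i.succ (degHom G i g) = g :=
  ConcreteCategory.congr_hom G.δ_comp_σ_succ g

variable {G}

/-- A family of elements with compatible faces, away from the index `k`. -/
def HornCompatible (k : Fin (n + 3)) (x : Fin (n + 3) → G _⦋n + 1⦌) : Prop :=
  ∀ i j : Fin (n + 2), i ≤ j → i.castSucc ≠ k → j.succ ≠ k →
    faceHom G i (x j.succ) = faceHom G j (x i.castSucc)

/-- Moore's argument: the faces are corrected one at a time in increasing order, multiplying by a
degeneracy of the error. Compatibility makes the lower faces of the error trivial, so the earlier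
corrections survive. -/
lemma exists_filler_lower {k : Fin (n + 3)} {x : Fin (n + 3) → G _⦋n + 1⦌}
    (hx : HornCompatible k x) (r : ℕ) (hr : r ≤ k) :
    ∃ g : G _⦋n + 2⦌, ∀ j : Fin (n + 3), j.1 < r → faceHom G j g = x j := by
  induction r with
  | zero => exact ⟨1, fun j hj => absurd hj (Nat.not_lt_zero _)⟩
  | succ r ih =>
    obtain ⟨g, hg⟩ := ih (by omega)
    obtain ⟨p, hp⟩ : ∃ p : Fin (n + 2), p.1 = r := ⟨⟨r, by omega⟩, rfl⟩
    refine ⟨g * degHom G p ((faceHom G p.castSucc g)⁻¹ * x p.castSucc), fun j hj => ?_⟩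
    rcases Nat.lt_succ_iff_lt_or_eq.1 hj with hj | hj
    · obtain ⟨i, rfl⟩ : ∃ i : Fin (n + 2), j = i.castSucc := ⟨⟨j.1, by omega⟩, rfl⟩
      have hj' : i.1 < r := hj
      obtain ⟨q, rfl⟩ : ∃ q : Fin (n + 1), p = q.succ :=
        ⟨⟨r - 1, by omega⟩, Fin.ext (by simp; omega)⟩
      have hq : q.1 + 1 = r := by simpa using hp
      have hle : i ≤ q.castSucc := Fin.le_def.2 (by simp; omega)
      have h1 : faceHom G i (faceHom G q.castSucc.succ g) = faceHom G i (x q.castSucc.succ) := by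
        rw [faceHom_faceHom G hle, hg _ hj]
        refine (hx i q.castSucc hle ?_ ?_).symm
        · exact fun h => absurd (congrArg Fin.val h) (by simp; omega)
        · exact fun h => absurd (congrArg Fin.val h) (by simp; omega)
      rw [map_mul, hg _ hj, faceHom_degHom_of_le G hle, map_mul, map_inv, Fin.castSucc_succ, h1,
        inv_mul_cancel, map_one, mul_one]
    · obtain rfl : j = p.castSucc := Fin.ext (by simp [hj, hp])
      rw [map_mul, faceHom_degHom_self, mul_inv_cancel_left]

/-- The faces above `k` are corrected from the top downwards. The face `r` uses the degeneracy of
index `r - 1`, so that both the faces below `k` and those above `r` of the correction are trivial.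
-/
lemma exists_filler_upper {k : Fin (n + 3)} {x : Fin (n + 3) → G _⦋n + 1⦌}
    (hx : HornCompatible k x) (r : ℕ) (hr : k < r) (hr' : r ≤ n + 3) :
    ∃ g : G _⦋n + 2⦌, ∀ j : Fin (n + 3), j < k ∨ r ≤ j.1 → faceHom G j g = x j := by
  induction hr' using Nat.decreasingInduction with
  | self =>
    obtain ⟨g, hg⟩ := exists_filler_lower hx k le_rfl
    refine ⟨g, fun j hj => hg j ?_⟩
    have := j.2
    rcases hj with hj | hj
    · exact hj
    · omega
  | of_succ r hr' ih =>
    obtain ⟨g, hg⟩ := ih (by omega)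
    obtain ⟨p, hp⟩ : ∃ p : Fin (n + 2), p.1 + 1 = r := ⟨⟨r - 1, by omega⟩, by simp; omega⟩
    refine ⟨g * degHom G p ((faceHom G p.succ g)⁻¹ * x p.succ), fun j hj => ?_⟩
    have hpk : p.succ ≠ k := fun h => absurd (congrArg Fin.val h) (by simp; omega)
    rcases lt_trichotomy j.1 r with h | h | h
    · replace hj : j < k := by omega
      obtain ⟨i, rfl⟩ : ∃ i : Fin (n + 2), j = i.castSucc := ⟨⟨j.1, by omega⟩, rfl⟩
      have hik : i.1 < k.1 := hj
      obtain ⟨q, rfl⟩ : ∃ q : Fin (n + 1), p = q.succ :=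
        ⟨⟨p.1 - 1, by omega⟩, Fin.ext (by simp; omega)⟩
      have hq : q.1 + 1 + 1 = r := by simpa using hp
      have hle : i ≤ q.castSucc := Fin.le_def.2 (by simp; omega)
      have hle' : i ≤ q.succ := Fin.le_def.2 (by simp; omega)
      have h1 : faceHom G i (faceHom G q.succ.succ g) = faceHom G i (x q.succ.succ) := by
        rw [faceHom_faceHom G hle', hg _ (Or.inl hj)]
        exact (hx i q.succ hle' hj.ne hpk).symm
      rw [map_mul, hg _ (Or.inl hj), faceHom_degHom_of_le G hle, map_mul, map_inv, h1,
        inv_mul_cancel, map_one, mul_one]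
    · obtain rfl : j = p.succ := Fin.ext (by simp [h, hp])
      rw [map_mul, faceHom_degHom_succ, mul_inv_cancel_left]
    · obtain ⟨i, rfl⟩ : ∃ i : Fin (n + 2), j = i.succ :=
        ⟨⟨j.1 - 1, by omega⟩, Fin.ext (by simp; omega)⟩
      have h' : r < i.1 + 1 := h
      obtain ⟨q, rfl⟩ : ∃ q : Fin (n + 1), p = q.castSucc := ⟨⟨p.1, by omega⟩, rfl⟩
      have hq : q.1 + 1 = r := hp
      have hlt : q.castSucc < i := Fin.lt_def.2 (by simp; omega)
      have hle : q.succ ≤ i := Fin.le_def.2 (by simp; omega)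
      have hj' : i.succ < k ∨ r + 1 ≤ i.succ.1 := Or.inr h'
      have h1 : faceHom G i (faceHom G q.succ.castSucc g) =
          faceHom G i (x q.succ.castSucc) := by
        rw [← faceHom_faceHom G hle, hg _ hj']
        exact hx q.succ i hle hpk (fun h => absurd (congrArg Fin.val h) (by simp; omega))
      rw [map_mul, hg _ hj', faceHom_degHom_of_gt G hlt, map_mul, map_inv, Fin.succ_castSucc, h1,
        inv_mul_cancel, map_one, mul_one]

/-- Simplicial groups satisfy the Kan condition. -/
lemma exists_filler {k : Fin (n + 3)} {x : Fin (n + 3) → G _⦋n + 1⦌} (hx : HornCompatible k x) :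
    ∃ g : G _⦋n + 2⦌, ∀ j : Fin (n + 3), j ≠ k → faceHom G j g = x j := by
  obtain ⟨g, hg⟩ := exists_filler_upper hx (k + 1) (by omega) (by omega)
  refine ⟨g, fun j hj => hg j ?_⟩
  rcases lt_or_gt_of_ne hj with h | h
  · exact Or.inl h
  · exact Or.inr h

variable {H : SimplicialObject GrpCat.{0}} (f : G ⟶ H)

/-- The homomorphism in degree `n` of a morphism of simplicial groups. -/
abbrev appHom (n : ℕ) : G _⦋n⦌ →* H _⦋n⦌ := (f.app (op ⦋n⦌)).hom

lemma appHom_faceHom (i : Fin (n + 2)) (g : G _⦋n + 1⦌) :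
    appHom f n (faceHom G i g) = faceHom H i (appHom f (n + 1) g) :=
  ConcreteCategory.congr_hom (SimplicialObject.δ_naturality f i) g

lemma appHom_degHom (i : Fin (n + 1)) (g : G _⦋n⦌) :
    appHom f (n + 1) (degHom G i g) = degHom H i (appHom f n g) :=
  ConcreteCategory.congr_hom (SimplicialObject.σ_naturality f i) g

variable {f}

/-- Any lift of `y` has faces which differ from the prescribed ones by elements of the kernel. The
kernel is itself a simplicial group, so a filler there corrects the lift. -/
lemma exists_lift_horn (hf : ∀ n, Function.Surjective (appHom f n)) {k : Fin (n + 3)}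
    {x : Fin (n + 3) → G _⦋n + 1⦌} (hx : HornCompatible k x) (y : H _⦋n + 2⦌)
    (hy : ∀ j, j ≠ k → faceHom H j y = appHom f (n + 1) (x j)) :
    ∃ g : G _⦋n + 2⦌, appHom f (n + 2) g = y ∧ ∀ j, j ≠ k → faceHom G j g = x j := by
  classical
  obtain ⟨g₀, rfl⟩ := hf _ y
  have hmem : ∀ j, j ≠ k → (faceHom G j g₀)⁻¹ * x j ∈ (appHom f (n + 1)).ker := by
    intro j hj
    rw [MonoidHom.mem_ker, map_mul, map_inv, appHom_faceHom, ← hy j hj, inv_mul_cancel]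
  let x' : Fin (n + 3) → kernel f _⦋n + 1⦌ := fun j =>
    if h : j ≠ k then ⟨(faceHom G j g₀)⁻¹ * x j, hmem j h⟩ else 1
  have hx' : ∀ j (h : j ≠ k), x' j = ⟨(faceHom G j g₀)⁻¹ * x j, hmem j h⟩ := fun j h => dif_pos h
  have hc : HornCompatible k x' := by
    intro i j hij hi hj
    rw [hx' _ hi, hx' _ hj]
    refine Subtype.ext ?_
    change faceHom G i ((faceHom G j.succ g₀)⁻¹ * x j.succ) =
      faceHom G j ((faceHom G i.castSucc g₀)⁻¹ * x i.castSucc)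
    rw [map_mul, map_inv, map_mul, map_inv, faceHom_faceHom G hij, hx i j hij hi hj]
  obtain ⟨g, hg⟩ := exists_filler hc
  refine ⟨g₀ * g.1, ?_, fun j hj => ?_⟩
  · have h1 : appHom f (n + 2) g.1 = 1 := g.2
    rw [map_mul, h1, mul_one]
  · have h1 : faceHom G j g.1 = (faceHom G j g₀)⁻¹ * x j := by
      have := hg j hj
      rw [hx' j hj] at this
      exact congrArg Subtype.val this
    rw [map_mul, h1, mul_inv_cancel_left]

lemma exists_lift_vertex (hf : ∀ n, Function.Surjective (appHom f n)) {j : Fin 2}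
    (x : G _⦋0⦌) (y : H _⦋1⦌) (hy : faceHom H j y = appHom f 0 x) :
    ∃ g : G _⦋1⦌, appHom f 1 g = y ∧ faceHom G j g = x := by
  obtain ⟨g, rfl⟩ := hf _ y
  have hs : ∀ z : G _⦋0⦌, faceHom G j (degHom G 0 z) = z := by
    intro z
    fin_cases j
    · exact faceHom_degHom_self G (i := 0) z
    · exact faceHom_degHom_succ G (i := 0) z
  refine ⟨g * degHom G 0 ((faceHom G j g)⁻¹ * x), ?_, ?_⟩
  · rw [map_mul, appHom_degHom, map_mul, map_inv, appHom_faceHom, hy, inv_mul_cancel, map_one,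
      mul_one]
  · rw [map_mul, hs, mul_inv_cancel_left]

/-- A surjection of simplicial groups is surjective on Moore chains. -/
lemma exists_moore_lift (hf : ∀ n, Function.Surjective (appHom f n)) (y : H _⦋n + 1⦌)
    (hy : ∀ i : Fin (n + 1), faceHom H i.succ y = 1) :
    ∃ g : G _⦋n + 1⦌, appHom f (n + 1) g = y ∧ ∀ i : Fin (n + 1), faceHom G i.succ g = 1 := by
  cases n with
  | zero =>
    obtain ⟨g, hg, hg'⟩ := exists_lift_vertex hf (j := 1) 1 y ((hy 0).trans (map_one _).symm)
    refine ⟨g, hg, fun i => ?_⟩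
    fin_cases i
    exact hg'
  | succ n =>
    -- A Moore chain is a simplex whose horn opposite to `d₀` is trivial.
    obtain ⟨g, hg, hg'⟩ := exists_lift_horn hf (k := 0) (x := fun _ => 1)
      (fun i j _ _ _ => by rw [map_one, map_one]) y (fun j hj => by
        obtain ⟨i, rfl⟩ := Fin.exists_succ_eq.2 hj
        rw [hy, map_one])
    exact ⟨g, hg, fun i => hg' _ (Fin.succ_ne_zero i)⟩

end Fillers

/-! ### Surjections of simplicial groups are Kan fibrations -/

section KanFibrations

/-- The lifting property of a Kan fibration in terms of simplices. -/
lemma rlp_horn_of_simplices {X Y : SSet.{0}} (f : X ⟶ Y) {n : ℕ} (k : Fin (n + 2))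
    (h : ∀ (x : ∀ j : Fin (n + 2), j ≠ k → X _⦋n⦌) (y : Y _⦋n + 1⦌),
      SSet.horn.IsCompatible (fun j hj => SSet.yonedaEquiv.symm (x j hj)) →
      (∀ j hj, Y.δ j y = f.app _ (x j hj)) →
      ∃ z : X _⦋n + 1⦌, f.app _ z = y ∧ ∀ j hj, X.δ j z = x j hj) :
    HasLiftingProperty (SSet.horn (n + 1) k).ι f where
  sq_hasLift {t b} sq := by
    obtain ⟨z, hz, hz'⟩ := h (fun j hj => SSet.yonedaEquiv (SSet.horn.ι k j hj ≫ t))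
      (SSet.yonedaEquiv b) (by
        simp only [Equiv.symm_apply_apply]
        exact SSet.horn.IsCompatible.of_hom t) (fun j hj => by
        refine SSet.yonedaEquiv.symm.injective ?_
        rw [← SSet.stdSimplex.δ_comp_yonedaEquiv_symm, Equiv.symm_apply_apply,
          ← SSet.yonedaEquiv_symm_comp, Equiv.symm_apply_apply, Category.assoc, sq.w, SSet.horn.ι_ι_assoc])
    refine ⟨⟨⟨SSet.yonedaEquiv.symm z, ?_, ?_⟩⟩⟩
    · refine SSet.horn.hom_ext' fun j hj => ?_
      rw [SSet.horn.ι_ι_assoc, SSet.stdSimplex.δ_comp_yonedaEquiv_symm, hz' j hj,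
        Equiv.symm_apply_apply]
    · rw [SSet.yonedaEquiv_symm_comp, hz, Equiv.symm_apply_apply]

/-- A surjection of simplicial groups is a Kan fibration. -/
theorem isKanFibration_of_surjective {G H : SimplicialObject GrpCat.{0}} (f : G ⟶ H)
    (hf : ∀ n, Function.Surjective (appHom f n)) : IsKanFibration f := by
  intro A B i hi
  simp only [SSet.modelCategoryQuillen.J, MorphismProperty.iSup_iff] at hi
  obtain ⟨n, ⟨k⟩⟩ := hi
  refine rlp_horn_of_simplices _ k fun x y hc hy => ?_
  cases n with
  | zero =>
    -- A horn in dimension one is a single vertex, which a degeneracy extends.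
    obtain ⟨j, hj⟩ := exists_ne k
    obtain ⟨g, hg, hg'⟩ := exists_lift_vertex hf (j := j) (x j hj) y (hy j hj)
    refine ⟨g, hg, fun j' hj' => ?_⟩
    obtain rfl : j' = j := by omega
    exact hg'
  | succ n =>
    classical
    let x' : Fin (n + 3) → G _⦋n + 1⦌ := fun j => if h : j ≠ k then x j h else 1
    have hx' : ∀ j (h : j ≠ k), x' j = x j h := fun j h => dif_pos h
    have hcomp : HornCompatible k x' := by
      intro i j hij hi hj
      rw [hx' _ hi, hx' _ hj]
      have := hc i.castSucc j.succ hi hj (Fin.castSucc_lt_succ_iff.2 hij)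
      rw [SSet.stdSimplex.δ_comp_yonedaEquiv_symm, SSet.stdSimplex.δ_comp_yonedaEquiv_symm,
        Fin.pred_succ, Fin.castPred_castSucc] at this
      exact (SSet.yonedaEquiv.symm.injective this).symm
    obtain ⟨g, hg, hg'⟩ := exists_lift_horn hf hcomp y
      (fun j hj => (hy j hj).trans (congrArg _ (hx' j hj).symm))
    exact ⟨g, hg, fun j hj => (hg' j hj).trans (hx' j hj)⟩

end KanFibrations

end FreeToK
end

noncomputable section

namespace FreeToK

/-! ### The Magnus representation of a free group -/

section Magnus

variable {α : Type} [DecidableEq α] {R : Type} [CommRing R]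

/-- Left multiplication by the letter `a` on noncommutative power series, considered as functions
on words. -/
def letterOp (R : Type) [CommRing R] (a : α) : Module.End R (List α → R) where
  toFun f u := match u with
    | [] => 0
    | b :: t => if b = a then f t else 0
  map_add' f g := by
    funext u
    rcases u with _ | ⟨b, t⟩
    · simp
    · by_cases h : b = a <;> simp [h]
  map_smul' c f := by
    funext u
    rcases u with _ | ⟨b, t⟩
    · simp
    · by_cases h : b = a <;> simp [h]

@[simp]
lemma letterOp_nil (a : α) (f : List α → R) : letterOp R a f [] = 0 := rfl

lemma letterOp_cons (a b : α) (t : List α) (f : List α → R) :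
    letterOp R a f (b :: t) = if b = a then f t else 0 := rfl

/-- Left multiplication by `(1 + a)⁻¹` on noncommutative power series. -/
def letterInvFun (a : α) (f : List α → R) (u : List α) : R :=
  match u with
  | [] => f []
  | b :: t => f (b :: t) - if b = a then letterInvFun a f t else 0

/-- Left multiplication by `(1 + a)⁻¹`, as a linear map. -/
def letterInv (R : Type) [CommRing R] (a : α) : Module.End R (List α → R) where
  toFun := letterInvFun a
  map_add' f g := by
    funext u
    induction u with
    | nil => rfl
    | cons b t ih =>
      simp only [letterInvFun, Pi.add_apply] at ih ⊢
      rw [ih]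
      split_ifs <;> ring
  map_smul' c f := by
    funext u
    induction u with
    | nil => rfl
    | cons b t ih =>
      simp only [letterInvFun, Pi.smul_apply, smul_eq_mul, RingHom.id_apply] at ih ⊢
      rw [ih]
      split_ifs <;> ring

/-- Left multiplication by `1 + a`, as an invertible linear map. -/
def letterUnit (R : Type) [CommRing R] (a : α) : (Module.End R (List α → R))ˣ where
  val := 1 + letterOp R a
  inv := letterInv R a
  val_inv := by
    refine LinearMap.ext fun f => funext fun u => ?_
    rcases u with _ | ⟨b, t⟩
    · change letterInvFun a f [] + 0 = f []
      simp [letterInvFun]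
    · change letterInvFun a f (b :: t) + (if b = a then letterInvFun a f t else 0) = f (b :: t)
      simp [letterInvFun]
  inv_val := by
    refine LinearMap.ext fun f => funext fun u => ?_
    induction u with
    | nil =>
      change f [] + 0 = f []
      simp
    | cons b t ih =>
      change letterInvFun a (f + letterOp R a f) t = f t at ih
      change (f (b :: t) + if b = a then f t else 0) -
        (if b = a then letterInvFun a (f + letterOp R a f) t else 0) = f (b :: t)
      rw [ih]
      ring

/-- The Magnus representation: `x_a` acts by multiplication by `1 + a`. -/
def magnusRep (R : Type) [CommRing R] : FreeGroup α →* (Module.End R (List α → R))ˣ :=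
  FreeGroup.lift (letterUnit R)

/-- The action of a free group on noncommutative power series. -/
def magnusAct (w : FreeGroup α) : Module.End R (List α → R) := (magnusRep R w).1

lemma magnusAct_one (f : List α → R) : magnusAct (1 : FreeGroup α) f = f := by
  simp [magnusAct]

lemma magnusAct_mul (v w : FreeGroup α) (f : List α → R) :
    magnusAct (v * w) f = magnusAct v (magnusAct w f) := by
  simp [magnusAct]

lemma magnusAct_of (a : α) (f : List α → R) :
    magnusAct (FreeGroup.of a) f = f + letterOp R a f := by
  simp only [magnusAct, magnusRep, FreeGroup.lift_apply_of]
  rfl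

lemma magnusAct_inv_self (w : FreeGroup α) (f : List α → R) :
    magnusAct w⁻¹ (magnusAct w f) = f := by
  rw [← magnusAct_mul, inv_mul_cancel, magnusAct_one]

lemma magnusAct_self_inv (w : FreeGroup α) (f : List α → R) :
    magnusAct w (magnusAct w⁻¹ f) = f := by
  rw [← magnusAct_mul, mul_inv_cancel, magnusAct_one]

/-- The power series `1`. -/
def unitSeries (α R : Type) [CommRing R] (u : List α) : R :=
  match u with
  | [] => 1
  | _ :: _ => 0

/-- The coefficients of the Magnus expansion. -/
def magnus (R : Type) [CommRing R] (w : FreeGroup α) : List α → R :=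
  magnusAct w (unitSeries α R)

lemma magnus_mul (v w : FreeGroup α) : magnus R (v * w) = magnusAct v (magnus R w) :=
  magnusAct_mul v w _

end Magnus

/-! ### Locality and words without repeated letters -/

section Locality

/-- A set of words closed under removing the first letter. -/
def TailClosed {α : Type} (S : List α → Prop) : Prop := ∀ a t, S (a :: t) → S t

lemma tailClosed_nodup {α : Type} : TailClosed (List.Nodup (α := α)) :=
  fun _ _ h => (List.nodup_cons.1 h).2

lemma tailClosed_notMem {α : Type} (a : α) : TailClosed (fun u => a ∉ u) :=
  fun _ _ h h' => h (List.mem_cons_of_mem _ h')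

variable {α : Type} [DecidableEq α] {R : Type} [CommRing R]

lemma letterOp_eq_zero {S : List α → Prop} (hS : TailClosed S) (a : α) {f : List α → R}
    (hf : ∀ u, S u → f u = 0) (u : List α) (hu : S u) : letterOp R a f u = 0 := by
  rcases u with _ | ⟨b, t⟩
  · rfl
  · rw [letterOp_cons, hf t (hS b t hu), ite_self]

/-- The Magnus action preserves vanishing on a set of words closed under tails. -/
lemma magnusAct_eq_zero {S : List α → Prop} (hS : TailClosed S) (w : FreeGroup α) :
    ∀ f : List α → R, (∀ u, S u → f u = 0) → ∀ u, S u → magnusAct w f u = 0 := by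
  induction w using FreeGroup.induction_on with
  | C1 =>
    intro f hf u hu
    rw [magnusAct_one, hf u hu]
  | of a =>
    intro f hf u hu
    rw [magnusAct_of, Pi.add_apply, hf u hu, letterOp_eq_zero hS a hf u hu, add_zero]
  | inv_of a _ =>
    intro f hf u
    have h : ∀ u, magnusAct (FreeGroup.of a)⁻¹ f u +
        letterOp R a (magnusAct (FreeGroup.of a)⁻¹ f) u = f u := by
      intro u
      have := congrFun (magnusAct_self_inv (FreeGroup.of a) f) u
      rwa [magnusAct_of] at this
    induction u with
    | nil =>
      intro hu
      have := h []
      rwa [letterOp_nil, add_zero, hf [] hu] at this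
    | cons b t ih =>
      intro hu
      have := h (b :: t)
      rwa [letterOp_cons, ih (hS b t hu), ite_self, add_zero, hf _ hu] at this
  | mul v w hv hw =>
    intro f hf u hu
    rw [magnusAct_mul]
    exact hv _ (hw f hf) u hu

lemma magnusAct_congr {S : List α → Prop} (hS : TailClosed S) (w : FreeGroup α)
    {f g : List α → R} (hfg : ∀ u, S u → f u = g u) (u : List α) (hu : S u) :
    magnusAct w f u = magnusAct w g u := by
  have := magnusAct_eq_zero hS w (f - g) (fun u hu => by simp [hfg u hu]) u hu
  rwa [map_sub, Pi.sub_apply, sub_eq_zero] at this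

/-- The elements which act trivially on the restriction of power series to a set of words closed
under tails. -/
def fixSubgroup (R : Type) [CommRing R] {S : List α → Prop} (_ : TailClosed S) :
    Subgroup (FreeGroup α) where
  carrier := {w | ∀ (f : List α → R) (u : List α), S u → magnusAct w f u = f u}
  one_mem' f u _ := by rw [magnusAct_one]
  mul_mem' {v w} hv hw f u hu := by rw [magnusAct_mul, hv _ u hu, hw f u hu]
  inv_mem' {w} hw f u hu := by
    rw [← hw (magnusAct w⁻¹ f) u hu, magnusAct_self_inv]

instance {S : List α → Prop} (hS : TailClosed S) : (fixSubgroup R hS).Normal where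
  conj_mem w hw g f u hu := by
    rw [magnusAct_mul, magnusAct_mul, magnusAct_congr hS g (g := magnusAct g⁻¹ f)
      (fun u hu => hw _ u hu) u hu, magnusAct_self_inv]

lemma fixSubgroup_mono {S T : List α → Prop} (hS : TailClosed S) (hT : TailClosed T)
    (h : ∀ u, S u → T u) : fixSubgroup R hT ≤ fixSubgroup R hS :=
  fun _ hw f u hu => hw f u (h u hu)

/-- The generator acts as `1 + a`, and multiples of `a` are supported on words beginning with `a`.
-/
lemma of_mem_fixSubgroup (a : α) : FreeGroup.of a ∈ fixSubgroup R (tailClosed_notMem a) := by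
  intro f u hu
  rw [magnusAct_of, Pi.add_apply, add_eq_left]
  rcases u with _ | ⟨b, t⟩
  · rfl
  · rw [letterOp_cons, if_neg]
    rintro rfl
    exact hu (List.mem_cons_self)

/-- Every word in the support of `a w a f` contains the letter `a` twice. -/
lemma letterOp_magnusAct_letterOp (a : α) (w : FreeGroup α) (f : List α → R) (u : List α)
    (hu : u.Nodup) : letterOp R a (magnusAct w (letterOp R a f)) u = 0 := by
  rcases u with _ | ⟨b, t⟩
  · rfl
  · rw [letterOp_cons]
    split_ifs with h
    · subst h
      refine magnusAct_eq_zero (tailClosed_notMem b) w _ (fun u hu => ?_) t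
        (List.nodup_cons.1 hu).1
      rcases u with _ | ⟨c, s⟩
      · rfl
      · rw [letterOp_cons, if_neg]
        rintro rfl
        exact hu (List.mem_cons_self)
    · rfl

/-- The two elements act as `1 + a` and `1 + g a g⁻¹`. On repetition-free words the products of `a`
with `g a g⁻¹` vanish in either order, so the actions commute there. -/
lemma commutator_mem_fixSubgroup (a : α) (g : FreeGroup α) :
    FreeGroup.of a * (g * FreeGroup.of a * g⁻¹) * (FreeGroup.of a)⁻¹ *
      (g * FreeGroup.of a * g⁻¹)⁻¹ ∈ fixSubgroup R (tailClosed_nodup (α := α)) := by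
  intro f u hu
  have key : ∀ (f : List α → R) (u : List α), u.Nodup →
      magnusAct (FreeGroup.of a * (g * FreeGroup.of a * g⁻¹)) f u =
        magnusAct (g * FreeGroup.of a * g⁻¹ * FreeGroup.of a) f u := by
    intro f u hu
    have hconj : ∀ f : List α → R, magnusAct (g * FreeGroup.of a * g⁻¹) f =
        f + magnusAct g (letterOp R a (magnusAct g⁻¹ f)) := by
      intro f
      rw [magnusAct_mul, magnusAct_mul, magnusAct_of, map_add, magnusAct_self_inv]
    rw [magnusAct_mul (FreeGroup.of a), magnusAct_mul _ (FreeGroup.of a), hconj, hconj,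
      magnusAct_of, magnusAct_of]
    simp only [map_add, Pi.add_apply]
    rw [letterOp_magnusAct_letterOp a g _ u hu,
      magnusAct_eq_zero tailClosed_nodup g _
        (fun u hu => letterOp_magnusAct_letterOp a g⁻¹ f u hu) u hu]
    ring
  -- Applying the commutation to the series moved back by both inverses turns it into triviality of
  -- the commutator.
  have h := key (magnusAct ((FreeGroup.of a)⁻¹ * (g * FreeGroup.of a * g⁻¹)⁻¹) f) u hu
  rw [← magnusAct_mul, ← magnusAct_mul] at h
  rw [mul_assoc (FreeGroup.of a * (g * FreeGroup.of a * g⁻¹)), h,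
    show g * FreeGroup.of a * g⁻¹ * FreeGroup.of a *
      ((FreeGroup.of a)⁻¹ * (g * FreeGroup.of a * g⁻¹)⁻¹) = 1 by group, magnusAct_one]

/-- Hence Magnus coefficients at repetition-free words are well defined on `K_n`. -/
lemma reducedFreeRel_le_fixSubgroup (n : ℕ) :
    reducedFreeRel n ≤ fixSubgroup R (tailClosed_nodup (α := Fin n)) := by
  refine Subgroup.normalClosure_le_normal ?_
  rintro _ ⟨a, g, rfl⟩
  exact commutator_mem_fixSubgroup a g

end Locality

/-! ### Functoriality of the Magnus expansion -/

section Push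

/-- The generator of a free group given by an optional letter. -/
def optGen {β : Type} (b : Option β) : FreeGroup β :=
  match b with
  | none => 1
  | some b => FreeGroup.of b

/-- The homomorphism of free groups given by a partial map of letters. -/
def letterHom {α β : Type} (p : α → Option β) : FreeGroup α →* FreeGroup β :=
  FreeGroup.lift fun a => optGen (p a)

lemma letterHom_of {α β : Type} (p : α → Option β) (a : α) :
    letterHom p (FreeGroup.of a) = optGen (p a) :=
  FreeGroup.lift_apply_of

variable {α β : Type} [DecidableEq α] [DecidableEq β] [Fintype α] {R : Type} [CommRing R]

/-- The words which a partial map of letters takes to the given word. -/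
def wordLifts (p : α → Option β) (v : List β) : Finset (List α) :=
  match v with
  | [] => {[]}
  | b :: v => ((Finset.univ.filter fun a => p a = some b) ×ˢ wordLifts p v).image
      fun x => x.1 :: x.2

lemma mem_wordLifts (p : α → Option β) (v : List β) : ∀ u : List α,
    u ∈ wordLifts p v ↔ u.map p = v.map some := by
  induction v with
  | nil => simp [wordLifts]
  | cons b v ih =>
    intro u
    simp only [wordLifts, Finset.mem_image, Finset.mem_product, Finset.mem_filter,
      Finset.mem_univ, true_and, Prod.exists, ih, List.map_cons]
    constructor
    · rintro ⟨a, t, ⟨h1, h2⟩, rfl⟩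
      simp [h1, h2]
    · intro h
      rcases u with _ | ⟨a, t⟩
      · simp at h
      · simp only [List.map_cons, List.cons.injEq] at h
        exact ⟨a, t, h, rfl⟩

/-- The push-forward of power series along a partial map of letters. -/
def pushSeries (p : α → Option β) (f : List α → R) (v : List β) : R :=
  ∑ u ∈ wordLifts p v, f u

lemma pushSeries_nil (p : α → Option β) (f : List α → R) : pushSeries p f [] = f [] := by
  simp [pushSeries, wordLifts]

lemma pushSeries_cons (p : α → Option β) (f : List α → R) (b : β) (v : List β) :
    pushSeries p f (b :: v) =
      ∑ a ∈ Finset.univ.filter (fun a => p a = some b), pushSeries p (fun t => f (a :: t)) v := by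
  rw [pushSeries, wordLifts, Finset.sum_image, Finset.sum_product]
  · rfl
  · rintro ⟨a, t⟩ _ ⟨a', t'⟩ _ h
    simpa using h

lemma pushSeries_add (p : α → Option β) (f g : List α → R) :
    pushSeries p (f + g) = pushSeries p f + pushSeries p g := by
  funext v
  exact Finset.sum_add_distrib

lemma pushSeries_letterOp_some {p : α → Option β} {a : α} {b : β} (h : p a = some b)
    (f : List α → R) : pushSeries p (letterOp R a f) = letterOp R b (pushSeries p f) := by
  funext v
  rcases v with _ | ⟨c, v⟩
  · rw [pushSeries_nil, letterOp_nil, letterOp_nil]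
  · rw [pushSeries_cons, letterOp_cons]
    split_ifs with hc
    · subst hc
      rw [Finset.sum_eq_single a]
      · simp [letterOp_cons]
      · intro a' _ ha'
        simp [letterOp_cons, ha', pushSeries]
      · simp [h]
    · refine Finset.sum_eq_zero fun a' ha' => ?_
      have : a' ≠ a := by
        rintro rfl
        rw [Finset.mem_filter, h] at ha'
        exact hc (Option.some.inj ha'.2).symm
      simp [letterOp_cons, this, pushSeries]

lemma pushSeries_letterOp_none {p : α → Option β} {a : α} (h : p a = none)
    (f : List α → R) : pushSeries p (letterOp R a f) = 0 := by
  funext v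
  rcases v with _ | ⟨c, v⟩
  · rw [pushSeries_nil, letterOp_nil, Pi.zero_apply]
  · rw [pushSeries_cons]
    refine Finset.sum_eq_zero fun a' ha' => ?_
    have : a' ≠ a := by
      rintro rfl
      simp [h] at ha'
    simp [letterOp_cons, this, pushSeries]

/-- Substituting letters in a power series is multiplicative. A deleted letter becomes `0`, in
accordance with its generator becoming `1`. -/
lemma pushSeries_magnusAct (p : α → Option β) (w : FreeGroup α) : ∀ f : List α → R,
    pushSeries p (magnusAct w f) = magnusAct (letterHom p w) (pushSeries p f) := by
  have hof : ∀ (a : α) (f : List α → R), pushSeries p (magnusAct (FreeGroup.of a) f) =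
      magnusAct (letterHom p (FreeGroup.of a)) (pushSeries p f) := by
    intro a f
    rw [magnusAct_of, letterHom_of, pushSeries_add]
    cases h : p a with
    | none => rw [pushSeries_letterOp_none h, add_zero, optGen, magnusAct_one]
    | some b => rw [pushSeries_letterOp_some h, optGen, magnusAct_of]
  induction w using FreeGroup.induction_on with
  | C1 =>
    intro f
    rw [map_one, magnusAct_one, magnusAct_one]
  | of a => exact hof a
  | inv_of a _ =>
    intro f
    have := hof a (magnusAct (FreeGroup.of a)⁻¹ f)
    rw [magnusAct_self_inv] at this
    rw [this, map_inv, magnusAct_inv_self]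
  | mul v w hv hw =>
    intro f
    rw [magnusAct_mul, map_mul, magnusAct_mul, hv, hw]

lemma pushSeries_unitSeries (p : α → Option β) :
    pushSeries p (unitSeries α R) = unitSeries β R := by
  funext v
  rcases v with _ | ⟨c, v⟩
  · exact pushSeries_nil p _
  · rw [pushSeries_cons]
    exact Finset.sum_eq_zero fun a _ => Finset.sum_const_zero

lemma magnus_letterHom (p : α → Option β) (w : FreeGroup α) (v : List β) :
    magnus R (letterHom p w) v = ∑ u ∈ wordLifts p v, magnus R w u := by
  have := congrFun (pushSeries_magnusAct p w (unitSeries α R)) v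
  rw [pushSeries_unitSeries] at this
  exact this.symm

end Push

end FreeToK
end

noncomputable section

namespace FreeToK

open scoped commutatorElement

/-! ### Iterated commutators in reduced groups -/

section CommWord

variable {α G : Type} [Group G] (x : α → G)

/-- The iterated commutator `[x_{u₁}, [x_{u₂}, …, [x_{u_k}, x_z]]]`. -/
def commWord (z : α) (u : List α) : G :=
  match u with
  | [] => x z
  | a :: u => ⁅x a, commWord z u⁆

lemma commWord_mem_of_normal {z : α} {u : List α} {N : Subgroup G} [hN : N.Normal] {a : α}
    (ha : a ∈ u ++ [z]) (hx : x a ∈ N) : commWord x z u ∈ N := by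
  induction u with
  | nil =>
    obtain rfl : a = z := by simpa using ha
    exact hx
  | cons b u ih =>
    rw [commWord]
    rcases List.mem_cons.1 ha with rfl | h
    · rw [commutatorElement_def, mul_assoc, mul_assoc]
      refine N.mul_mem hx ?_
      rw [← mul_assoc]
      exact hN.conj_mem _ (N.inv_mem hx) _
    · rw [commutatorElement_def]
      exact N.mul_mem (hN.conj_mem _ (ih h) _) (N.inv_mem (ih h))

lemma map_commWord {H : Type} [Group H] (f : G →* H) (z : α) (u : List α) :
    f (commWord x z u) = commWord (fun a => f (x a)) z u := by
  induction u with
  | nil => rfl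
  | cons a u ih => rw [commWord, map_commutatorElement, ih, commWord]

/-- Every generator commutes with its conjugates. -/
def IsReducedFamily : Prop := ∀ (a : α) (g : G), Commute (x a) (g * x a * g⁻¹)

variable {x}

/-- The defining relations say that the conjugates of `x a` commute with each other, so its normal
closure is abelian. -/
lemma IsReducedFamily.commute (hx : IsReducedFamily x) (a : α) {p q : G}
    (hp : p ∈ Subgroup.normalClosure {x a}) (hq : q ∈ Subgroup.normalClosure {x a}) :
    Commute p q := by
  have hgen : ∀ g h : G, Commute (g * x a * g⁻¹) (h * x a * h⁻¹) := by
    intro g h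
    have h1 := (Commute.conj_iff g).2 (hx a (g⁻¹ * h))
    simpa [mul_assoc] using h1
  rw [Subgroup.normalClosure] at hp hq
  induction hp using Subgroup.closure_induction with
  | one => exact Commute.one_left _
  | mul s t _ _ hs ht => exact hs.mul_left ht
  | inv s _ hs => exact hs.inv_left
  | mem s hs =>
    obtain ⟨s', rfl, hs'⟩ := Group.mem_conjugatesOfSet_iff.1 hs
    obtain ⟨g, rfl⟩ := isConj_iff.1 hs'
    induction hq using Subgroup.closure_induction with
    | one => exact Commute.one_right _
    | mul s t _ _ hs ht => exact hs.mul_right ht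
    | inv s _ hs => exact hs.inv_right
    | mem t ht =>
      obtain ⟨t', rfl, ht'⟩ := Group.mem_conjugatesOfSet_iff.1 ht
      obtain ⟨h, rfl⟩ := isConj_iff.1 ht'
      exact hgen g h

lemma self_mem_normalClosure (a : α) : x a ∈ Subgroup.normalClosure {x a} :=
  Subgroup.subset_normalClosure rfl

/-- At the first repetition, counted from the inside, both entries of the commutator lie in the
abelian normal closure of the repeated generator. -/
lemma IsReducedFamily.commWord_eq_one (hx : IsReducedFamily x) {z : α} {u : List α}
    (hu : ¬ (u ++ [z]).Nodup) : commWord x z u = 1 := by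
  induction u with
  | nil => simp at hu
  | cons a u ih =>
    rw [commWord, commutatorElement_eq_one_iff_commute]
    by_cases h : (u ++ [z]).Nodup
    · have ha : a ∈ u ++ [z] := by
        by_contra ha
        exact hu (List.nodup_cons.2 ⟨ha, h⟩)
      exact hx.commute a (self_mem_normalClosure a)
        (commWord_mem_of_normal x ha (self_mem_normalClosure a))
    · rw [ih h]
      exact Commute.one_right _

lemma commWord_mem_normalClosure (z : α) (u : List α) :
    commWord x z u ∈ Subgroup.normalClosure {x z} :=
  commWord_mem_of_normal x (by simp) (self_mem_normalClosure z)

/-- The commutator of `x a` with `c` commutes with `x a`, since bracketing by `a` twice gives `1`,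
and with `c`, since both lie in the normal closure of `x z`. -/
lemma IsReducedFamily.conj_commWord (hx : IsReducedFamily x) (a z : α) (u : List α) :
    (x a)⁻¹ * commWord x z u * x a = commWord x z u * (commWord x z (a :: u))⁻¹ := by
  have h1 : commWord x z (a :: a :: u) = 1 := by
    refine hx.commWord_eq_one ?_
    simp
  have h2 : Commute (x a) (commWord x z (a :: u)) := by
    rwa [commWord, commutatorElement_eq_one_iff_commute] at h1
  have h3 : Commute (commWord x z u) (commWord x z (a :: u)) :=
    hx.commute z (commWord_mem_normalClosure z u) (commWord_mem_normalClosure z _)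
  rw [mul_assoc, inv_mul_eq_iff_eq_mul, ← mul_assoc, eq_mul_inv_iff_mul_eq, mul_assoc, h2.eq,
    ← mul_assoc, h3.eq, commWord, commutatorElement_def]
  group

/-- The normal closure of a generator is generated by iterated commutators. -/
lemma IsReducedFamily.normalClosure_eq (hx : IsReducedFamily x)
    (hgen : Subgroup.closure (Set.range x) = ⊤) (z : α) :
    Subgroup.normalClosure {x z} =
      Subgroup.closure {c | ∃ u : List α, (u ++ [z]).Nodup ∧ commWord x z u = c} := by
  set S := Subgroup.closure {c | ∃ u : List α, (u ++ [z]).Nodup ∧ commWord x z u = c} with hS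
  have hmem : ∀ u, commWord x z u ∈ S := by
    intro u
    by_cases hu : (u ++ [z]).Nodup
    · exact Subgroup.subset_closure ⟨u, hu, rfl⟩
    · rw [hx.commWord_eq_one hu]
      exact S.one_mem
  have hconj : ∀ g : G, (∀ u, g * commWord x z u * g⁻¹ ∈ S) → ∀ s ∈ S, g * s * g⁻¹ ∈ S := by
    intro g hg s hs
    have : S ≤ S.comap (MulAut.conj g).toMonoidHom := by
      rw [hS, Subgroup.closure_le]
      rintro _ ⟨u, _, rfl⟩
      exact hg u
    exact this hs
  -- Conjugation by `g` and by its inverse are treated together so that the induction passes through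
  -- inverses.
  have hnormal : ∀ g : G, ∀ s ∈ S, g * s * g⁻¹ ∈ S ∧ g⁻¹ * s * g ∈ S := by
    intro g
    have hg : g ∈ Subgroup.closure (Set.range x) := by rw [hgen]; trivial
    induction hg using Subgroup.closure_induction with
    | one => intro s hs; simpa using hs
    | mul g h _ _ hg hh =>
      intro s hs
      constructor
      · have := (hg _ (hh s hs).1).1
        simpa [mul_assoc] using this
      · have := (hh _ (hg s hs).2).2
        simpa [mul_assoc] using this
    | inv g _ hg =>
      intro s hs
      rw [inv_inv]
      exact (hg s hs).symm
    | mem g hg =>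
      obtain ⟨a, rfl⟩ := hg
      intro s hs
      constructor
      · refine hconj _ (fun u => ?_) s hs
        have : x a * commWord x z u * (x a)⁻¹ = commWord x z (a :: u) * commWord x z u := by
          rw [commWord, commutatorElement_def]
          group
        rw [this]
        exact S.mul_mem (hmem _) (hmem _)
      · have := hconj (x a)⁻¹ (fun u => ?_) s hs
        · rwa [inv_inv] at this
        · rw [inv_inv, hx.conj_commWord]
          exact S.mul_mem (hmem _) (S.inv_mem (hmem _))
  have : S.Normal := ⟨fun s hs g => (hnormal g s hs).1⟩
  refine le_antisymm (Subgroup.normalClosure_le_normal ?_) ?_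
  · rintro _ rfl
    exact hmem []
  · rw [hS, Subgroup.closure_le]
    rintro _ ⟨u, _, rfl⟩
    exact commWord_mem_normalClosure z u

end CommWord

/-! ### The coefficients of words which end in a given letter -/

section LastCoeff

lemma tailClosed_append {α : Type} (z : α) : TailClosed (fun u : List α => (u ++ [z]).Nodup) :=
  fun _ _ h => (List.nodup_cons.1 h).2

variable {α : Type} [DecidableEq α] {R : Type} [CommRing R] (z : α)

/-- The coefficients of the Magnus expansion at words ending in `z`. -/
def lastCoeff (R : Type) [CommRing R] (w : FreeGroup α) (u : List α) : R := magnus R w (u ++ [z])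

lemma magnusAct_nil (w : FreeGroup α) (f : List α → R) : magnusAct w f [] = f [] := by
  have h : TailClosed (fun u : List α => u = []) := fun _ _ h => by simp at h
  have h1 : FreeGroup.lift (fun a : α => FreeGroup.of a) w ∈ fixSubgroup R h := by
    induction w using FreeGroup.induction_on with
    | C1 => simp
    | of a =>
      rw [FreeGroup.lift_apply_of]
      rintro f u rfl
      rw [magnusAct_of, Pi.add_apply, letterOp_nil, add_zero]
    | inv_of a h => rw [map_inv]; exact Subgroup.inv_mem _ h
    | mul v w hv hw => rw [map_mul]; exact Subgroup.mul_mem _ hv hw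
  rw [FreeGroup.lift_of_eq_id] at h1
  exact h1 f [] rfl

lemma magnus_nil (w : FreeGroup α) : magnus R w [] = 1 := magnusAct_nil w _

lemma magnus_one : magnus R (1 : FreeGroup α) = unitSeries α R := magnusAct_one _

lemma lastCoeff_one : lastCoeff z R (1 : FreeGroup α) = 0 := by
  funext u
  rw [lastCoeff, magnus_one]
  rcases u with _ | ⟨a, u⟩ <;> rfl

lemma lastCoeff_of_mul (a : α) (w : FreeGroup α) :
    lastCoeff z R (FreeGroup.of a * w) =
      lastCoeff z R (FreeGroup.of a) + magnusAct (FreeGroup.of a) (lastCoeff z R w) := by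
  funext u
  rw [magnusAct_of, lastCoeff, magnus_mul, magnusAct_of, Pi.add_apply, Pi.add_apply, Pi.add_apply,
    lastCoeff, magnus.eq_def R (FreeGroup.of a), magnusAct_of]
  rcases u with _ | ⟨b, u⟩
  · simp only [List.nil_append, Pi.add_apply, letterOp_cons, letterOp_nil, magnus_nil, lastCoeff,
      unitSeries]
    ring
  · have h : unitSeries α R (u ++ [z]) = 0 := by
      rcases u with _ | ⟨c, u⟩ <;> rfl
    have h' : unitSeries α R (b :: (u ++ [z])) = 0 := rfl
    simp only [List.cons_append, Pi.add_apply, letterOp_cons, lastCoeff, h, h', ite_self, zero_add]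

/-- The coefficients at words ending in `z` form the Fox derivative with respect to `z`, and this is
its product rule. -/
lemma lastCoeff_mul (v w : FreeGroup α) :
    lastCoeff z R (v * w) = lastCoeff z R v + magnusAct v (lastCoeff z R w) := by
  induction v using FreeGroup.induction_on generalizing w with
  | C1 => rw [one_mul, lastCoeff_one, zero_add, magnusAct_one]
  | of a => exact lastCoeff_of_mul z a w
  | inv_of a _ =>
    have key : ∀ w, lastCoeff z R ((FreeGroup.of a)⁻¹ * w) =
        magnusAct (FreeGroup.of a)⁻¹ (lastCoeff z R w - lastCoeff z R (FreeGroup.of a)) := by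
      intro w
      have := lastCoeff_of_mul (R := R) z a ((FreeGroup.of a)⁻¹ * w)
      rw [mul_inv_cancel_left] at this
      rw [this, add_sub_cancel_left, magnusAct_inv_self]
    have h1 := key 1
    rw [mul_one, lastCoeff_one, zero_sub] at h1
    rw [key, h1, sub_eq_neg_add, map_add]
  | mul v v' hv hv' =>
    rw [mul_assoc, hv, hv', hv, magnusAct_mul, map_add, add_assoc]

lemma lastCoeff_self : lastCoeff z R (FreeGroup.of z) = unitSeries α R := by
  funext u
  rw [lastCoeff, magnus, magnusAct_of, Pi.add_apply]
  rcases u with _ | ⟨b, u⟩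
  · simp [unitSeries, letterOp_cons]
  · rw [List.cons_append, letterOp_cons]
    rcases u with _ | ⟨c, u⟩ <;> simp [unitSeries]

variable {z}

lemma lastCoeff_of {a : α} (h : a ≠ z) : lastCoeff z R (FreeGroup.of a) = 0 := by
  funext u
  rw [lastCoeff, magnus, magnusAct_of, Pi.add_apply]
  rcases u with _ | ⟨b, u⟩
  · simp [unitSeries, letterOp_cons, h.symm]
  · rw [List.cons_append, letterOp_cons]
    rcases u with _ | ⟨c, u⟩ <;> simp [unitSeries]

lemma lastCoeff_inv_of {a : α} (h : a ≠ z) : lastCoeff z R (FreeGroup.of a)⁻¹ = 0 := by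
  have := lastCoeff_mul (R := R) z (FreeGroup.of a)⁻¹ (FreeGroup.of a)
  rw [inv_mul_cancel, lastCoeff_one, lastCoeff_of h, map_zero, add_zero] at this
  exact this.symm

lemma lastCoeff_conj {a : α} (h : a ≠ z) (w : FreeGroup α) :
    lastCoeff z R (FreeGroup.of a * w * (FreeGroup.of a)⁻¹) =
      lastCoeff z R w + letterOp R a (lastCoeff z R w) := by
  rw [mul_assoc, lastCoeff_mul, lastCoeff_of h, zero_add, lastCoeff_mul, lastCoeff_inv_of h,
    map_zero, add_zero, magnusAct_of]

variable (z)

/-- The elements which act trivially on words without repetitions and without the letter `z`. -/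
abbrev fixLast (R : Type) [CommRing R] : Subgroup (FreeGroup α) :=
  fixSubgroup R (tailClosed_append z)

lemma of_mem_fixLast : FreeGroup.of z ∈ fixLast z R :=
  fixSubgroup_mono (tailClosed_append z) (tailClosed_notMem z) (fun u hu hz =>
    (List.nodup_append.1 hu).2.2 z hz z (by simp) rfl) (of_mem_fixSubgroup z)

lemma normalClosure_le_fixLast : Subgroup.normalClosure {FreeGroup.of z} ≤ fixLast z R :=
  Subgroup.normalClosure_le_normal (by
    rintro _ rfl
    exact of_mem_fixLast z)

variable {z}

/-- The factor `v` acts trivially on repetition-free words without `z`, so the crossed homomorphism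
becomes additive. -/
lemma lastCoeff_mul_of_mem {v : FreeGroup α} (hv : v ∈ fixLast z R) (w : FreeGroup α)
    {u : List α} (hu : (u ++ [z]).Nodup) :
    lastCoeff z R (v * w) u = lastCoeff z R v u + lastCoeff z R w u := by
  rw [lastCoeff_mul, Pi.add_apply, hv _ u hu]

lemma lastCoeff_inv_of_mem {v : FreeGroup α} (hv : v ∈ fixLast z R)
    {u : List α} (hu : (u ++ [z]).Nodup) :
    lastCoeff z R v⁻¹ u = - lastCoeff z R v u := by
  have := lastCoeff_mul_of_mem hv v⁻¹ hu
  rw [mul_inv_cancel, lastCoeff_one, Pi.zero_apply] at this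
  exact (neg_eq_of_add_eq_zero_right this.symm).symm

/-- Conjugation by `x_a` multiplies the Fox derivative by `1 + a`, and the inverse of `v` subtracts
it again. -/
lemma lastCoeff_commutator {a : α} (h : a ≠ z) {v : FreeGroup α} (hv : v ∈ fixLast z R)
    {u : List α} (hu : (u ++ [z]).Nodup) :
    lastCoeff z R ⁅FreeGroup.of a, v⁆ u = letterOp R a (lastCoeff z R v) u := by
  rw [commutatorElement_def, lastCoeff_mul_of_mem
    (Subgroup.Normal.conj_mem inferInstance v hv (FreeGroup.of a)) _ hu, lastCoeff_conj h,
    lastCoeff_inv_of_mem hv hu, Pi.add_apply]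
  ring

lemma commWord_mem_fixLast (u : List α) : commWord FreeGroup.of z u ∈ fixLast z R :=
  normalClosure_le_fixLast z (commWord_mem_normalClosure z u)

/-- Each bracket with a generator multiplies by its letter, so the derivative of the commutator is
the word `u` itself. This duality makes the commutators independent. -/
lemma lastCoeff_commWord {u : List α} (hu : (u ++ [z]).Nodup) {v : List α}
    (hv : (v ++ [z]).Nodup) :
    lastCoeff z R (commWord FreeGroup.of z u) v = if v = u then 1 else 0 := by
  induction u generalizing v with
  | nil =>
    rw [commWord, lastCoeff_self]
    rcases v with _ | ⟨b, v⟩ <;> simp [unitSeries]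
  | cons a u ih =>
    have ha : a ≠ z := by
      rintro rfl
      simp at hu
    rw [commWord, lastCoeff_commutator ha (commWord_mem_fixLast u) hv]
    rcases v with _ | ⟨b, v⟩
    · simp
    · rw [letterOp_cons, ih (tailClosed_append z a u hu) (tailClosed_append z b v hv)]
      by_cases hb : b = a <;> simp [hb]

end LastCoeff

end FreeToK
end

noncomputable section

namespace FreeToK

open scoped commutatorElement

/-! ### Coefficients on the reduced free group -/

section ReducedCoeff

/-- A homomorphism from a commutative group to a product of copies of `ℤ` is injective if it
takes a family of generators to the coordinate vectors. -/
lemma injective_of_dual_generators {N I : Type} [Group N] [DecidableEq I]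
    (hcomm : ∀ a b : N, a * b = b * a) (c : I → N) (hc : Subgroup.closure (Set.range c) = ⊤)
    (Φ : N →* Multiplicative (I → ℤ)) (h : ∀ u, (Φ (c u)).toAdd = Pi.single u 1) :
    Function.Injective Φ := by
  let _ : CommGroup N := { ‹Group N› with mul_comm := hcomm }
  let Ψ : (I →₀ ℤ) →+ Additive N :=
    Finsupp.liftAddHom fun u => zmultiplesHom (Additive N) (Additive.ofMul (c u))
  have hΨ : ∀ k : N, ∃ m, (Ψ m).toMul = k := by
    intro k
    have hk : k ∈ Subgroup.closure (Set.range c) := by rw [hc]; trivial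
    induction hk using Subgroup.closure_induction with
    | one => exact ⟨0, by rw [map_zero]; rfl⟩
    | mul a b _ _ ha hb =>
      obtain ⟨p, rfl⟩ := ha
      obtain ⟨q, rfl⟩ := hb
      exact ⟨p + q, by rw [map_add]; rfl⟩
    | inv a _ ha =>
      obtain ⟨p, rfl⟩ := ha
      exact ⟨-p, by rw [map_neg]; rfl⟩
    | mem k hk =>
      obtain ⟨u, rfl⟩ := hk
      exact ⟨Finsupp.single u 1, by simp [Ψ]⟩
  let Φ' : Additive N →+ (I → ℤ) := MonoidHom.toAdditiveLeft Φ
  have hΦ : Φ'.comp Ψ = Finsupp.coeFnAddHom := by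
    refine Finsupp.addHom_ext fun u m => ?_
    have h1 : Ψ (Finsupp.single u m) = m • Additive.ofMul (c u) := by simp [Ψ]
    have h2 : Φ' (Additive.ofMul (c u)) = Pi.single u 1 := h u
    rw [AddMonoidHom.comp_apply, h1, map_zsmul, h2]
    funext v
    by_cases hv : v = u
    · subst hv; simp
    · simp [hv]
  refine (injective_iff_map_eq_one Φ).2 fun k hk => ?_
  obtain ⟨m, rfl⟩ := hΨ k
  have h0 : Φ' (Ψ m) = 0 := hk
  have hm : (m : I → ℤ) = 0 := (DFunLike.congr_fun hΦ m).symm.trans h0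
  have hm' : m = 0 := DFunLike.coe_injective hm
  rw [hm', map_zero]
  rfl

variable {n : ℕ}

/-- The generators of the reduced free group. -/
def reducedGen (a : Fin n) : ReducedFreeGroup n := (FreeGroup.of a : FreeGroup (Fin n))

lemma isReducedFamily_reducedGen : IsReducedFamily (reducedGen (n := n)) := by
  intro a g
  induction g using QuotientGroup.induction_on with
  | H g =>
    have h : ((FreeGroup.of a * (g * FreeGroup.of a * g⁻¹) * (FreeGroup.of a)⁻¹ *
        (g * FreeGroup.of a * g⁻¹)⁻¹ : FreeGroup (Fin n)) : ReducedFreeGroup n) = 1 :=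
      (QuotientGroup.eq_one_iff _).2 (Subgroup.subset_normalClosure ⟨a, g, rfl⟩)
    exact commutatorElement_eq_one_iff_commute.1 h

lemma closure_reducedGen : Subgroup.closure (Set.range (reducedGen (n := n))) = ⊤ := by
  have h : Set.range (reducedGen (n := n)) =
      (QuotientGroup.mk' (reducedFreeRel n)) '' Set.range FreeGroup.of := by
    rw [← Set.range_comp]
    rfl
  rw [h, ← MonoidHom.map_closure, FreeGroup.closure_range_of]
  exact Subgroup.map_top_of_surjective _ (QuotientGroup.mk'_surjective _)

lemma magnus_eq_of_mk_eq {v w : FreeGroup (Fin n)}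
    (h : (v : ReducedFreeGroup n) = (w : ReducedFreeGroup n)) {u : List (Fin n)} (hu : u.Nodup) :
    magnus ℤ v u = magnus ℤ w u := by
  have hm : v⁻¹ * w ∈ fixSubgroup ℤ (tailClosed_nodup (α := Fin n)) :=
    reducedFreeRel_le_fixSubgroup n (QuotientGroup.eq.1 h)
  have : magnus ℤ w = magnusAct v (magnus ℤ (v⁻¹ * w)) := by
    rw [← magnus_mul, mul_inv_cancel_left]
  rw [this]
  exact magnusAct_congr tailClosed_nodup v (fun t ht => (hm _ t ht).symm) u hu

variable (z : Fin n)

/-- The normal closure of a generator of the reduced free group. -/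
abbrev reducedNormal : Subgroup (ReducedFreeGroup n) := Subgroup.normalClosure {reducedGen z}

/-- Membership holds for some representative, and two representatives differ by a relation, which
acts trivially on all repetition-free words. -/
lemma mem_fixLast_of_mk_mem {w : FreeGroup (Fin n)}
    (hw : (w : ReducedFreeGroup n) ∈ reducedNormal z) : w ∈ fixLast z ℤ := by
  have hnorm : ((fixLast z ℤ).map (QuotientGroup.mk' (reducedFreeRel n))).Normal :=
    Subgroup.Normal.map inferInstance _ (QuotientGroup.mk'_surjective _)
  have hle : reducedNormal z ≤ (fixLast z ℤ).map (QuotientGroup.mk' (reducedFreeRel n)) := by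
    refine Subgroup.normalClosure_le_normal ?_
    rintro _ rfl
    exact ⟨_, of_mem_fixLast z, rfl⟩
  obtain ⟨v, hv, hvw⟩ := hle hw
  have h1 : v⁻¹ * w ∈ fixLast z ℤ :=
    fixSubgroup_mono (tailClosed_append z) tailClosed_nodup (fun u hu => (List.nodup_append.1 hu).1)
      (reducedFreeRel_le_fixSubgroup n (QuotientGroup.eq.1 hvw))
  have := mul_mem hv h1
  rwa [mul_inv_cancel_left] at this

/-- The coefficients of an element of the reduced free group at words without repetitions which
end in `z`. -/
def reducedCoeff (k : ReducedFreeGroup n) (u : List (Fin n)) : ℤ :=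
  lastCoeff z ℤ (Quotient.out k) u

lemma reducedCoeff_mk (w : FreeGroup (Fin n)) {u : List (Fin n)} (hu : (u ++ [z]).Nodup) :
    reducedCoeff z (w : ReducedFreeGroup n) u = magnus ℤ w (u ++ [z]) :=
  magnus_eq_of_mk_eq (QuotientGroup.out_eq' _) hu

lemma reducedCoeff_mul {k l : ReducedFreeGroup n} (hk : k ∈ reducedNormal z) {u : List (Fin n)}
    (hu : (u ++ [z]).Nodup) :
    reducedCoeff z (k * l) u = reducedCoeff z k u + reducedCoeff z l u := by
  induction k using QuotientGroup.induction_on with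
  | H v =>
    induction l using QuotientGroup.induction_on with
    | H w =>
      rw [← QuotientGroup.mk_mul, reducedCoeff_mk z _ hu, reducedCoeff_mk z _ hu,
        reducedCoeff_mk z _ hu]
      exact lastCoeff_mul_of_mem (mem_fixLast_of_mk_mem z hk) w hu

lemma mk_commWord (u : List (Fin n)) :
    ((commWord FreeGroup.of z u : FreeGroup (Fin n)) : ReducedFreeGroup n) =
      commWord reducedGen z u :=
  map_commWord FreeGroup.of (QuotientGroup.mk' (reducedFreeRel n)) z u

lemma reducedCoeff_commWord {u v : List (Fin n)} (hu : (u ++ [z]).Nodup) (hv : (v ++ [z]).Nodup) :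
    reducedCoeff z (commWord reducedGen z u) v = if v = u then 1 else 0 := by
  rw [← mk_commWord, reducedCoeff_mk z _ hv]
  exact lastCoeff_commWord hu hv

/-- An element of the normal closure of a generator is determined by its coefficients. -/
lemma eq_one_of_reducedCoeff {k : ReducedFreeGroup n} (hk : k ∈ reducedNormal z)
    (h : ∀ u, (u ++ [z]).Nodup → reducedCoeff z k u = 0) : k = 1 := by
  let I := {u : List (Fin n) // (u ++ [z]).Nodup}
  let c : I → reducedNormal z := fun u =>
    ⟨commWord reducedGen z u.1, commWord_mem_normalClosure z u.1⟩
  let Φ : reducedNormal z →* Multiplicative (I → ℤ) :=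
    MonoidHom.mk' (fun k => Multiplicative.ofAdd fun u => reducedCoeff z k.1 u.1) (by
      intro a b
      refine congrArg Multiplicative.ofAdd (funext fun u => ?_)
      exact reducedCoeff_mul z a.2 u.2)
  have hc : Subgroup.closure (Set.range c) = ⊤ := by
    refine Subgroup.map_injective (Subgroup.subtype_injective (reducedNormal z)) ?_
    rw [MonoidHom.map_closure, ← MonoidHom.range_eq_map, Subgroup.range_subtype]
    refine Eq.trans ?_ (isReducedFamily_reducedGen.normalClosure_eq closure_reducedGen z).symm
    congr 1
    ext k
    constructor
    · rintro ⟨_, ⟨u, rfl⟩, rfl⟩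
      exact ⟨u.1, u.2, rfl⟩
    · rintro ⟨u, hu, rfl⟩
      exact ⟨_, ⟨⟨u, hu⟩, rfl⟩, rfl⟩
  have hinj := injective_of_dual_generators (fun a b => Subtype.ext
    (isReducedFamily_reducedGen.commute z a.2 b.2).eq) c hc Φ (fun u => funext fun v => by
      refine (reducedCoeff_commWord z u.2 v.2).trans ?_
      rw [Pi.single_apply]
      exact if_congr Subtype.ext_iff.symm rfl rfl)
  have h1 : (⟨k, hk⟩ : reducedNormal z) = 1 := by
    refine hinj ?_
    rw [map_one]
    exact congrArg Multiplicative.ofAdd (funext fun u => h u.1 u.2)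
  exact congrArg Subtype.val h1

end ReducedCoeff

end FreeToK
end

noncomputable section

namespace FreeToK

/-! ### Words with the same image under a partial map of letters -/

section Fibers

variable {α β : Type} {p : α → Option β}

/-- A letter which is determined by its image. -/
def IsolatedLetter (p : α → Option β) (a : α) : Prop := ∀ b, p b = p a → b = a

lemma map_eq_map_iff_of_isolated {A : List α} (hA : ∀ a ∈ A, IsolatedLetter p a) (u : List α) :
    u.map p = A.map p ↔ u = A := by
  refine ⟨fun h => ?_, fun h => by rw [h]⟩
  induction A generalizing u with
  | nil => simpa using h
  | cons a A ih =>
    rcases u with _ | ⟨b, u⟩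
    · simp at h
    · simp only [List.map_cons, List.cons.injEq] at h
      rw [hA a List.mem_cons_self b h.1,
        ih (fun c hc => hA c (List.mem_cons_of_mem _ hc)) u h.2]

lemma map_eq_map_append_cons_iff {A B : List α} (hA : ∀ a ∈ A, IsolatedLetter p a) (c : α)
    (u : List α) : u.map p = (A ++ c :: B).map p ↔
      ∃ c' B', p c' = p c ∧ B'.map p = B.map p ∧ u = A ++ c' :: B' := by
  constructor
  · intro h
    rw [List.map_append, List.map_eq_append_iff] at h
    obtain ⟨A', B', rfl, hA', hB'⟩ := h
    rw [map_eq_map_iff_of_isolated hA] at hA'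
    subst hA'
    rw [List.map_cons, List.map_eq_cons_iff] at hB'
    obtain ⟨c', B', rfl, hc, hB⟩ := hB'
    exact ⟨c', B', hc, hB, rfl⟩
  · rintro ⟨c', B', hc, hB, rfl⟩
    simp [hc, hB]

variable [DecidableEq α] [DecidableEq β] [Fintype α]

/-- The sum over the fibre is a coefficient of the image of `w`, which is `1` and has no
coefficients at nonempty words. -/
lemma sum_magnus_eq_zero {w : FreeGroup α} (hw : letterHom p w = 1) {u : List α} (hu : u ≠ [])
    (hp : ∀ a ∈ u, p a ≠ none) (T : Finset (List α)) (hT : ∀ v, v ∈ T ↔ v.map p = u.map p) :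
    ∑ v ∈ T, magnus ℤ w v = 0 := by
  obtain ⟨v, hv⟩ : ∃ v : List β, v.map some = u.map p := by
    clear hT hu
    induction u with
    | nil => exact ⟨[], rfl⟩
    | cons a u ih =>
      obtain ⟨b, hb⟩ := Option.ne_none_iff_exists.1 (hp a List.mem_cons_self)
      obtain ⟨v, hv⟩ := ih fun a ha => hp a (List.mem_cons_of_mem _ ha)
      exact ⟨b :: v, by simp [hb, hv]⟩
  have hT' : T = wordLifts p v := by
    ext u'
    rw [hT, mem_wordLifts, hv]
  rw [hT', ← magnus_letterHom, hw, magnus_one]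
  rcases v with _ | ⟨b, v⟩
  · simp only [List.map_nil] at hv
    exact absurd (List.map_eq_nil_iff.1 hv.symm) hu
  · rfl

lemma magnus_eq_zero_of_isolated {w : FreeGroup α} (hw : letterHom p w = 1) {u : List α}
    (hu : u ≠ []) (hp : ∀ a ∈ u, p a ≠ none) (hi : ∀ a ∈ u, IsolatedLetter p a) :
    magnus ℤ w u = 0 := by
  have := sum_magnus_eq_zero hw hu hp {u} fun v => by
    rw [Finset.mem_singleton, map_eq_map_iff_of_isolated hi]
  simpa using this

lemma magnus_add_eq_zero_of_pair {w : FreeGroup α} (hw : letterHom p w = 1) {A B : List α}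
    (hp : ∀ a, p a ≠ none) {c d : α} (hcd : c ≠ d) (h : ∀ a, p a = p c ↔ a = c ∨ a = d)
    (hA : ∀ a ∈ A, IsolatedLetter p a) (hB : ∀ a ∈ B, IsolatedLetter p a) :
    magnus ℤ w (A ++ c :: B) + magnus ℤ w (A ++ d :: B) = 0 := by
  have := sum_magnus_eq_zero hw (u := A ++ c :: B) (by simp) (fun a _ => hp a)
    {A ++ c :: B, A ++ d :: B} fun v => by
      rw [map_eq_map_append_cons_iff hA, Finset.mem_insert, Finset.mem_singleton]
      constructor
      · rintro (rfl | rfl)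
        · exact ⟨c, B, rfl, rfl, rfl⟩
        · exact ⟨d, B, (h d).2 (Or.inr rfl), rfl, rfl⟩
      · rintro ⟨c', B', hc, hB', rfl⟩
        rw [map_eq_map_iff_of_isolated hB] at hB'
        subst hB'
        rcases (h c').1 hc with rfl | rfl <;> simp
  rwa [Finset.sum_pair] at this
  simpa using hcd

/-- The fibre consists of four words, one for each choice of `c` or `d` at the two places. -/
lemma magnus_add_eq_zero_of_two_pairs {w : FreeGroup α} (hw : letterHom p w = 1)
    {A B C : List α} (hp : ∀ a, p a ≠ none) {c d : α} (hcd : c ≠ d)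
    (h : ∀ a, p a = p c ↔ a = c ∨ a = d) (hA : ∀ a ∈ A, IsolatedLetter p a)
    (hB : ∀ a ∈ B, IsolatedLetter p a) (hC : ∀ a ∈ C, IsolatedLetter p a) :
    magnus ℤ w (A ++ c :: (B ++ d :: C)) + magnus ℤ w (A ++ d :: (B ++ c :: C)) +
      (magnus ℤ w (A ++ c :: (B ++ c :: C)) + magnus ℤ w (A ++ d :: (B ++ d :: C))) = 0 := by
  have hd : ∀ a, p a = p d ↔ a = c ∨ a = d := by
    intro a
    rw [(h d).2 (Or.inr rfl), h]
  have := sum_magnus_eq_zero hw (u := A ++ c :: (B ++ d :: C)) (by simp) (fun a _ => hp a)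
    {A ++ c :: (B ++ d :: C), A ++ d :: (B ++ c :: C), A ++ c :: (B ++ c :: C),
      A ++ d :: (B ++ d :: C)} fun v => by
      rw [map_eq_map_append_cons_iff hA]
      simp only [Finset.mem_insert, Finset.mem_singleton]
      constructor
      · rintro (rfl | rfl | rfl | rfl)
        · exact ⟨c, _, rfl, rfl, rfl⟩
        · exact ⟨d, _, (h d).2 (Or.inr rfl), by simp [(h d).2 (Or.inr rfl)], rfl⟩
        · exact ⟨c, _, rfl, by simp [(h d).2 (Or.inr rfl)], rfl⟩
        · exact ⟨d, _, (h d).2 (Or.inr rfl), rfl, rfl⟩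
      · rintro ⟨c', B', hc, hB', rfl⟩
        rw [map_eq_map_append_cons_iff hB] at hB'
        obtain ⟨d', C', hd', hC', rfl⟩ := hB'
        rw [map_eq_map_iff_of_isolated hC] at hC'
        subst hC'
        rcases (h c').1 hc with rfl | rfl <;> rcases (hd d').1 hd' with rfl | rfl <;> simp
  rw [Finset.sum_insert, Finset.sum_insert, Finset.sum_insert, Finset.sum_singleton] at this
  · linear_combination this
  · simpa using hcd
  · simpa using ⟨hcd.symm, hcd⟩
  · simpa [hcd] using hcd.symm

end Fibers

/-! ### The faces of `F[S¹]` in terms of free groups -/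

section Faces

variable {n : ℕ}

/-- The effect of the face `d_k` on letters. -/
def faceLetter (k : Fin (n + 2)) (j : Fin (n + 1)) : Option (Fin n) :=
  if j.1 < k.1 then (if h : j.1 < n then some ⟨j.1, h⟩ else none)
  else if h : 0 < j.1 then some ⟨j.1 - 1, by omega⟩ else none

/-- With letters numbered from `0`, the face `d_k` merges the letters `k - 1` and `k` when both
exist. -/
lemma faceLetter_eq_faceLetter {k : Fin (n + 2)} {a b : Fin (n + 1)} :
    faceLetter k a = faceLetter k b ↔ a.1 = b.1 ∨ (a.1 + 1 = k.1 ∧ b.1 = k.1) ∨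
      (b.1 + 1 = k.1 ∧ a.1 = k.1) := by
  simp only [faceLetter]
  have ha := a.2
  have hb := b.2
  have hk := k.2
  split_ifs
  all_goals try simp only [Option.some.injEq, Fin.mk.injEq, true_iff, false_iff]
  all_goals omega

lemma faceLetter_eq_none {k : Fin (n + 2)} {a : Fin (n + 1)} :
    faceLetter k a = none ↔ (a.1 = n ∧ k.1 = n + 1) ∨ (a.1 = 0 ∧ k.1 = 0) := by
  simp only [faceLetter]
  have ha := a.2
  have hk := k.2
  split_ifs
  all_goals try simp only [true_iff, false_iff]
  all_goals omega

/-- The face `d_k` as a homomorphism of free groups. -/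
abbrev freeFace (k : Fin (n + 2)) : FreeGroup (Fin (n + 1)) →* FreeGroup (Fin n) :=
  letterHom (faceLetter k)

lemma isolatedLetter_faceLetter {k : Fin (n + 2)} {a : Fin (n + 1)} (h : a.1 + 1 ≠ k)
    (h' : a.1 ≠ k) : IsolatedLetter (faceLetter k) a := by
  intro b hb
  rw [faceLetter_eq_faceLetter] at hb
  rcases hb with hb | hb | hb
  · exact Fin.ext hb
  · exact absurd hb.2 h'
  · exact absurd hb.1 h

lemma faceLetter_pair (i : Fin n) {c d : Fin (n + 1)}
    (h : (c = i.castSucc ∧ d = i.succ) ∨ (c = i.succ ∧ d = i.castSucc)) (a : Fin (n + 1)) :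
    faceLetter i.succ.castSucc a = faceLetter i.succ.castSucc c ↔ a = c ∨ a = d := by
  rw [faceLetter_eq_faceLetter]
  rw [Fin.ext_iff, Fin.ext_iff, Fin.val_castSucc, Fin.val_succ]
  have h' : (c.1 = i.1 ∧ d.1 = i.1 + 1) ∨ (c.1 = i.1 + 1 ∧ d.1 = i.1) := by
    rcases h with ⟨rfl, rfl⟩ | ⟨rfl, rfl⟩
    · exact Or.inl ⟨rfl, rfl⟩
    · exact Or.inr ⟨rfl, rfl⟩
  omega

lemma isolatedLetter_of_ne (i : Fin n) {a : Fin (n + 1)} (h : a ≠ i.castSucc) (h' : a ≠ i.succ) :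
    IsolatedLetter (faceLetter i.succ.castSucc) a := by
  refine isolatedLetter_faceLetter ?_ ?_
  · intro ha
    refine h (Fin.ext ?_)
    simpa using ha
  · intro ha
    exact h' (Fin.ext ha)

lemma faceLetter_ne_none (i : Fin n) (a : Fin (n + 1)) :
    faceLetter i.succ.castSucc a ≠ none := by
  rw [Ne, faceLetter_eq_none]
  have := i.2
  simp only [Fin.val_succ, Fin.val_castSucc]
  omega

/-- For a word without `d` and with at most one `c`, the fibre under merging `c` and `d` has one or
two words. In the second case `c` may be exchanged for `d` at the cost of a sign. -/
lemma magnus_pair (i : Fin n) {c d : Fin (n + 1)}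
    (h : (c = i.castSucc ∧ d = i.succ) ∨ (c = i.succ ∧ d = i.castSucc))
    {w : FreeGroup (Fin (n + 1))} (hw : freeFace i.succ.castSucc w = 1)
    {u : List (Fin (n + 1))} (hu : u ≠ []) (hd : d ∉ u) (hc : u.count c ≤ 1) :
    magnus ℤ w u = 0 ∨ ∃ A B, c ∉ A ∧ c ∉ B ∧ d ∉ A ∧ d ∉ B ∧ u = A ++ c :: B ∧
      magnus ℤ w u + magnus ℤ w (A ++ d :: B) = 0 := by
  have hiso : ∀ v : List (Fin (n + 1)), c ∉ v → d ∉ v → ∀ a ∈ v,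
      IsolatedLetter (faceLetter i.succ.castSucc) a := by
    intro v hcv hdv a ha
    have h1 : a ≠ c := fun h => hcv (h ▸ ha)
    have h2 : a ≠ d := fun h => hdv (h ▸ ha)
    rcases h with ⟨rfl, rfl⟩ | ⟨rfl, rfl⟩
    · exact isolatedLetter_of_ne i h1 h2
    · exact isolatedLetter_of_ne i h2 h1
  by_cases hcu : c ∈ u
  · obtain ⟨A, B, rfl⟩ := List.append_of_mem hcu
    right
    have hA : c ∉ A := by
      intro hA
      have := List.count_pos_iff.2 hA
      simp only [List.count_append, List.count_cons_self] at hc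
      omega
    have hB : c ∉ B := by
      intro hB
      have := List.count_pos_iff.2 hB
      simp only [List.count_append, List.count_cons_self] at hc
      omega
    have hdA : d ∉ A := fun h => hd (by simp [h])
    have hdB : d ∉ B := fun h => hd (by simp [h])
    refine ⟨A, B, hA, hB, hdA, hdB, rfl, ?_⟩
    refine magnus_add_eq_zero_of_pair hw (faceLetter_ne_none i) ?_ (faceLetter_pair i h)
      (hiso A hA hdA) (hiso B hB hdB)
    rcases h with ⟨rfl, rfl⟩ | ⟨rfl, rfl⟩
    · exact (Fin.castSucc_lt_succ).ne
    · exact (Fin.castSucc_lt_succ).ne'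
  · left
    exact magnus_eq_zero_of_isolated hw hu (fun a _ => faceLetter_ne_none i a) (hiso u hcu hd)

/-- The coefficients of a Moore chain at words which miss a letter `m`, in which the letters above
`m` are not repeated. -/
lemma magnus_eq_zero_of_notMem {w : FreeGroup (Fin (n + 1))}
    (hw : ∀ i : Fin (n + 1), freeFace i.succ w = 1) (m : Fin (n + 1)) :
    ∀ u : List (Fin (n + 1)), u ≠ [] → m ∉ u → (∀ a, m < a → u.count a ≤ 1) →
      magnus ℤ w u = 0 := by
  induction m using Fin.reverseInduction with
  | last =>
    intro u hu hm _
    have hne : ∀ a ∈ u, a.1 ≠ n := fun a ha h =>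
      hm (by rwa [show a = Fin.last n from Fin.ext h] at ha)
    refine magnus_eq_zero_of_isolated (hw (Fin.last n)) hu (fun a ha => ?_) fun a ha => ?_
    · rw [Ne, faceLetter_eq_none]
      have := hne a ha
      simp [this]
    · refine isolatedLetter_faceLetter ?_ ?_
      · have := hne a ha
        simpa using this
      · simp only [Fin.val_succ, Fin.val_last]
        omega
  | cast i ih =>
    intro u hu hm hc
    have hf : freeFace i.succ.castSucc w = 1 := by
      rw [← Fin.succ_castSucc]
      exact hw i.castSucc
    rcases magnus_pair i (c := i.succ) (d := i.castSucc) (Or.inr ⟨rfl, rfl⟩) hf hu hm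
      (hc _ Fin.castSucc_lt_succ) with h | ⟨A, B, hA, hB, hdA, hdB, rfl, h⟩
    · exact h
    -- After the exchange the word misses the next higher letter instead. This repeats until the
    -- last letter is missing, where the outer face applies.
    · rw [ih (A ++ i.castSucc :: B) (by simp) ?_ ?_, add_zero] at h
      · exact h
      · simp only [List.mem_append, List.mem_cons, not_or]
        exact ⟨hA, (Fin.castSucc_lt_succ).ne', hB⟩
      · intro a ha
        have h1 := hc a (Fin.castSucc_lt_succ.trans ha)
        simp only [List.count_append, List.count_cons] at h1 ⊢
        have h2 : (i.castSucc == a) = false := by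
          simpa using (Fin.castSucc_lt_succ.trans ha).ne
        simp only [h2]
        simp only [Bool.false_eq_true, if_false]
        omega

/-- The coefficients of a cycle at words which miss a letter `m`, in which the letters below
`m` are not repeated. -/
lemma magnus_eq_zero_of_notMem' {w : FreeGroup (Fin (n + 1))}
    (hw : ∀ i : Fin (n + 1), freeFace i.castSucc w = 1) (m : Fin (n + 1)) :
    ∀ u : List (Fin (n + 1)), u ≠ [] → m ∉ u → (∀ a, a < m → u.count a ≤ 1) →
      magnus ℤ w u = 0 := by
  induction m using Fin.induction with
  | zero =>
    intro u hu hm _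
    have hne : ∀ a ∈ u, a.1 ≠ 0 := fun a ha h =>
      hm (by rwa [show a = 0 from Fin.ext h] at ha)
    refine magnus_eq_zero_of_isolated (hw 0) hu (fun a ha => ?_) fun a ha => ?_
    · rw [Ne, faceLetter_eq_none]
      have := hne a ha
      simp [this]
    · refine isolatedLetter_faceLetter ?_ ?_
      · simp
      · have := hne a ha
        simpa using this
  | succ i ih =>
    intro u hu hm hc
    rcases magnus_pair i (c := i.castSucc) (d := i.succ) (Or.inl ⟨rfl, rfl⟩) (hw i.succ) hu hm
      (hc _ Fin.castSucc_lt_succ) with h | ⟨A, B, hA, hB, hdA, hdB, rfl, h⟩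
    · exact h
    · rw [ih (A ++ i.succ :: B) (by simp) ?_ ?_, add_zero] at h
      · exact h
      · simp only [List.mem_append, List.mem_cons, not_or]
        exact ⟨hA, (Fin.castSucc_lt_succ).ne, hB⟩
      · intro a ha
        have h1 := hc a (ha.trans Fin.castSucc_lt_succ)
        simp only [List.count_append, List.count_cons] at h1 ⊢
        have h2 : (i.succ == a) = false := by
          simpa using (ha.trans Fin.castSucc_lt_succ).ne'
        simp only [h2]
        simp only [Bool.false_eq_true, if_false]
        omega

variable {w : FreeGroup (Fin (n + 1))}

/-- Of the four words in the fibre, the two with a doubled letter have coefficient zero, because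
they miss the other letter of the pair. -/
lemma magnus_add_swap (hw : ∀ i : Fin (n + 2), freeFace i w = 1)
    (i : Fin n) {c d : Fin (n + 1)}
    (h : (c = i.castSucc ∧ d = i.succ) ∨ (c = i.succ ∧ d = i.castSucc))
    {A B C : List (Fin (n + 1))} (hnd : (A ++ c :: (B ++ d :: C)).Nodup) :
    magnus ℤ w (A ++ c :: (B ++ d :: C)) + magnus ℤ w (A ++ d :: (B ++ c :: C)) = 0 := by
  have hcd : c ≠ d := by
    rcases h with ⟨rfl, rfl⟩ | ⟨rfl, rfl⟩
    · exact (Fin.castSucc_lt_succ).ne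
    · exact (Fin.castSucc_lt_succ).ne'
  have hcount : ∀ a, (A ++ c :: (B ++ d :: C)).count a ≤ 1 := List.nodup_iff_count_le_one.1 hnd
  have hcc := hcount c
  have hdd := hcount d
  simp only [List.count_append, List.count_cons, beq_self_eq_true, if_true,
    beq_eq_false_iff_ne.2 hcd, beq_eq_false_iff_ne.2 hcd.symm, Bool.false_eq_true, if_false,
    add_zero] at hcc hdd
  have hnot : ∀ {x : Fin (n + 1)} {v : List (Fin (n + 1))}, v.count x = 0 → x ∉ v :=
    fun h => List.count_eq_zero.1 h
  have hcA : c ∉ A := hnot (by omega)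
  have hcB : c ∉ B := hnot (by omega)
  have hcC : c ∉ C := hnot (by omega)
  have hdA : d ∉ A := hnot (by omega)
  have hdB : d ∉ B := hnot (by omega)
  have hdC : d ∉ C := hnot (by omega)
  have hiso : ∀ v : List (Fin (n + 1)), c ∉ v → d ∉ v → ∀ a ∈ v,
      IsolatedLetter (faceLetter i.succ.castSucc) a := by
    intro v hcv hdv a ha
    have h1 : a ≠ c := fun h => hcv (h ▸ ha)
    have h2 : a ≠ d := fun h => hdv (h ▸ ha)
    rcases h with ⟨rfl, rfl⟩ | ⟨rfl, rfl⟩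
    · exact isolatedLetter_of_ne i h1 h2
    · exact isolatedLetter_of_ne i h2 h1
  have key := magnus_add_eq_zero_of_two_pairs (hw i.succ.castSucc) (faceLetter_ne_none i) hcd
    (faceLetter_pair i h) (hiso A hcA hdA) (hiso B hcB hdB) (hiso C hcC hdC)
  have hz : ∀ x y : Fin (n + 1), ((x = c ∧ y = d) ∨ (x = d ∧ y = c)) →
      magnus ℤ w (A ++ x :: (B ++ x :: C)) = 0 := by
    intro x y hxy
    have hxy' : (x = i.castSucc ∧ y = i.succ) ∨ (x = i.succ ∧ y = i.castSucc) := by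
      rcases hxy with ⟨rfl, rfl⟩ | ⟨rfl, rfl⟩ <;> tauto
    have hyx : y ≠ x := by
      rcases hxy with ⟨rfl, rfl⟩ | ⟨rfl, rfl⟩
      · exact hcd.symm
      · exact hcd
    have hy : y ∉ A ++ x :: (B ++ x :: C) := by
      simp only [List.mem_append, List.mem_cons, not_or]
      rcases hxy with ⟨rfl, rfl⟩ | ⟨rfl, rfl⟩
      · exact ⟨hdA, hyx, hdB, hyx, hdC⟩
      · exact ⟨hcA, hyx, hcB, hyx, hcC⟩
    have hle : ∀ a, a ≠ x → (A ++ x :: (B ++ x :: C)).count a ≤ 1 := by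
      intro a ha
      have := hcount a
      simp only [List.count_append, List.count_cons] at this ⊢
      rw [if_neg (by simpa using ha.symm)]
      omega
    -- The doubled letter lies below the missing one in the first case and above it in the second;
    -- each vanishing lemma allows repetitions on just one side.
    rcases hxy' with ⟨rfl, rfl⟩ | ⟨rfl, rfl⟩
    · exact magnus_eq_zero_of_notMem (fun i => hw i.succ) _ _ (by simp) hy fun a ha =>
        hle a (Fin.castSucc_lt_succ.trans ha).ne'
    · exact magnus_eq_zero_of_notMem' (fun i => hw i.castSucc) _ _ (by simp) hy fun a ha =>
        hle a (ha.trans Fin.castSucc_lt_succ).ne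
  rw [hz c d (Or.inl ⟨rfl, rfl⟩), hz d c (Or.inr ⟨rfl, rfl⟩), add_zero, add_zero] at key
  exact key

lemma magnus_map_swap (hw : ∀ i : Fin (n + 2), freeFace i w = 1)
    (i : Fin n) {u : List (Fin (n + 1))} (hnd : u.Nodup)
    (h1 : i.castSucc ∈ u) (h2 : i.succ ∈ u) :
    magnus ℤ w (u.map (Equiv.swap i.castSucc i.succ)) = - magnus ℤ w u := by
  have hne : i.castSucc ≠ i.succ := (Fin.castSucc_lt_succ).ne
  have hmap : ∀ v : List (Fin (n + 1)), i.castSucc ∉ v → i.succ ∉ v →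
      v.map (Equiv.swap i.castSucc i.succ) = v := by
    intro v h h'
    refine (List.map_congr_left fun a ha => ?_).trans (List.map_id v)
    exact Equiv.swap_apply_of_ne_of_ne (fun e => h (e ▸ ha)) (fun e => h' (e ▸ ha))
  have main : ∀ (c d : Fin (n + 1)) (A B C : List (Fin (n + 1))),
      ((c = i.castSucc ∧ d = i.succ) ∨ (c = i.succ ∧ d = i.castSucc)) →
      u = A ++ c :: (B ++ d :: C) →
      magnus ℤ w (u.map (Equiv.swap i.castSucc i.succ)) = - magnus ℤ w u := by
    rintro c d A B C h rfl
    have hcount := List.nodup_iff_count_le_one.1 hnd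
    have hsum := magnus_add_swap hw i h hnd
    have hcd : c ≠ d := by
      rcases h with ⟨rfl, rfl⟩ | ⟨rfl, rfl⟩
      · exact hne
      · exact hne.symm
    have hcc := hcount c
    have hdd := hcount d
    simp only [List.count_append, List.count_cons, beq_self_eq_true, if_true,
      beq_eq_false_iff_ne.2 hcd, beq_eq_false_iff_ne.2 hcd.symm, Bool.false_eq_true, if_false,
      add_zero] at hcc hdd
    have hnot : ∀ {v : List (Fin (n + 1))}, v.count c = 0 → v.count d = 0 →
        v.map (Equiv.swap i.castSucc i.succ) = v := by
      intro v hc hd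
      rw [List.count_eq_zero] at hc hd
      rcases h with ⟨rfl, rfl⟩ | ⟨rfl, rfl⟩
      · exact hmap v hc hd
      · exact hmap v hd hc
    have e1 : Equiv.swap i.castSucc i.succ c = d := by
      rcases h with ⟨rfl, rfl⟩ | ⟨rfl, rfl⟩ <;> simp
    have e2 : Equiv.swap i.castSucc i.succ d = c := by
      rcases h with ⟨rfl, rfl⟩ | ⟨rfl, rfl⟩ <;> simp
    simp only [List.map_append, List.map_cons, e1, e2]
    rw [hnot (v := A) (by omega) (by omega), hnot (v := B) (by omega) (by omega),
      hnot (v := C) (by omega) (by omega)]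
    linear_combination hsum
  obtain ⟨A, B, hu⟩ := List.append_of_mem h1
  rw [hu, List.mem_append, List.mem_cons] at h2
  rcases h2 with h2 | h2 | h2
  · obtain ⟨A₁, A₂, rfl⟩ := List.append_of_mem h2
    exact main i.succ i.castSucc A₁ A₂ B (Or.inr ⟨rfl, rfl⟩) (by simp [hu])
  · exact absurd h2 hne.symm
  · obtain ⟨B₁, B₂, rfl⟩ := List.append_of_mem h2
    exact main i.castSucc i.succ A B₁ B₂ (Or.inl ⟨rfl, rfl⟩) (by simp [hu])

/-- The multilinear coefficients of a cycle are alternating. -/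
lemma magnus_ofFn_perm (hw : ∀ i : Fin (n + 2), freeFace i w = 1)
    (σ : Equiv.Perm (Fin (n + 1))) :
    magnus ℤ w (List.ofFn σ) =
      (Equiv.Perm.sign σ : ℤ) * magnus ℤ w (List.ofFn (1 : Equiv.Perm (Fin (n + 1)))) := by
  have hσ : σ ∈ Submonoid.closure
      (Set.range fun i : Fin n => Equiv.swap i.castSucc i.succ) := by
    rw [Equiv.Perm.mclosure_swap_castSucc_succ]
    trivial
  suffices ∀ τ : Equiv.Perm (Fin (n + 1)), magnus ℤ w (List.ofFn (σ * τ)) =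
      (Equiv.Perm.sign σ : ℤ) * magnus ℤ w (List.ofFn τ) by simpa using this 1
  induction hσ using Submonoid.closure_induction with
  | one => simp
  | mul σ σ' _ _ h h' =>
    intro τ
    rw [mul_assoc, h, h', Equiv.Perm.sign_mul, Units.val_mul, mul_assoc]
  | mem σ hσ =>
    obtain ⟨i, rfl⟩ := hσ
    intro τ
    have hmem : ∀ a, a ∈ List.ofFn τ := fun a => by
      rw [List.mem_ofFn]
      exact τ.surjective a
    have := magnus_map_swap hw i (u := List.ofFn τ) (List.nodup_ofFn.2 τ.injective) (hmem _)
      (hmem _)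
    rw [List.map_ofFn] at this
    refine Eq.trans this ?_
    rw [Equiv.Perm.sign_swap (Fin.castSucc_lt_succ).ne]
    simp

end Faces

end FreeToK
end

noncomputable section

namespace FreeToK

/-! ### Free groups as the degrees of `F[S¹]` and `K[S¹]` -/

section Identification

lemma objMk₁_mem_boundary_iff {n : ℕ} (i : Fin (n + 2)) :
    (SSet.stdSimplex.objMk₁ i : (Δ[1] : SSet.{0}) _⦋n⦌) ∈
      (∂Δ[1] : (Δ[1] : SSet.{0}).Subcomplex).obj (op ⦋n⦌) ↔ i = 0 ∨ i = Fin.last (n + 1) := by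
  have h0 : (0 : Fin 2) ∉ Set.range (SSet.stdSimplex.objMk₁.{0} i) ↔ i = 0 := by
    simp only [Set.mem_range, not_exists, SSet.stdSimplex.objMk₁_apply_eq_zero_iff, not_lt]
    constructor
    · intro h
      have h1 := h 0
      rwa [Fin.castSucc_zero, Fin.le_zero_iff] at h1
    · rintro rfl j
      exact Fin.zero_le _
  have h1 : (1 : Fin 2) ∉ Set.range (SSet.stdSimplex.objMk₁.{0} i) ↔ i = Fin.last (n + 1) := by
    simp only [Set.mem_range, not_exists, SSet.stdSimplex.objMk₁_apply_eq_one_iff, not_le]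
    constructor
    · intro h
      have h1 := h (Fin.last n)
      refine Fin.ext ?_
      have h2 : n < i.1 := h1
      have := i.2
      simp only [Fin.val_last]
      omega
    · rintro rfl j
      exact Fin.castSucc_lt_last _
  rw [SSet.mem_boundary_iff_notMem_range, Fin.exists_fin_two, h0, h1]

lemma objMk₁_mem_boundary_zero (i : Fin 2) :
    (SSet.stdSimplex.objMk₁ i : (Δ[1] : SSet.{0}) _⦋0⦌) ∈
      (∂Δ[1] : (Δ[1] : SSet.{0}).Subcomplex).obj (op ⦋0⦌) := by
  rw [SSet.boundary_obj_eq_univ 0 1]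
  trivial

/-- The letter of the free group which corresponds to a simplex of the circle. -/
def simplexLetter {n : ℕ} (i : Fin (n + 2)) : Option (Fin n) :=
  if h : 0 < i.1 ∧ i.1 < n + 1 then some ⟨i.1 - 1, by omega⟩ else none

lemma simplexLetter_eq_none {n : ℕ} {i : Fin (n + 2)} (h : i = 0 ∨ i = Fin.last (n + 1)) :
    simplexLetter i = none := by
  rw [simplexLetter, dif_neg]
  rcases h with rfl | rfl <;> simp

lemma simplexLetter_succ_castSucc {n : ℕ} (i : Fin n) :
    simplexLetter i.succ.castSucc = some i := by
  rw [simplexLetter, dif_pos (by simp)]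
  rfl

lemma eq_or_exists_succ_castSucc {n : ℕ} (i : Fin (n + 2)) :
    (i = 0 ∨ i = Fin.last (n + 1)) ∨ ∃ j : Fin n, i = j.succ.castSucc := by
  by_cases h : i = 0 ∨ i = Fin.last (n + 1)
  · exact Or.inl h
  · refine Or.inr ⟨⟨i.1 - 1, ?_⟩, ?_⟩
    all_goals
      simp only [Fin.ext_iff, Fin.val_zero, Fin.val_last, Fin.val_castSucc, Fin.val_succ] at h ⊢
      omega

/-- The word of the free group which corresponds to a simplex of the circle. -/
def circleWord {n : ℕ} (s : circle _⦋n⦌) : FreeGroup (Fin n) :=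
  Quot.lift (fun s => optGen (simplexLetter
    ((Equiv.ofBijective _ (SSet.stdSimplex.objMk₁_bijective (n := n))).symm s))) (by
    rintro a b ⟨ha, hb⟩
    obtain ⟨i, rfl⟩ := SSet.stdSimplex.objMk₁_surjective a
    obtain ⟨j, rfl⟩ := SSet.stdSimplex.objMk₁_surjective b
    have hi := simplexLetter_eq_none ((objMk₁_mem_boundary_iff i).1 ha)
    have hj := simplexLetter_eq_none ((objMk₁_mem_boundary_iff j).1 hb)
    simp only [Equiv.ofBijective_symm_apply_apply, hi, hj]) s

lemma circleWord_circleSimplex {n : ℕ} (i : Fin (n + 2)) :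
    circleWord (circleSimplex n i) = optGen (simplexLetter i) := by
  change optGen (simplexLetter ((Equiv.ofBijective _
    (SSet.stdSimplex.objMk₁_bijective (n := n))).symm (SSet.stdSimplex.objMk₁ i))) = _
  rw [Equiv.ofBijective_symm_apply_apply]

lemma exists_circleSimplex {n : ℕ} (s : circle _⦋n⦌) : ∃ i, s = circleSimplex n i := by
  obtain ⟨s, rfl⟩ := Quot.exists_rep s
  obtain ⟨i, rfl⟩ := SSet.stdSimplex.objMk₁_surjective s
  exact ⟨i, rfl⟩

lemma circleSimplex_eq_basePt {n : ℕ} {i : Fin (n + 2)} (h : i = 0 ∨ i = Fin.last (n + 1)) :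
    circleSimplex n i = basePt circle circlePt (op ⦋n⦌) :=
  Quot.sound ⟨(objMk₁_mem_boundary_iff i).2 h,
    (∂Δ[1] : (Δ[1] : SSet.{0}).Subcomplex).map _ (objMk₁_mem_boundary_zero 1)⟩

lemma gen_basePt {n : ℕ} : gen circlePt (basePt circle circlePt (op ⦋n⦌)) = 1 :=
  PresentedGroup.one_of_mem (Set.mem_singleton _)

lemma circleWord_basePt {n : ℕ} : circleWord (basePt circle circlePt (op ⦋n⦌)) = 1 := by
  rw [← circleSimplex_eq_basePt (Or.inl rfl), circleWord_circleSimplex,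
    simplexLetter_eq_none (Or.inl rfl)]
  rfl

/-- The generator of `F[S¹]_n` given by a letter. -/
def circleGen {n : ℕ} (i : Fin n) : MilnorGroup circle circlePt (op ⦋n⦌) :=
  gen circlePt (circleSimplex n i.succ.castSucc)

lemma gen_circleSimplex {n : ℕ} (i : Fin (n + 2)) :
    gen circlePt (circleSimplex n i) = FreeGroup.lift circleGen (optGen (simplexLetter i)) := by
  rcases eq_or_exists_succ_castSucc i with h | ⟨j, rfl⟩
  · rw [circleSimplex_eq_basePt h, simplexLetter_eq_none h]
    exact gen_basePt.trans (map_one _).symm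
  · rw [simplexLetter_succ_castSucc]
    exact FreeGroup.lift_apply_of.symm

/-- The homomorphism from `F[S¹]_n` to the free group. -/
def freeInv (n : ℕ) : MilnorGroup circle circlePt (op ⦋n⦌) →* FreeGroup (Fin n) :=
  PresentedGroup.toGroup (f := circleWord) (by
    rintro r rfl
    rw [FreeGroup.lift_apply_of, circleWord_basePt])

lemma freeInv_gen {n : ℕ} (s : circle _⦋n⦌) : freeInv n (gen circlePt s) = circleWord s :=
  PresentedGroup.toGroup.of _

/-- The free group on `n` letters is Milnor's group of the circle in degree `n`. -/
def milnorEquiv (n : ℕ) : FreeGroup (Fin n) ≃* MilnorGroup circle circlePt (op ⦋n⦌) :=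
  MonoidHom.toMulEquiv (FreeGroup.lift circleGen) (freeInv n)
    (FreeGroup.ext_hom _ _ fun i => by
      rw [MonoidHom.comp_apply, FreeGroup.lift_apply_of, circleGen, freeInv_gen,
        circleWord_circleSimplex, simplexLetter_succ_castSucc]
      rfl)
    (PresentedGroup.ext fun s => by
      obtain ⟨i, rfl⟩ := exists_circleSimplex s
      change FreeGroup.lift circleGen (freeInv n (gen circlePt (circleSimplex n i))) =
        gen circlePt (circleSimplex n i)
      rw [freeInv_gen, circleWord_circleSimplex, ← gen_circleSimplex])

lemma milnorEquiv_of {n : ℕ} (i : Fin n) : milnorEquiv n (FreeGroup.of i) = circleGen i :=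
  FreeGroup.lift_apply_of (f := circleGen)

lemma milnorEquiv_optGen {n : ℕ} (i : Fin (n + 2)) :
    milnorEquiv n (optGen (simplexLetter i)) = gen circlePt (circleSimplex n i) :=
  (gen_circleSimplex i).symm

lemma δ_circleSimplex_of_le {n : ℕ} {i : Fin (n + 3)} {k : Fin (n + 2)} (h : i ≤ k.castSucc) :
    circle.δ k (circleSimplex (n + 1) i) = circleSimplex n
      (i.castPred (Fin.ne_last_of_lt (lt_of_le_of_lt h k.castSucc_lt_succ))) :=
  congrArg (Quot.mk _) (SSet.stdSimplex.δ_objMk₁_of_le i k h)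

lemma δ_circleSimplex_of_lt {n : ℕ} {i : Fin (n + 3)} {k : Fin (n + 2)} (h : k.castSucc < i) :
    circle.δ k (circleSimplex (n + 1) i) = circleSimplex n (i.pred (Fin.ne_zero_of_lt h)) :=
  congrArg (Quot.mk _) (SSet.stdSimplex.δ_objMk₁_of_lt i k h)

/-- The free group on `n` letters is `F[S¹]_n`. -/
def freeEquiv (n : ℕ) : FreeGroup (Fin n) ≃* FS1 _⦋n⦌ := milnorEquiv n

lemma freeEquiv_of {n : ℕ} (i : Fin n) : freeEquiv n (FreeGroup.of i) = circleGen i :=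
  milnorEquiv_of i

/-- Deleting the vertex `k` of `⟨0^i, 1^*⟩` lowers `i` by one if `k < i` and keeps it otherwise. The
letter attached to this simplex has number `i - 1`. -/
lemma milnorMap_milnorEquiv {n : ℕ} (k : Fin (n + 2)) (w : FreeGroup (Fin (n + 1))) :
    milnorMap circle circlePt (SimplexCategory.δ k).op (milnorEquiv (n + 1) w) =
      milnorEquiv n (freeFace k w) := by
  suffices h : (milnorMap circle circlePt (SimplexCategory.δ k).op).comp
      (milnorEquiv (n + 1)).toMonoidHom = (milnorEquiv n).toMonoidHom.comp (freeFace k) from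
    DFunLike.congr_fun h w
  refine FreeGroup.ext_hom _ _ fun i => ?_
  change milnorMap circle circlePt (SimplexCategory.δ k).op (milnorEquiv (n + 1) (FreeGroup.of i)) =
    milnorEquiv n (freeFace k (FreeGroup.of i))
  rw [letterHom_of, milnorEquiv_of, circleGen, milnorMap_gen]
  change gen circlePt (circle.δ k (circleSimplex (n + 1) i.succ.castSucc)) = _
  by_cases h : i.succ.castSucc ≤ k.castSucc
  · rw [δ_circleSimplex_of_le h, ← milnorEquiv_optGen]
    congr 2
    have h' : i.1 < k.1 := h
    simp only [simplexLetter, faceLetter, Fin.coe_castPred, Fin.val_castSucc, Fin.val_succ, h',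
      if_true]
    split_ifs <;> first | rfl | omega | simp
  · rw [not_le] at h
    rw [δ_circleSimplex_of_lt h, ← milnorEquiv_optGen]
    congr 2
    have h' : ¬ i.1 < k.1 := fun h1 => absurd h (not_lt.2 h1)
    simp only [simplexLetter, faceLetter, Fin.val_pred, Fin.val_castSucc, Fin.val_succ, h',
      if_false]
    split_ifs <;> first | rfl | omega

lemma faceHom_freeEquiv {n : ℕ} (k : Fin (n + 2)) (w : FreeGroup (Fin (n + 1))) :
    faceHom FS1 k (freeEquiv (n + 1) w) = freeEquiv n (freeFace k w) :=
  milnorMap_milnorEquiv k w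

lemma faceHom_freeEquiv_eq_one {n : ℕ} (k : Fin (n + 2)) (w : FreeGroup (Fin (n + 1))) :
    faceHom FS1 k (freeEquiv (n + 1) w) = 1 ↔ freeFace k w = 1 := by
  rw [faceHom_freeEquiv, EmbeddingLike.map_eq_one_iff]

/-- The relations of `K[S¹]` at the base point hold trivially, so only those at the letters remain.
-/
lemma map_reducedFreeRel (n : ℕ) :
    (reducedFreeRel n).map (milnorEquiv n).toMonoidHom = reducedRel circle circlePt (op ⦋n⦌) := by
  apply le_antisymm
  · rw [Subgroup.map_le_iff_le_comap]
    have : ((reducedRel circle circlePt (op ⦋n⦌)).comap (milnorEquiv n).toMonoidHom).Normal :=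
      Subgroup.Normal.comap inferInstance _
    refine Subgroup.normalClosure_le_normal ?_
    rintro _ ⟨i, g, rfl⟩
    refine Subgroup.subset_normalClosure ⟨circleSimplex n i.succ.castSucc, milnorEquiv n g, ?_⟩
    have h : milnorEquiv n (FreeGroup.of i) = gen circlePt (circleSimplex n i.succ.castSucc) :=
      milnorEquiv_of i
    rw [← h]
    simp
  · have : ((reducedFreeRel n).map (milnorEquiv n).toMonoidHom).Normal :=
      Subgroup.Normal.map inferInstance _ (milnorEquiv n).surjective
    refine Subgroup.normalClosure_le_normal ?_
    rintro _ ⟨s, g, rfl⟩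
    obtain ⟨i, rfl⟩ := exists_circleSimplex s
    obtain ⟨g, rfl⟩ := (milnorEquiv n).surjective g
    rw [← milnorEquiv_optGen]
    rcases simplexLetter i with _ | j
    · change milnorEquiv n 1 * (_ * milnorEquiv n 1 * _) * (milnorEquiv n 1)⁻¹ *
        (_ * milnorEquiv n 1 * _)⁻¹ ∈ _
      simp only [map_one, mul_one, mul_inv_cancel, inv_one]
      exact Subgroup.one_mem _
    · exact ⟨_, Subgroup.subset_normalClosure ⟨j, g, rfl⟩, by simp [optGen]⟩

/-- The reduced free group on `n` letters is `K[S¹]_n`. -/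
def reducedEquiv (n : ℕ) : ReducedFreeGroup n ≃* KS1 _⦋n⦌ :=
  (QuotientGroup.congr (reducedFreeRel n) (reducedRel circle circlePt (op ⦋n⦌)) (milnorEquiv n)
    (map_reducedFreeRel n) :
      ReducedFreeGroup n ≃* MilnorGroup circle circlePt (op ⦋n⦌) ⧸
        reducedRel circle circlePt (op ⦋n⦌))

lemma reducedEquiv_mk {n : ℕ} (w : FreeGroup (Fin n)) :
    reducedEquiv n (w : ReducedFreeGroup n) = appHom rho n (freeEquiv n w) := rfl

lemma rho_surjective (n : ℕ) : Function.Surjective (appHom rho n) := by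
  intro k
  obtain ⟨w, rfl⟩ := (reducedEquiv n).surjective k
  obtain ⟨w, rfl⟩ := QuotientGroup.mk_surjective w
  exact ⟨freeEquiv n w, rfl⟩

lemma rho_freeEquiv_eq_one {n : ℕ} {w : FreeGroup (Fin n)} :
    appHom rho n (freeEquiv n w) = 1 ↔ w ∈ reducedFreeRel n := by
  rw [← reducedEquiv_mk, EmbeddingLike.map_eq_one_iff, QuotientGroup.eq_one_iff]

/-- This is the Nielsen–Schreier theorem. -/
lemma isFreeGroup_gammaS1 (n : ℕ) : IsFreeGroup (GammaS1 _⦋n⦌) := by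
  have : IsFreeGroup (FS1 _⦋n⦌) := IsFreeGroup.ofMulEquiv (freeEquiv n)
  exact subgroupIsFreeOfIsFree (appHom rho n).ker

end Identification

end FreeToK

end

noncomputable section

namespace FreeToK

open scoped commutatorElement

/-! ### The Moore complex of `K[S¹]` -/

section PermList

/-- The rearrangements of a list without repetitions. -/
def permListEquiv {α : Type} [DecidableEq α] {l : List α} (hl : l.Nodup) :
    {u : List α // u.Perm l} ≃ Fin l.length.factorial :=
  (Equiv.subtypeEquivRight fun _ => List.mem_permutations.symm).trans
    ((List.Nodup.getEquiv _ (List.nodup_permutations l hl)).symm.trans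
      (finCongr (List.length_permutations l)))

lemma perm_finRange_or_exists_notMem {n : ℕ} {v : List (Fin n)} (hv : v.Nodup) :
    v.Perm (List.finRange n) ∨ ∃ m, m ∉ v := by
  by_cases h : ∃ m, m ∉ v
  · exact Or.inr h
  · refine Or.inl ((List.perm_ext_iff_of_nodup hv (List.nodup_finRange n)).2 fun a => ?_)
    push Not at h
    simp [h a]

end PermList

section Moore

/-- Two different letters with the same value act like a repeated letter. -/
lemma IsReducedFamily.commWord_eq_one_of_eq {α G : Type} [Group G] {x : α → G}
    (hx : IsReducedFamily x) {z : α} {u : List α} (hu : (u ++ [z]).Nodup) {a b : α}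
    (hab : a ≠ b) (ha : a ∈ u ++ [z]) (hb : b ∈ u ++ [z]) (h : x a = x b) :
    commWord x z u = 1 := by
  induction u with
  | nil => simp_all
  | cons c u ih =>
    rw [commWord, commutatorElement_eq_one_iff_commute]
    rw [List.cons_append, List.mem_cons] at ha hb
    rcases ha with rfl | ha
    · rcases hb with rfl | hb
      · exact absurd rfl hab
      · exact hx.commute a (self_mem_normalClosure a) (by
          rw [h]; exact commWord_mem_of_normal x hb (self_mem_normalClosure b))
    · rcases hb with rfl | hb
      · exact hx.commute b (self_mem_normalClosure b) (by
          rw [← h]; exact commWord_mem_of_normal x ha (self_mem_normalClosure a))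
      · rw [ih (List.nodup_cons.1 hu).2 ha hb]
        exact Commute.one_right _

lemma commWord_eq_one_of_eq_one {α G : Type} [Group G] {x : α → G} {z : α} {u : List α} {a : α}
    (ha : a ∈ u ++ [z]) (h : x a = 1) : commWord x z u = 1 := by
  have := commWord_mem_of_normal x (N := ⊥) ha (by rw [h]; exact Subgroup.one_mem _)
  rwa [Subgroup.mem_bot] at this

variable {n : ℕ}

/-- The faces of the reduced free groups. -/
def reducedFace (k : Fin (n + 2)) : ReducedFreeGroup (n + 1) →* ReducedFreeGroup n :=
  (reducedEquiv n).symm.toMonoidHom.comp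
    ((faceHom KS1 k).comp (reducedEquiv (n + 1)).toMonoidHom)

lemma reducedEquiv_reducedFace (k : Fin (n + 2)) (x : ReducedFreeGroup (n + 1)) :
    reducedEquiv n (reducedFace k x) = faceHom KS1 k (reducedEquiv (n + 1) x) :=
  (reducedEquiv n).apply_symm_apply _

lemma reducedFace_mk (k : Fin (n + 2)) (w : FreeGroup (Fin (n + 1))) :
    reducedFace k (w : ReducedFreeGroup (n + 1)) = (freeFace k w : FreeGroup (Fin n)) := by
  apply (reducedEquiv n).injective
  rw [reducedEquiv_reducedFace, reducedEquiv_mk, reducedEquiv_mk]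
  exact (appHom_faceHom rho k _).symm.trans (congrArg _ (faceHom_freeEquiv k w))

/-- The elements of the reduced free group all of whose faces but `d₀` are trivial. -/
def reducedMoore (n : ℕ) : Subgroup (ReducedFreeGroup (n + 1)) :=
  ⨅ i : Fin (n + 1), (reducedFace i.succ).ker

/-- The elements of the reduced free group all of whose faces are trivial. -/
def reducedCycles (n : ℕ) : Subgroup (ReducedFreeGroup (n + 1)) :=
  ⨅ i : Fin (n + 2), (reducedFace i).ker

lemma mem_reducedMoore {x : ReducedFreeGroup (n + 1)} :
    x ∈ reducedMoore n ↔ ∀ i : Fin (n + 1), reducedFace i.succ x = 1 := by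
  simp [reducedMoore]

lemma mem_reducedCycles {x : ReducedFreeGroup (n + 1)} :
    x ∈ reducedCycles n ↔ ∀ i : Fin (n + 2), reducedFace i x = 1 := by
  simp [reducedCycles]

lemma reducedCycles_le : reducedCycles n ≤ reducedMoore n := fun _ hx =>
  mem_reducedMoore.2 fun i => mem_reducedCycles.1 hx i.succ

/-- Moore chains lift along surjections of simplicial groups. With the lift, vanishing statements
proved in the free group become available in `K_n`. -/
lemma exists_mk_of_mem_reducedMoore {x : ReducedFreeGroup (n + 1)} (hx : x ∈ reducedMoore n) :
    ∃ w : FreeGroup (Fin (n + 1)), (w : ReducedFreeGroup (n + 1)) = x ∧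
      ∀ i : Fin (n + 1), freeFace i.succ w = 1 := by
  obtain ⟨g, hg, hg'⟩ := exists_moore_lift rho_surjective (reducedEquiv (n + 1) x) fun i => by
    rw [← reducedEquiv_reducedFace, mem_reducedMoore.1 hx i, map_one]
  obtain ⟨w, rfl⟩ := (freeEquiv (n + 1)).surjective g
  exact ⟨w, (reducedEquiv (n + 1)).injective hg,
    fun i => (faceHom_freeEquiv_eq_one _ w).1 (hg' i)⟩

/-- Modulo the last generator, every word equals its image under the last face followed by the
inclusion of letters. -/
lemma mem_normalClosure_of_freeFace_last {w : FreeGroup (Fin (n + 1))}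
    (hw : freeFace (Fin.last (n + 1)) w = 1) :
    w ∈ Subgroup.normalClosure {FreeGroup.of (Fin.last n)} := by
  let N : Subgroup (FreeGroup (Fin (n + 1))) := Subgroup.normalClosure {FreeGroup.of (Fin.last n)}
  have h : QuotientGroup.mk' N =
      (QuotientGroup.mk' N).comp
        ((FreeGroup.map Fin.castSucc).comp (freeFace (Fin.last (n + 1)))) := by
    refine FreeGroup.ext_hom _ _ fun a => ?_
    rw [MonoidHom.comp_apply, MonoidHom.comp_apply, letterHom_of, faceLetter,
      if_pos (by simp; omega)]
    split_ifs with ha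
    · rw [optGen, FreeGroup.map.of]
      rfl
    · obtain rfl : a = Fin.last n := Fin.ext (by simp; omega)
      rw [optGen, map_one, map_one]
      exact (QuotientGroup.eq_one_iff _).2 (Subgroup.subset_normalClosure rfl)
  have h1 := DFunLike.congr_fun h w
  rw [MonoidHom.comp_apply, MonoidHom.comp_apply, hw, map_one, map_one] at h1
  exact (QuotientGroup.eq_one_iff _).1 h1

lemma mk_mem_reducedNormal {z : Fin n} {w : FreeGroup (Fin n)}
    (hw : w ∈ Subgroup.normalClosure {FreeGroup.of z}) :
    (w : ReducedFreeGroup n) ∈ reducedNormal z := by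
  have : ((reducedNormal z).comap (QuotientGroup.mk' (reducedFreeRel n))).Normal :=
    Subgroup.Normal.comap inferInstance _
  have h : Subgroup.normalClosure {FreeGroup.of z} ≤
      (reducedNormal z).comap (QuotientGroup.mk' (reducedFreeRel n)) := by
    refine Subgroup.normalClosure_le_normal ?_
    rintro _ rfl
    exact Subgroup.subset_normalClosure rfl
  exact h hw

lemma reducedMoore_le : reducedMoore n ≤ reducedNormal (Fin.last n) := by
  intro x hx
  obtain ⟨w, rfl, hw⟩ := exists_mk_of_mem_reducedMoore hx
  exact mk_mem_reducedNormal (mem_normalClosure_of_freeFace_last (hw (Fin.last n)))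

/-- The words in all letters but the last one, each of which occurs once. -/
abbrev FullWord (n : ℕ) : Type :=
  {u : List (Fin (n + 1)) // u.Perm ((List.finRange n).map Fin.castSucc)}

lemma fullWord_iff {u : List (Fin (n + 1))} :
    u.Perm ((List.finRange n).map Fin.castSucc) ↔
      (u ++ [Fin.last n]).Perm (List.finRange (n + 1)) := by
  rw [List.finRange_succ_last, List.perm_append_right_iff]

lemma FullWord.nodup (u : FullWord n) : (u.1 ++ [Fin.last n]).Nodup :=
  (fullWord_iff.1 u.2).nodup_iff.2 (List.nodup_finRange _)

lemma FullWord.mem (u : FullWord n) (a : Fin (n + 1)) : a ∈ u.1 ++ [Fin.last n] :=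
  (fullWord_iff.1 u.2).mem_iff.2 (List.mem_finRange a)

lemma reducedCoeff_eq_zero_of_mem_reducedMoore {x : ReducedFreeGroup (n + 1)}
    (hx : x ∈ reducedMoore n) {u : List (Fin (n + 1))} (hu : (u ++ [Fin.last n]).Nodup)
    (hu' : ¬ u.Perm ((List.finRange n).map Fin.castSucc)) :
    reducedCoeff (Fin.last n) x u = 0 := by
  obtain ⟨w, rfl, hw⟩ := exists_mk_of_mem_reducedMoore hx
  rw [reducedCoeff_mk _ _ hu]
  rcases perm_finRange_or_exists_notMem hu with h | ⟨m, hm⟩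
  · exact absurd (fullWord_iff.2 h) hu'
  · exact magnus_eq_zero_of_notMem hw m _ (by simp) hm fun a _ => List.nodup_iff_count_le_one.1 hu a

lemma isReducedFamily_faceLetter (k : Fin (n + 2)) :
    IsReducedFamily fun a => (optGen (faceLetter k a) : ReducedFreeGroup n) := by
  intro a g
  change Commute (optGen (faceLetter k a) : ReducedFreeGroup n)
    (g * (optGen (faceLetter k a) : FreeGroup (Fin n)) * g⁻¹)
  rcases faceLetter k a with _ | b
  · exact Commute.one_left _
  · exact isReducedFamily_reducedGen b g

/-- All letters occur in the commutator. An outer face sends one of them to `1`, and an inner face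
makes two of them equal. -/
lemma commWord_mem_reducedCycles (u : FullWord n) :
    commWord reducedGen (Fin.last n) u.1 ∈ reducedCycles n := by
  rw [mem_reducedCycles]
  intro k
  rw [map_commWord]
  have hfun : (fun a => reducedFace k (reducedGen a)) =
      fun a => (optGen (faceLetter k a) : ReducedFreeGroup n) := by
    funext a
    rw [reducedGen, reducedFace_mk, letterHom_of]
  rw [hfun]
  have hnone : ∀ a, faceLetter k a = none → commWord
      (fun a => (optGen (faceLetter k a) : ReducedFreeGroup n)) (Fin.last n) u.1 = 1 := by
    intro a ha
    refine commWord_eq_one_of_eq_one (u.mem a) ?_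
    rw [ha]
    rfl
  by_cases h0 : k.1 = 0
  · exact hnone 0 (faceLetter_eq_none.2 (Or.inr ⟨rfl, h0⟩))
  by_cases hn : k.1 = n + 1
  · exact hnone (Fin.last n) (faceLetter_eq_none.2 (Or.inl ⟨rfl, hn⟩))
  have hk := k.2
  refine (isReducedFamily_faceLetter k).commWord_eq_one_of_eq u.nodup
    (a := ⟨k.1 - 1, by omega⟩) (b := ⟨k.1, by omega⟩) ?_ (u.mem _) (u.mem _) ?_
  · rw [Ne, Fin.ext_iff]
    simp only
    omega
  · have h : faceLetter k ⟨k.1 - 1, by omega⟩ = faceLetter k ⟨k.1, by omega⟩ :=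
      faceLetter_eq_faceLetter.2 (Or.inr (Or.inl ⟨Nat.sub_add_cancel (by omega), rfl⟩))
    rw [h]

/-- The coefficients of an element of the Moore complex. -/
def mooreCoeff (n : ℕ) : reducedMoore n →* Multiplicative (FullWord n → ℤ) where
  toFun x := Multiplicative.ofAdd fun u => reducedCoeff (Fin.last n) x.1 u.1
  map_one' := by
    refine congrArg Multiplicative.ofAdd (funext fun u => ?_)
    have h := reducedCoeff_mul (Fin.last n) (Subgroup.one_mem (reducedNormal (Fin.last n)))
      (l := 1) u.nodup
    rw [one_mul] at h
    exact left_eq_add.1 h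
  map_mul' x y := congrArg Multiplicative.ofAdd (funext fun u =>
    reducedCoeff_mul (Fin.last n) (reducedMoore_le x.2) u.nodup)

lemma mooreCoeff_apply (x : reducedMoore n) (u : FullWord n) :
    (mooreCoeff n x).toAdd u = reducedCoeff (Fin.last n) x.1 u.1 := rfl

/-- The coefficients not recorded belong to words missing a letter, and they vanish on Moore chains.
-/
lemma mooreCoeff_injective (n : ℕ) : Function.Injective (mooreCoeff n) := by
  refine (injective_iff_map_eq_one _).2 fun x hx => Subtype.ext ?_
  refine eq_one_of_reducedCoeff (Fin.last n) (reducedMoore_le x.2) fun u hu => ?_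
  by_cases hu' : u.Perm ((List.finRange n).map Fin.castSucc)
  · rw [← mooreCoeff_apply x ⟨u, hu'⟩, hx]
    rfl
  · exact reducedCoeff_eq_zero_of_mem_reducedMoore x.2 hu hu'

instance : Finite (FullWord n) :=
  Finite.of_equiv _ (permListEquiv
    ((List.nodup_finRange n).map (Fin.castSucc_injective n))).symm

/-- The subgroup generated by the iterated commutators in which every letter occurs once. -/
def fullCommutators (n : ℕ) : Subgroup (ReducedFreeGroup (n + 1)) :=
  Subgroup.closure (Set.range fun u : FullWord n => commWord reducedGen (Fin.last n) u.1)

lemma fullCommutators_le : fullCommutators n ≤ reducedCycles n := by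
  rw [fullCommutators, Subgroup.closure_le]
  rintro _ ⟨u, rfl⟩
  exact commWord_mem_reducedCycles u

lemma mooreCoeff_surjective (n : ℕ) (f : FullWord n → ℤ) :
    ∃ x : reducedMoore n, x.1 ∈ fullCommutators n ∧ (mooreCoeff n x).toAdd = f := by
  let S : AddSubgroup (FullWord n → ℤ) :=
    { carrier := {f | ∃ x : reducedMoore n, x.1 ∈ fullCommutators n ∧ (mooreCoeff n x).toAdd = f}
      zero_mem' := ⟨1, Subgroup.one_mem _, by rw [map_one]; rfl⟩
      add_mem' := by
        rintro _ _ ⟨x, hx, rfl⟩ ⟨y, hy, rfl⟩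
        exact ⟨x * y, Subgroup.mul_mem _ hx hy, by rw [map_mul]; rfl⟩
      neg_mem' := by
        rintro _ ⟨x, hx, rfl⟩
        exact ⟨x⁻¹, Subgroup.inv_mem _ hx, by rw [map_inv]; rfl⟩ }
  have := Fintype.ofFinite (FullWord n)
  have hS : ∀ u : FullWord n, Pi.single u 1 ∈ S := fun u =>
    ⟨⟨commWord reducedGen (Fin.last n) u.1, reducedCycles_le (commWord_mem_reducedCycles u)⟩,
      Subgroup.subset_closure ⟨u, rfl⟩, funext fun v => by
        rw [mooreCoeff_apply, reducedCoeff_commWord _ u.nodup v.nodup, Pi.single_apply]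
        simp only [Subtype.ext_iff]⟩
  have hf : f = ∑ u, f u • (Pi.single u 1 : FullWord n → ℤ) := by
    funext v
    simp [Finset.sum_apply, Pi.single_apply]
  have hmem : f ∈ S := by
    rw [hf]
    exact AddSubgroup.sum_mem _ fun u _ => AddSubgroup.zsmul_mem _ (hS u) _
  exact hmem

/-- Some product of full commutators has the same coefficients, and coefficients determine Moore
chains. -/
lemma reducedMoore_le_fullCommutators (n : ℕ) : reducedMoore n ≤ fullCommutators n := by
  intro x hx
  obtain ⟨y, hy, hxy⟩ := mooreCoeff_surjective n (mooreCoeff n ⟨x, hx⟩).toAdd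
  have h : y.1 = x := Subtype.ext_iff.1 (mooreCoeff_injective n hxy)
  exact h ▸ hy

/-- Moore chains are generated by full commutators, which are cycles; hence the Moore complex has
zero differential. -/
theorem reducedMoore_eq_reducedCycles (n : ℕ) : reducedMoore n = reducedCycles n :=
  le_antisymm ((reducedMoore_le_fullCommutators n).trans fullCommutators_le) reducedCycles_le

theorem reducedMoore_equiv (n : ℕ) :
    Nonempty (reducedMoore n ≃* Multiplicative (Fin n.factorial → ℤ)) := by
  have hlen : ((List.finRange n).map Fin.castSucc).length.factorial = n.factorial := by simp
  let e : FullWord n ≃ Fin n.factorial := (permListEquiv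
    ((List.nodup_finRange n).map (Fin.castSucc_injective n))).trans (finCongr hlen)
  refine ⟨(MulEquiv.ofBijective (mooreCoeff n) ⟨mooreCoeff_injective n, fun f => ?_⟩).trans
    (AddEquiv.toMultiplicative (LinearEquiv.funCongrLeft ℤ ℤ e.symm).toAddEquiv)⟩
  obtain ⟨x, _, hx⟩ := mooreCoeff_surjective n f.toAdd
  exact ⟨x, hx⟩

end Moore

/-! ### The homotopy groups of `K[S¹]` -/

section HomotopyGroups

variable {n : ℕ} {G : SimplicialObject GrpCat.{0}}

lemma mem_cycles_succ {x : G _⦋n + 1⦌} : x ∈ cycles G (n + 1) ↔ ∀ i, faceHom G i x = 1 := by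
  simp only [cycles, Subgroup.mem_iInf, MonoidHom.mem_ker]

lemma mem_boundaries {x : G _⦋n⦌} : x ∈ boundaries G n ↔
    ∃ y : G _⦋n + 1⦌, (∀ i : Fin (n + 1), faceHom G i.succ y = 1) ∧ faceHom G 0 y = x := by
  simp only [boundaries, Subgroup.mem_map, Subgroup.mem_iInf, MonoidHom.mem_ker]

lemma faceHom_zero_reduced {x : KS1 _⦋n + 1⦌}
    (hx : ∀ i : Fin (n + 1), faceHom KS1 i.succ x = 1) : faceHom KS1 0 x = 1 := by
  obtain ⟨k, rfl⟩ := (reducedEquiv (n + 1)).surjective x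
  have hk : k ∈ reducedMoore n := mem_reducedMoore.2 fun i => by
    apply (reducedEquiv n).injective
    rw [reducedEquiv_reducedFace, hx i, map_one]
  rw [reducedMoore_eq_reducedCycles] at hk
  rw [← reducedEquiv_reducedFace, mem_reducedCycles.1 hk 0, map_one]

lemma boundaries_reduced (n : ℕ) : boundaries KS1 n = ⊥ := by
  refine (Subgroup.eq_bot_iff_forall _).2 fun x hx => ?_
  obtain ⟨y, hy, rfl⟩ := mem_boundaries.1 hx
  exact faceHom_zero_reduced hy

lemma cycles_reduced (n : ℕ) :
    cycles KS1 (n + 1) = (reducedCycles n).map (reducedEquiv (n + 1)).toMonoidHom := by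
  ext x
  obtain ⟨k, rfl⟩ := (reducedEquiv (n + 1)).surjective x
  rw [mem_cycles_succ]
  refine Iff.trans ?_ (Subgroup.mem_map_iff_mem
    (f := (reducedEquiv (n + 1)).toMonoidHom) (reducedEquiv (n + 1)).injective).symm
  rw [mem_reducedCycles]
  refine forall_congr' fun i => ?_
  rw [← reducedEquiv_reducedFace, EmbeddingLike.map_eq_one_iff]

lemma homotopyMk_eq_one {x : cycles G n} :
    (QuotientGroup.mk x : HomotopyGroup G n) = 1 ↔ x.1 ∈ boundaries G n := by
  rw [QuotientGroup.eq_one_iff, Subgroup.mem_subgroupOf]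

lemma homotopyGroup_reduced_equiv_cycles (n : ℕ) :
    Nonempty (HomotopyGroup KS1 n ≃* cycles KS1 n) := by
  have hbot : (boundaries KS1 n).subgroupOf (cycles KS1 n) = ⊥ := by
    rw [boundaries_reduced, Subgroup.bot_subgroupOf]
  exact ⟨(QuotientGroup.quotientMulEquivOfEq hbot).trans QuotientGroup.quotientBot⟩

theorem homotopyGroup_reduced_equiv (n : ℕ) :
    Nonempty (HomotopyGroup KS1 (n + 1) ≃* Multiplicative (Fin n.factorial → ℤ)) := by
  obtain ⟨e⟩ := reducedMoore_equiv n
  obtain ⟨e'⟩ := homotopyGroup_reduced_equiv_cycles (n + 1)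
  exact ⟨e'.trans <| (MulEquiv.subgroupCongr (cycles_reduced n)).trans <|
    ((reducedEquiv (n + 1)).subgroupMap (reducedCycles n)).symm.trans <|
    (MulEquiv.subgroupCongr (reducedMoore_eq_reducedCycles n).symm).trans e⟩

end HomotopyGroups

end FreeToK

end

noncomputable section

namespace FreeToK

open scoped commutatorElement

/-! ### Quotients of class two -/

section ClassTwo

variable {G : Type} [Group G]

lemma commutator_mem_center_of_closure {S : Set G} (hS : Subgroup.closure S = ⊤)
    (h : ∀ a ∈ S, ∀ b ∈ S, ⁅a, b⁆ ∈ Subgroup.center G) (g g' : G) :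
    ⁅g, g'⁆ ∈ Subgroup.center G := by
  let π : G →* G ⧸ Subgroup.center G := QuotientGroup.mk' _
  have key : ∀ a b : G, ⁅a, b⁆ ∈ Subgroup.center G ↔ Commute (π a) (π b) := by
    intro a b
    rw [← commutatorElement_eq_one_iff_commute, ← map_commutatorElement]
    exact (QuotientGroup.eq_one_iff _).symm
  have step : ∀ b : G, (∀ a ∈ S, Commute (π a) (π b)) → ∀ a, Commute (π a) (π b) := by
    intro b hb a
    have ha : a ∈ Subgroup.closure S := by rw [hS]; trivial
    induction ha using Subgroup.closure_induction with
    | mem a ha => exact hb a ha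
    | one => rw [map_one]; exact Commute.one_left _
    | mul a a' _ _ ha ha' => rw [map_mul]; exact ha.mul_left ha'
    | inv a _ ha => rw [map_inv]; exact ha.inv_left
  rw [key]
  exact step g' (fun a ha => (step a (fun b hb => (key _ _).1 (h b hb a ha)) g').symm) g

variable {n : ℕ} {φ : FreeGroup (Fin n) →* G}

/-- The argument passes to the image of `φ`, where the generators generate and their commutators are
central. -/
lemma commute_map_commutator
    (hφ : ∀ i j k, Commute ⁅φ (FreeGroup.of i), φ (FreeGroup.of j)⁆ (φ (FreeGroup.of k)))
    (g g' h : FreeGroup (Fin n)) : Commute ⁅φ g, φ g'⁆ (φ h) := by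
  have hS : Subgroup.closure (Set.range fun i => φ.rangeRestrict (FreeGroup.of i)) = ⊤ := by
    have h1 : (Set.range fun i => φ.rangeRestrict (FreeGroup.of i)) =
        φ.rangeRestrict '' Set.range FreeGroup.of := by
      rw [← Set.range_comp]
      rfl
    rw [h1, ← MonoidHom.map_closure, FreeGroup.closure_range_of, ← MonoidHom.range_eq_map,
      MonoidHom.range_eq_top]
    exact φ.rangeRestrict_surjective
  have hc := commutator_mem_center_of_closure hS (by
    rintro _ ⟨i, rfl⟩ _ ⟨j, rfl⟩
    rw [Subgroup.mem_center_iff]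
    intro t
    have ht : t ∈ Subgroup.closure (Set.range fun i => φ.rangeRestrict (FreeGroup.of i)) := by
      rw [hS]
      trivial
    change Commute t _
    induction ht using Subgroup.closure_induction with
    | mem t ht =>
      obtain ⟨k, rfl⟩ := ht
      exact Subtype.ext (hφ i j k).symm.eq
    | one => exact Commute.one_left _
    | mul a a' _ _ ha ha' => exact ha.mul_left ha'
    | inv a _ ha => exact ha.inv_left) (φ.rangeRestrict g) (φ.rangeRestrict g')
  have := Subgroup.mem_center_iff.1 hc (φ.rangeRestrict h)
  exact (Subtype.ext_iff.1 this).symm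

/-- In class two a conjugate of `x` is `x` times a central element, so it commutes with `x`. -/
lemma reducedFreeRel_le_ker
    (hφ : ∀ i j k, Commute ⁅φ (FreeGroup.of i), φ (FreeGroup.of j)⁆ (φ (FreeGroup.of k))) :
    reducedFreeRel n ≤ φ.ker := by
  refine Subgroup.normalClosure_le_normal ?_
  rintro _ ⟨i, g, rfl⟩
  have h1 : g * FreeGroup.of i * g⁻¹ = ⁅g, FreeGroup.of i⁆ * FreeGroup.of i := by
    rw [commutatorElement_def]
    group
  have h2 : Commute (φ (FreeGroup.of i)) (φ (g * FreeGroup.of i * g⁻¹)) := by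
    rw [h1, map_mul, map_commutatorElement]
    exact (commute_map_commutator hφ g _ _).symm.mul_right (Commute.refl _)
  rw [SetLike.mem_coe, MonoidHom.mem_ker, map_mul, map_mul, map_mul, map_inv, map_inv, h2.eq]
  group

lemma map_commWord_eq_one
    (hφ : ∀ i j k, Commute ⁅φ (FreeGroup.of i), φ (FreeGroup.of j)⁆ (φ (FreeGroup.of k)))
    (z : Fin n) {u : List (Fin n)} (hu : 2 ≤ u.length) :
    φ (commWord FreeGroup.of z u) = 1 := by
  match u, hu with
  | a :: b :: u, _ =>
    rw [commWord, commWord, map_commutatorElement, map_commutatorElement,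
      commutatorElement_eq_one_iff_commute]
    exact (commute_map_commutator hφ _ _ _).symm

end ClassTwo

/-! ### Triviality of full commutators in class two -/

section FullCommutators

lemma map_eq_one_of_mk_mem_fullCommutators {G : Type} [Group G] {n : ℕ} (hn : 2 ≤ n)
    {φ : FreeGroup (Fin (n + 1)) →* G}
    (hφ : ∀ i j k, Commute ⁅φ (FreeGroup.of i), φ (FreeGroup.of j)⁆ (φ (FreeGroup.of k)))
    {w : FreeGroup (Fin (n + 1))} (hw : (w : ReducedFreeGroup (n + 1)) ∈ fullCommutators n) :
    φ w = 1 := by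
  let ψ : ReducedFreeGroup (n + 1) →* G :=
    QuotientGroup.lift (reducedFreeRel (n + 1)) φ (reducedFreeRel_le_ker hφ)
  have h : fullCommutators n ≤ ψ.ker := by
    rw [fullCommutators, Subgroup.closure_le]
    rintro _ ⟨u, rfl⟩
    simp only [SetLike.mem_coe, MonoidHom.mem_ker]
    rw [← mk_commWord]
    exact map_commWord_eq_one hφ _ (by rw [u.2.length_eq]; simpa using hn)
  exact h hw

end FullCommutators

/-! ### The Magnus expansion in the exterior algebra -/

section Exterior

lemma exists_ofFn_perm {m : ℕ} {v : List (Fin m)} (hv : v.Perm (List.finRange m)) :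
    ∃ σ : Equiv.Perm (Fin m), v = List.ofFn σ := by
  have hlen : v.length = m := by simpa using hv.length_eq
  have hnd : v.Nodup := hv.nodup_iff.2 (List.nodup_finRange m)
  have hinj : Function.Injective fun i : Fin m => v.get (i.cast hlen.symm) :=
    (List.nodup_iff_injective_get.1 hnd).comp (Fin.cast_injective _)
  refine ⟨Equiv.ofBijective _ (Finite.injective_iff_bijective.1 hinj), ?_⟩
  refine List.ext_get (by simpa using hlen) fun i h1 h2 => ?_
  simp

variable {m : ℕ}

/-- The generators of the exterior algebra. -/
def extGen (a : Fin m) : ExteriorAlgebra ℤ (Fin m → ℤ) := ExteriorAlgebra.ι ℤ (Pi.single a 1)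

lemma extGen_mul_self (a : Fin m) : extGen a * extGen a = 0 := ExteriorAlgebra.ι_sq_zero _

lemma extGen_mul_add (a b : Fin m) : extGen a * extGen b + extGen b * extGen a = 0 :=
  ExteriorAlgebra.ι_add_mul_swap _ _

/-- The unit `1 + e_a` of the exterior algebra. -/
def extUnit (a : Fin m) : (ExteriorAlgebra ℤ (Fin m → ℤ))ˣ where
  val := 1 + extGen a
  inv := 1 - extGen a
  val_inv := by
    linear_combination (norm := noncomm_ring) - extGen_mul_self a
  inv_val := by
    linear_combination (norm := noncomm_ring) - extGen_mul_self a

/-- The representation of the free group in the units of the exterior algebra. -/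
def extRep (m : ℕ) : FreeGroup (Fin m) →* (ExteriorAlgebra ℤ (Fin m → ℤ))ˣ :=
  FreeGroup.lift extUnit

/-- The correction term has even degree, hence is central; therefore the image of the free group has
class at most two. -/
lemma extUnit_commutator (a b : Fin m) :
    (⁅extUnit a, extUnit b⁆ : (ExteriorAlgebra ℤ (Fin m → ℤ))ˣ).1 =
      1 + 2 * (extGen a * extGen b) := by
  change (1 + extGen a) * (1 + extGen b) * (1 - extGen a) * (1 - extGen b) = _
  have ha := extGen_mul_self a
  have hb := extGen_mul_self b
  have hab := extGen_mul_add a b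
  linear_combination (norm := noncomm_ring) -hab - ha + ha * extGen b - hb + hab * extGen b -
    extGen a * hb - extGen a * hab + ha * extGen b - extGen a * hb + extGen a * hab * extGen b -
    ha * (extGen b * extGen b)

lemma extRep_commute (a b c : Fin m) :
    Commute ⁅extRep m (FreeGroup.of a), extRep m (FreeGroup.of b)⁆ (extRep m (FreeGroup.of c)) := by
  simp only [extRep, FreeGroup.lift_apply_of]
  refine Units.ext ?_
  rw [Units.val_mul, Units.val_mul, extUnit_commutator]
  change (1 + 2 * (extGen a * extGen b)) * (1 + extGen c) =
    (1 + extGen c) * (1 + 2 * (extGen a * extGen b))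
  linear_combination (norm := noncomm_ring) 2 * (extGen a * extGen_mul_add b c) -
    2 * (extGen_mul_add a c * extGen b)

/-- The image of the homogeneous part of degree `k` of a power series in the exterior algebra. -/
def extPart (k : ℕ) (f : List (Fin m) → ℤ) : ExteriorAlgebra ℤ (Fin m → ℤ) :=
  ∑ v : Fin k → Fin m, f (List.ofFn v) • ExteriorAlgebra.ιMulti ℤ k fun i => Pi.single (v i) 1

lemma extPart_zero (f : List (Fin m) → ℤ) : extPart 0 f = f [] • 1 := by
  rw [extPart, Fintype.sum_unique, List.ofFn_zero, ExteriorAlgebra.ιMulti_zero_apply]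

lemma extPart_add (k : ℕ) (f g : List (Fin m) → ℤ) :
    extPart k (f + g) = extPart k f + extPart k g := by
  simp only [extPart, Pi.add_apply, add_smul, Finset.sum_add_distrib]

lemma extPart_letterOp (k : ℕ) (a : Fin m) (f : List (Fin m) → ℤ) :
    extPart (k + 1) (letterOp ℤ a f) = extGen a * extPart k f := by
  rw [extPart, ← (Fin.consEquiv fun _ => Fin m).sum_comp, Fintype.sum_prod_type,
    Finset.sum_eq_single a]
  · rw [extPart, Finset.mul_sum]
    refine Finset.sum_congr rfl fun v _ => ?_
    have hl : List.ofFn (Fin.consEquiv (fun _ => Fin m) (a, v)) = a :: List.ofFn v := by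
      rw [List.ofFn_succ]
      rfl
    rw [mul_smul_comm, hl, letterOp_cons, if_pos rfl,
      ExteriorAlgebra.ιMulti_succ_apply]
    rfl
  · intro b _ hb
    refine Finset.sum_eq_zero fun v _ => ?_
    have hl : List.ofFn (Fin.consEquiv (fun _ => Fin m) (b, v)) = b :: List.ofFn v := by
      rw [List.ofFn_succ]
      rfl
    rw [hl, letterOp_cons, if_neg hb, zero_smul]
  · simp

lemma extPart_eq_zero {k : ℕ} (hk : m < k) (f : List (Fin m) → ℤ) : extPart k f = 0 := by
  refine Finset.sum_eq_zero fun v _ => ?_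
  have hv : ¬ Function.Injective v := fun h => by
    have := Fintype.card_le_of_injective v h
    simp only [Fintype.card_fin] at this
    omega
  rw [ExteriorAlgebra.ιMulti_eq_zero_of_not_inj, smul_zero]
  intro h
  exact hv (Function.Injective.of_comp (f := fun a : Fin m => (Pi.single a 1 : Fin m → ℤ)) h)

/-- The image of a power series in the exterior algebra. -/
def extSum (f : List (Fin m) → ℤ) : ExteriorAlgebra ℤ (Fin m → ℤ) :=
  ∑ k ∈ Finset.range (m + 1), extPart k f

lemma extSum_add (f g : List (Fin m) → ℤ) : extSum (f + g) = extSum f + extSum g := by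
  simp only [extSum, extPart_add, Finset.sum_add_distrib]

/-- The truncation at degree `m` loses nothing, since higher exterior powers vanish. -/
lemma extSum_letterOp (a : Fin m) (f : List (Fin m) → ℤ) :
    extSum (letterOp ℤ a f) = extGen a * extSum f := by
  have h1 : extGen a * extPart m f = 0 := by
    rw [← extPart_letterOp, extPart_eq_zero (Nat.lt_succ_self m)]
  rw [extSum, Finset.sum_range_succ', extPart_zero, letterOp_nil, zero_smul, add_zero, extSum,
    Finset.sum_range_succ, mul_add, h1, add_zero, Finset.mul_sum]
  exact Finset.sum_congr rfl fun k _ => extPart_letterOp k a f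

lemma extSum_magnusAct (w : FreeGroup (Fin m)) :
    ∀ f : List (Fin m) → ℤ, extSum (magnusAct w f) = (extRep m w).1 * extSum f := by
  induction w using FreeGroup.induction_on with
  | C1 =>
    intro f
    rw [magnusAct_one, map_one, Units.val_one, one_mul]
  | of a =>
    intro f
    rw [magnusAct_of, extSum_add, extSum_letterOp, extRep, FreeGroup.lift_apply_of]
    change _ = (1 + extGen a) * _
    rw [add_mul, one_mul]
  | inv_of a h =>
    intro f
    rw [map_inv, ← Units.inv_mul_eq_iff_eq_mul, inv_inv, ← h, magnusAct_self_inv]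
  | mul v w hv hw =>
    intro f
    rw [magnusAct_mul, hv, hw, map_mul, Units.val_mul, mul_assoc]

/-- The exterior algebra sees the Magnus expansion after imposing anticommutativity, so the
representation can be computed from Magnus coefficients. -/
lemma extSum_magnus (w : FreeGroup (Fin m)) : extSum (magnus ℤ w) = (extRep m w).1 := by
  rw [magnus, extSum_magnusAct, extSum, Finset.sum_range_succ', Finset.sum_eq_zero, zero_add,
    extPart_zero, unitSeries, one_smul, mul_one]
  intro k _
  refine Finset.sum_eq_zero fun v _ => ?_
  rw [List.ofFn_succ, unitSeries, zero_smul]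

/-- The coefficient of the product of all generators in an element of the exterior algebra. -/
def topCoeff (m : ℕ) : ExteriorAlgebra ℤ (Fin m → ℤ) →ₗ[ℤ] ℤ :=
  ExteriorAlgebra.liftAlternating (Function.update 0 m Matrix.detRowAlternating)

lemma topCoeff_extPart_of_ne {k : ℕ} (hk : k ≠ m) (f : List (Fin m) → ℤ) :
    topCoeff m (extPart k f) = 0 := by
  rw [extPart, map_sum]
  refine Finset.sum_eq_zero fun v _ => ?_
  rw [map_zsmul, topCoeff, ExteriorAlgebra.liftAlternating_apply_ιMulti, Function.update_of_ne hk]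
  exact smul_zero _

lemma topCoeff_extPart (f : List (Fin m) → ℤ) :
    topCoeff m (extPart m f) = ∑ σ : Equiv.Perm (Fin m), f (List.ofFn σ) * Equiv.Perm.sign σ := by
  rw [extPart, map_sum]
  symm
  refine Finset.sum_of_injOn (fun σ : Equiv.Perm (Fin m) => (σ : Fin m → Fin m))
    (fun σ _ τ _ h => Equiv.coe_fn_injective h) (fun _ _ => Finset.mem_coe.2 (Finset.mem_univ _))
    ?_ ?_
  · intro v _ hv
    rw [ExteriorAlgebra.ιMulti_eq_zero_of_not_inj, smul_zero, map_zero]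
    intro h
    have hinj : Function.Injective v :=
      Function.Injective.of_comp (f := fun a : Fin m => (Pi.single a 1 : Fin m → ℤ)) h
    exact hv ⟨Equiv.ofBijective v (Finite.injective_iff_bijective.1 hinj), by simp, rfl⟩
  · intro σ _
    rw [map_zsmul, topCoeff, ExteriorAlgebra.liftAlternating_apply_ιMulti, Function.update_self]
    have h := (Matrix.detRowAlternating (R := ℤ) (n := Fin m)).map_perm
      (fun a => Pi.single a 1) σ
    have h1 : (Matrix.detRowAlternating (R := ℤ) (n := Fin m)) (fun a => Pi.single a 1) = 1 := by
      refine Eq.trans (congrArg Matrix.det ?_) (Matrix.det_one (n := Fin m) (R := ℤ))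
      ext i j
      rw [Matrix.one_apply, Pi.single_apply]
      simp only [eq_comm]
    rw [h1] at h
    refine Eq.trans ?_ (congrArg (f (List.ofFn σ) • ·) h).symm
    rw [smul_eq_mul, Units.smul_def, smul_eq_mul, mul_one]

/-- A word whose faces are all trivial and which is trivial in the exterior algebra has trivial
coefficients. -/
lemma magnus_eq_zero_of_extRep {n : ℕ} {w : FreeGroup (Fin (n + 1))}
    (hw : ∀ i : Fin (n + 2), freeFace i w = 1) (h : extRep (n + 1) w = 1)
    (σ : Equiv.Perm (Fin (n + 1))) : magnus ℤ w (List.ofFn σ) = 0 := by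
  have h1 : topCoeff (n + 1) (extSum (magnus ℤ w)) = 0 := by
    have h0 : (1 : ExteriorAlgebra ℤ (Fin (n + 1) → ℤ)) = extPart 0 (fun _ => 1) := by
      rw [extPart_zero, one_smul]
    rw [extSum_magnus, h, Units.val_one, h0, topCoeff_extPart_of_ne (Nat.succ_ne_zero n).symm]
  rw [extSum, map_sum, Finset.sum_eq_single (n + 1)
    (fun k _ hk => topCoeff_extPart_of_ne hk _) (by simp), topCoeff_extPart] at h1
  have h2 : ∀ σ : Equiv.Perm (Fin (n + 1)),
      magnus ℤ w (List.ofFn σ) * Equiv.Perm.sign σ =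
        magnus ℤ w (List.ofFn (1 : Equiv.Perm (Fin (n + 1)))) := by
    intro σ
    rw [magnus_ofFn_perm hw, mul_right_comm, ← Units.val_mul, Int.units_mul_self, Units.val_one,
      one_mul]
  -- The sign of the coefficient cancels the sign of the determinant, so the sum is `(n + 1)!` times
  -- one integer, which must be zero.
  rw [Finset.sum_congr rfl fun σ _ => h2 σ, Finset.sum_const, smul_eq_zero] at h1
  rw [magnus_ofFn_perm hw, h1.resolve_left (by simp), mul_zero]

/-- The map from the cycles of `F[S¹]` to `K[S¹]` is trivial in degrees above two. -/
theorem mem_reducedFreeRel_of_freeFace {n : ℕ} (hn : 2 ≤ n) {w : FreeGroup (Fin (n + 1))}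
    (hw : ∀ i : Fin (n + 2), freeFace i w = 1) : w ∈ reducedFreeRel (n + 1) := by
  have hmem : (w : ReducedFreeGroup (n + 1)) ∈ reducedMoore n := mem_reducedMoore.2 fun i => by
    rw [reducedFace_mk, hw]
    rfl
  -- The class of `w` is a product of commutators in `n + 1 ≥ 3` letters, and those die in class
  -- two.
  have hext := map_eq_one_of_mk_mem_fullCommutators hn extRep_commute
    (reducedMoore_le_fullCommutators n hmem)
  have h : mooreCoeff n ⟨_, hmem⟩ = 1 := by
    refine congrArg Multiplicative.ofAdd (funext fun u => ?_)
    change reducedCoeff (Fin.last n) (w : ReducedFreeGroup (n + 1)) u.1 = 0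
    rw [reducedCoeff_mk _ _ u.nodup]
    obtain ⟨σ, hσ⟩ := exists_ofFn_perm (fullWord_iff.1 u.2)
    rw [hσ]
    exact magnus_eq_zero_of_extRep hw hext σ
  rw [← map_one (mooreCoeff n)] at h
  exact (QuotientGroup.eq_one_iff _).1 (Subtype.ext_iff.1 (mooreCoeff_injective n h))

end Exterior

end FreeToK

end

noncomputable section

namespace FreeToK

open scoped commutatorElement

/-! ### The homotopy of `ρ` -/

/-! ### Boundaries in the free groups and the relations in low degrees -/

section FreeBoundaries

variable {n : ℕ}

/-- The boundaries in the free groups. -/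
def freeBoundaries (n : ℕ) : Subgroup (FreeGroup (Fin n)) :=
  (⨅ i : Fin (n + 1), (freeFace i.succ).ker).map (freeFace 0)

lemma mem_freeBoundaries {w : FreeGroup (Fin n)} : w ∈ freeBoundaries n ↔
    ∃ y : FreeGroup (Fin (n + 1)), (∀ i : Fin (n + 1), freeFace i.succ y = 1) ∧
      freeFace 0 y = w := by
  simp only [freeBoundaries, Subgroup.mem_map, Subgroup.mem_iInf, MonoidHom.mem_ker]

lemma freeFace_zero_surjective (n : ℕ) : Function.Surjective (freeFace (n := n) 0) := by
  have h : (freeFace 0).comp (FreeGroup.map Fin.succ) = MonoidHom.id (FreeGroup (Fin n)) := by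
    refine FreeGroup.ext_hom _ _ fun a => ?_
    rw [MonoidHom.comp_apply, FreeGroup.map.of, letterHom_of, faceLetter, if_neg (by simp),
      dif_pos (by simp)]
    rfl
  exact fun w => ⟨_, DFunLike.congr_fun h w⟩

instance : (freeBoundaries n).Normal :=
  Subgroup.Normal.map (Subgroup.normal_iInf_normal fun _ => inferInstance) _
    (freeFace_zero_surjective n)

lemma faceLetter_two_values :
    faceLetter (n := 2) 0 0 = none ∧ faceLetter (n := 2) 0 1 = some 0 ∧
    faceLetter (n := 2) 0 2 = some 1 ∧ faceLetter (n := 2) 1 0 = some 0 ∧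
    faceLetter (n := 2) 1 1 = some 0 ∧ faceLetter (n := 2) 1 2 = some 1 ∧
    faceLetter (n := 2) 2 0 = some 0 ∧ faceLetter (n := 2) 2 1 = some 1 ∧
    faceLetter (n := 2) 2 2 = some 1 ∧ faceLetter (n := 2) 3 0 = some 0 ∧
    faceLetter (n := 2) 3 1 = some 1 ∧ faceLetter (n := 2) 3 2 = none := by
  decide

/-- In the chosen chain `d₁` kills the entry `x₀⁻¹ x₁`, `d₂` kills the inner commutator by merging
its letters, and `d₃` deletes `x₂`. -/
lemma commutator_mem_freeBoundaries_left :
    ⁅⁅FreeGroup.of (0 : Fin 2), FreeGroup.of (1 : Fin 2)⁆, FreeGroup.of (0 : Fin 2)⁆ ∈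
      freeBoundaries 2 := by
  obtain ⟨h00, h01, h02, h10, h11, h12, h20, h21, h22, h30, h31, h32⟩ := faceLetter_two_values
  refine mem_freeBoundaries.2 ⟨⁅⁅FreeGroup.of (1 : Fin 3), FreeGroup.of (2 : Fin 3)⁆,
    (FreeGroup.of (0 : Fin 3))⁻¹ * FreeGroup.of (1 : Fin 3)⁆, fun i => ?_, ?_⟩
  · match i with
    | 0 => simp [map_commutatorElement, letterHom_of, optGen, h10, h11, h12]
    | 1 => simp [map_commutatorElement, letterHom_of, optGen, h20, h21, h22]
    | 2 => simp [map_commutatorElement, letterHom_of, optGen, h30, h31, h32]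
  · simp [map_commutatorElement, letterHom_of, optGen, h00, h01, h02]

/-- Here `d₁` kills `x₀⁻¹ x₁`, `d₂` kills `x₁⁻¹ x₂`, and `d₃` deletes `x₂`. -/
lemma commutator_mem_freeBoundaries_right :
    ⁅⁅FreeGroup.of (0 : Fin 2), FreeGroup.of (1 : Fin 2)⁆,
      (FreeGroup.of (0 : Fin 2))⁻¹ * FreeGroup.of (1 : Fin 2)⁆ ∈ freeBoundaries 2 := by
  obtain ⟨h00, h01, h02, h10, h11, h12, h20, h21, h22, h30, h31, h32⟩ := faceLetter_two_values
  refine mem_freeBoundaries.2 ⟨⁅⁅(FreeGroup.of (0 : Fin 3))⁻¹ * FreeGroup.of (1 : Fin 3),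
    FreeGroup.of (2 : Fin 3)⁆,
    (FreeGroup.of (1 : Fin 3))⁻¹ * FreeGroup.of (2 : Fin 3)⁆, fun i => ?_, ?_⟩
  · match i with
    | 0 => simp [map_commutatorElement, letterHom_of, optGen, h10, h11, h12]
    | 1 => simp [map_commutatorElement, letterHom_of, optGen, h20, h21, h22]
    | 2 => simp [map_commutatorElement, letterHom_of, optGen, h30, h31, h32]
  · simp [map_commutatorElement, letterHom_of, optGen, h00, h01, h02]

/-- By the two explicit boundaries the quotient of `F_2` by boundaries has class two, and class two
forces the reduced relations. -/
lemma reducedFreeRel_two_le : reducedFreeRel 2 ≤ freeBoundaries 2 := by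
  let φ := QuotientGroup.mk' (freeBoundaries 2)
  have hker : ∀ a b : FreeGroup (Fin 2), ⁅a, b⁆ ∈ freeBoundaries 2 → Commute (φ a) (φ b) := by
    intro a b h
    rw [← commutatorElement_eq_one_iff_commute, ← map_commutatorElement]
    exact (QuotientGroup.eq_one_iff _).2 h
  have h0 : Commute ⁅φ (FreeGroup.of 0), φ (FreeGroup.of 1)⁆ (φ (FreeGroup.of 0)) := by
    rw [← map_commutatorElement]
    exact hker _ _ commutator_mem_freeBoundaries_left
  have h1 : Commute ⁅φ (FreeGroup.of 0), φ (FreeGroup.of 1)⁆ (φ (FreeGroup.of 1)) := by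
    have h := hker _ _ commutator_mem_freeBoundaries_right
    rw [map_commutatorElement, map_mul, map_inv] at h
    simpa using h0.mul_right h
  have hk : ∀ k, Commute ⁅φ (FreeGroup.of 0), φ (FreeGroup.of 1)⁆ (φ (FreeGroup.of k)) := by
    intro k
    match k with
    | 0 => exact h0
    | 1 => exact h1
  have hφ : ∀ i j k, Commute ⁅φ (FreeGroup.of i), φ (FreeGroup.of j)⁆ (φ (FreeGroup.of k)) := by
    intro i j k
    match i, j with
    | 0, 0 => rw [commutatorElement_self]; exact Commute.one_left _
    | 0, 1 => exact hk k
    | 1, 0 => rw [← commutatorElement_inv]; exact (hk k).inv_left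
    | 1, 1 => rw [commutatorElement_self]; exact Commute.one_left _
  have h := reducedFreeRel_le_ker hφ
  rwa [QuotientGroup.ker_mk'] at h

lemma reducedFreeRel_one : reducedFreeRel 1 = ⊥ := by
  have h := reducedFreeRel_le_ker (φ := MonoidHom.id (FreeGroup (Fin 1))) fun i j k => by
    rw [Subsingleton.elim i j, commutatorElement_self]
    exact Commute.one_left _
  rw [eq_bot_iff]
  exact h

/-- The free cycles map onto the cycles of the reduced free group if the iterated commutators
are cycles. -/
lemma exists_freeFace_of_commWord
    (h : ∀ u : FullWord n, ∀ i, freeFace i (commWord FreeGroup.of (Fin.last n) u.1) = 1)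
    {x : ReducedFreeGroup (n + 1)} (hx : x ∈ reducedCycles n) :
    ∃ w : FreeGroup (Fin (n + 1)), (w : ReducedFreeGroup (n + 1)) = x ∧
      ∀ i, freeFace i w = 1 := by
  have hle : fullCommutators n ≤
      (⨅ i : Fin (n + 2), (freeFace i).ker).map (QuotientGroup.mk' (reducedFreeRel (n + 1))) := by
    rw [fullCommutators, Subgroup.closure_le]
    rintro _ ⟨u, rfl⟩
    refine ⟨commWord FreeGroup.of (Fin.last n) u.1, ?_, mk_commWord _ _⟩
    simpa only [SetLike.mem_coe, Subgroup.mem_iInf, MonoidHom.mem_ker] using h u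
  obtain ⟨w, hw, rfl⟩ := hle (reducedMoore_le_fullCommutators n (reducedCycles_le hx))
  refine ⟨w, rfl, ?_⟩
  simpa only [SetLike.mem_coe, Subgroup.mem_iInf, MonoidHom.mem_ker] using hw

lemma freeFace_commWord_zero (u : FullWord 0) (i : Fin 2) :
    freeFace i (commWord FreeGroup.of (Fin.last 0) u.1) = 1 := Subsingleton.elim _ _

lemma freeFace_commWord_one (u : FullWord 1) (i : Fin 3) :
    freeFace i (commWord FreeGroup.of (Fin.last 1) u.1) = 1 := by
  obtain ⟨u, hu⟩ := u
  obtain rfl : u = [0] := by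
    have h : (List.finRange 1).map Fin.castSucc = [(0 : Fin 2)] := rfl
    rwa [h, List.perm_singleton] at hu
  have h : faceLetter (n := 1) 0 0 = none ∧ faceLetter (n := 1) 0 1 = some 0 ∧
      faceLetter (n := 1) 1 0 = some 0 ∧ faceLetter (n := 1) 1 1 = some 0 ∧
      faceLetter (n := 1) 2 0 = some 0 ∧ faceLetter (n := 1) 2 1 = none := by decide
  obtain ⟨h00, h01, h10, h11, h20, h21⟩ := h
  change freeFace i ⁅FreeGroup.of 0, FreeGroup.of 1⁆ = 1
  match i with
  | 0 => simp [map_commutatorElement, letterHom_of, optGen, h00, h01]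
  | 1 => simp [map_commutatorElement, letterHom_of, optGen, h10, h11]
  | 2 => simp [map_commutatorElement, letterHom_of, optGen, h20, h21]

end FreeBoundaries

section HomotopyOfRho

variable {n : ℕ}

lemma freeEquiv_mem_cycles {w : FreeGroup (Fin (n + 1))} :
    freeEquiv (n + 1) w ∈ cycles FS1 (n + 1) ↔ ∀ i, freeFace i w = 1 := by
  rw [mem_cycles_succ]
  exact forall_congr' fun i => faceHom_freeEquiv_eq_one i w

lemma freeEquiv_mem_boundaries {w : FreeGroup (Fin n)} (hw : w ∈ freeBoundaries n) :
    freeEquiv n w ∈ boundaries FS1 n := by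
  obtain ⟨y, hy, rfl⟩ := mem_freeBoundaries.1 hw
  exact mem_boundaries.2 ⟨freeEquiv (n + 1) y,
    fun i => (faceHom_freeEquiv_eq_one i.succ y).2 (hy i), faceHom_freeEquiv 0 y⟩

lemma homotopyMap_mk {G H : SimplicialObject GrpCat.{0}} (f : G ⟶ H) (x : cycles G n) :
    homotopyMap f n (QuotientGroup.mk x) = QuotientGroup.mk (cyclesMap f n x) := rfl

/-- Since `K[S¹]` has no nontrivial boundaries, a class in the kernel is represented by a cycle
lying in the relations. -/
lemma homotopyMap_rho_injective (h : reducedFreeRel n ≤ freeBoundaries n) :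
    Function.Injective (homotopyMap rho n) := by
  refine (injective_iff_map_eq_one _).2 fun x hx => ?_
  obtain ⟨x, rfl⟩ := QuotientGroup.mk_surjective x
  rw [homotopyMap_mk, homotopyMk_eq_one, boundaries_reduced, Subgroup.mem_bot] at hx
  rw [homotopyMk_eq_one]
  obtain ⟨w, hw⟩ := (freeEquiv n).surjective x.1
  rw [← hw]
  refine freeEquiv_mem_boundaries (h (rho_freeEquiv_eq_one.1 ?_))
  rw [hw]
  exact hx

lemma homotopyMap_rho_surjective
    (h : ∀ u : FullWord n, ∀ i, freeFace i (commWord FreeGroup.of (Fin.last n) u.1) = 1) :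
    Function.Surjective (homotopyMap rho (n + 1)) := by
  intro x
  obtain ⟨⟨x, hx⟩, rfl⟩ := QuotientGroup.mk_surjective x
  have hx' := hx
  rw [cycles_reduced] at hx'
  obtain ⟨k, hk, rfl⟩ := hx'
  obtain ⟨w, rfl, hw⟩ := exists_freeFace_of_commWord h hk
  exact ⟨QuotientGroup.mk ⟨freeEquiv (n + 1) w, freeEquiv_mem_cycles.2 hw⟩, rfl⟩

theorem homotopyMap_rho_one_bijective : Function.Bijective (homotopyMap rho 1) :=
  ⟨homotopyMap_rho_injective (by rw [reducedFreeRel_one]; exact bot_le),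
    homotopyMap_rho_surjective freeFace_commWord_zero⟩

theorem homotopyMap_rho_two_bijective : Function.Bijective (homotopyMap rho 2) :=
  ⟨homotopyMap_rho_injective reducedFreeRel_two_le,
    homotopyMap_rho_surjective freeFace_commWord_one⟩

lemma rho_eq_one_of_mem_cycles (hn : 2 < n) {x : FS1 _⦋n⦌} (hx : x ∈ cycles FS1 n) :
    appHom rho n x = 1 := by
  obtain ⟨m, rfl⟩ : ∃ m, n = m + 1 := ⟨n - 1, by omega⟩
  obtain ⟨w, rfl⟩ := (freeEquiv (m + 1)).surjective x
  exact rho_freeEquiv_eq_one.2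
    (mem_reducedFreeRel_of_freeFace (by omega) (freeEquiv_mem_cycles.1 hx))

theorem homotopyMap_rho_eq_one (hn : 2 < n) (x : HomotopyGroup FS1 n) :
    homotopyMap rho n x = 1 := by
  obtain ⟨x, rfl⟩ := QuotientGroup.mk_surjective x
  rw [homotopyMap_mk, homotopyMk_eq_one, boundaries_reduced, Subgroup.mem_bot]
  exact rho_eq_one_of_mem_cycles hn x.2

end HomotopyOfRho

/-! ### The homotopy of the kernel -/

section Connecting

variable {G H : SimplicialObject GrpCat.{0}} {f : G ⟶ H} {n : ℕ}

lemma kernelι_injective (f : G ⟶ H) (n : ℕ) : Function.Injective (appHom (kernelι f) n) :=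
  Subtype.val_injective

lemma appHom_kernelι (f : G ⟶ H) (n : ℕ) (x : kernel f _⦋n⦌) :
    appHom f n (appHom (kernelι f) n x) = 1 := x.2

lemma exists_kernelι {x : G _⦋n⦌} (hx : appHom f n x = 1) : ∃ y, appHom (kernelι f) n y = x :=
  ⟨⟨x, hx⟩, rfl⟩

lemma kernelι_mem_cycles {x : kernel f _⦋n⦌} :
    appHom (kernelι f) n x ∈ cycles G n ↔ x ∈ cycles (kernel f) n := by
  refine ⟨fun hx => ?_, fun hx => cycles_le_comap (kernelι f) n hx⟩
  cases n with
  | zero => exact Subgroup.mem_top _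
  | succ n =>
    rw [mem_cycles_succ] at hx ⊢
    intro i
    refine kernelι_injective f n ?_
    rw [appHom_faceHom, hx i, map_one]

lemma mem_boundaries_kernel {x : kernel f _⦋n⦌} : x ∈ boundaries (kernel f) n ↔
    ∃ g : G _⦋n + 1⦌, (∀ i : Fin (n + 1), faceHom G i.succ g = 1) ∧ appHom f (n + 1) g = 1 ∧
      faceHom G 0 g = appHom (kernelι f) n x := by
  rw [mem_boundaries]
  constructor
  · rintro ⟨y, hy, rfl⟩
    refine ⟨appHom (kernelι f) (n + 1) y, fun i => ?_, appHom_kernelι f _ y, ?_⟩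
    · rw [← appHom_faceHom, hy i, map_one]
    · rw [appHom_faceHom]
  · rintro ⟨g, hg, hfg, hx⟩
    obtain ⟨y, rfl⟩ := exists_kernelι hfg
    refine ⟨y, fun i => kernelι_injective f n ?_, kernelι_injective f n ?_⟩
    · rw [appHom_faceHom, hg i, map_one]
    · rw [appHom_faceHom, hx]

lemma faceHom_zero_mem_cycles {g : G _⦋n + 1⦌}
    (hg : ∀ i : Fin (n + 1), faceHom G i.succ g = 1) : faceHom G 0 g ∈ cycles G n := by
  cases n with
  | zero => exact Subgroup.mem_top _
  | succ n =>
    rw [mem_cycles_succ]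
    intro i
    have h := faceHom_faceHom G (Fin.zero_le i) g
    rw [hg i, map_one] at h
    exact h.symm

variable (f n) in
/-- The elements of the Moore complex of `G` which map to cycles of `H`. -/
def relativeCycles : Subgroup (G _⦋n + 1⦌) :=
  (⨅ i : Fin (n + 1), (faceHom G i.succ).ker) ⊓ (cycles H (n + 1)).comap (appHom f (n + 1))

lemma mem_relativeCycles {g : G _⦋n + 1⦌} : g ∈ relativeCycles f n ↔
    (∀ i : Fin (n + 1), faceHom G i.succ g = 1) ∧ appHom f (n + 1) g ∈ cycles H (n + 1) := by
  simp only [relativeCycles, Subgroup.mem_inf, Subgroup.mem_iInf, MonoidHom.mem_ker,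
    Subgroup.mem_comap]

lemma appHom_faceHom_zero {g : G _⦋n + 1⦌} (hg : g ∈ relativeCycles f n) :
    appHom f n (faceHom G 0 g) = 1 := by
  rw [appHom_faceHom]
  exact mem_cycles_succ.1 (mem_relativeCycles.1 hg).2 0

variable (f n) in
/-- The boundary of a relative cycle. -/
def relativeBoundary : relativeCycles f n →* cycles (kernel f) n where
  toFun g := ⟨⟨faceHom G 0 g.1, appHom_faceHom_zero g.2⟩,
    kernelι_mem_cycles.1 (faceHom_zero_mem_cycles (mem_relativeCycles.1 g.2).1)⟩
  map_one' := Subtype.ext (Subtype.ext (map_one _))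
  map_mul' g h := Subtype.ext (Subtype.ext (map_mul _ g.1 h.1))

lemma kernelι_relativeBoundary (g : relativeCycles f n) :
    appHom (kernelι f) n (relativeBoundary f n g).1 = faceHom G 0 g.1 := rfl

variable (f n) in
/-- The image in `H` of a relative cycle. -/
def relativeImage : relativeCycles f n →* cycles H (n + 1) :=
  ((appHom f (n + 1)).comp (relativeCycles f n).subtype).codRestrict _
    fun g => (mem_relativeCycles.1 g.2).2

lemma relativeImage_surjective (hf : ∀ n, Function.Surjective (appHom f n)) :
    Function.Surjective (relativeImage f n) := by
  rintro ⟨z, hz⟩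
  obtain ⟨g, rfl, hg⟩ := exists_moore_lift hf z fun i => mem_cycles_succ.1 hz i.succ
  exact ⟨⟨g, mem_relativeCycles.2 ⟨hg, hz⟩⟩, rfl⟩

/-- The connecting homomorphism of a surjection of simplicial groups. -/
theorem exists_connecting (hf : ∀ n, Function.Surjective (appHom f n)) :
    ∃ δ : cycles H (n + 1) →* HomotopyGroup (kernel f) n,
      ∀ g : relativeCycles f n, δ (relativeImage f n g) =
        QuotientGroup.mk (relativeBoundary f n g) := by
  let π : relativeCycles f n →* HomotopyGroup (kernel f) n :=
    (QuotientGroup.mk' _).comp (relativeBoundary f n)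
  have hπ : (relativeImage f n).ker ≤ π.ker := by
    intro g hg
    -- A relative cycle with trivial image is a Moore chain of the kernel, so its zeroth face is a
    -- boundary there.
    refine homotopyMk_eq_one.2 (mem_boundaries_kernel.2
      ⟨g.1, (mem_relativeCycles.1 g.2).1, ?_, (kernelι_relativeBoundary g).symm⟩)
    exact Subtype.ext_iff.1 (MonoidHom.mem_ker.1 hg)
  refine ⟨(relativeImage f n).liftOfSurjective (relativeImage_surjective hf) ⟨π, hπ⟩, fun g => ?_⟩
  exact MonoidHom.liftOfRightInverse_comp_apply _ _ _ ⟨π, hπ⟩ g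

/-- The short exact sequence of the homotopy of a kernel, if cycles map trivially. -/
theorem exists_exact_of_cycles (hf : ∀ n, Function.Surjective (appHom f n))
    (h0 : ∀ x ∈ cycles G n, appHom f n x = 1)
    (h1 : ∀ x ∈ cycles G (n + 1), appHom f (n + 1) x = 1) :
    ∃ δ : cycles H (n + 1) →* HomotopyGroup (kernel f) n, Function.Injective δ ∧
      δ.range = (homotopyMap (kernelι f) n).ker ∧
      Function.Surjective (homotopyMap (kernelι f) n) := by
  obtain ⟨δ, hδ⟩ := exists_connecting (n := n) hf
  refine ⟨δ, (injective_iff_map_eq_one δ).2 fun z hz => ?_, le_antisymm ?_ fun x hx => ?_, ?_⟩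
  · obtain ⟨g, rfl⟩ := relativeImage_surjective hf z
    rw [hδ, homotopyMk_eq_one, mem_boundaries_kernel] at hz
    obtain ⟨y, hy, hfy, hgy⟩ := hz
    rw [kernelι_relativeBoundary] at hgy
    have hc : g.1 * y⁻¹ ∈ cycles G (n + 1) := by
      rw [mem_cycles_succ]
      intro i
      rw [map_mul, map_inv]
      refine Fin.cases ?_ (fun i => ?_) i
      · rw [hgy, mul_inv_cancel]
      · rw [hy, (mem_relativeCycles.1 g.2).1 i, inv_one, mul_one]
    have h := h1 _ hc
    rw [map_mul, map_inv, hfy, inv_one, mul_one] at h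
    exact Subtype.ext h
  · rintro _ ⟨z, rfl⟩
    obtain ⟨g, rfl⟩ := relativeImage_surjective hf z
    rw [hδ, MonoidHom.mem_ker, homotopyMap_mk, homotopyMk_eq_one, mem_boundaries]
    exact ⟨g.1, (mem_relativeCycles.1 g.2).1, (kernelι_relativeBoundary g).symm⟩
  · obtain ⟨x, rfl⟩ := QuotientGroup.mk_surjective x
    rw [MonoidHom.mem_ker, homotopyMap_mk, homotopyMk_eq_one, mem_boundaries] at hx
    obtain ⟨g, hg, hgx⟩ := hx
    replace hgx : faceHom G 0 g = appHom (kernelι f) n x.1 := hgx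
    have hmem : g ∈ relativeCycles f n := by
      refine mem_relativeCycles.2 ⟨hg, mem_cycles_succ.2 fun i => ?_⟩
      rw [← appHom_faceHom]
      refine Fin.cases ?_ (fun i => ?_) i
      · rw [hgx, appHom_kernelι]
      · rw [hg, map_one]
    refine ⟨relativeImage f n ⟨g, hmem⟩, ?_⟩
    rw [hδ]
    exact congrArg _ (Subtype.ext (kernelι_injective f n hgx))
  · intro x
    obtain ⟨x, rfl⟩ := QuotientGroup.mk_surjective x
    -- Surjectivity holds on cycles: a cycle which `f` kills already lies in the kernel.
    obtain ⟨y, hy⟩ := exists_kernelι (h0 x.1 x.2)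
    have hyc : y ∈ cycles (kernel f) n := kernelι_mem_cycles.1 (by rw [hy]; exact x.2)
    refine ⟨QuotientGroup.mk ⟨y, hyc⟩, ?_⟩
    rw [homotopyMap_mk]
    exact congrArg _ (Subtype.ext hy)

end Connecting

end FreeToK

end

noncomputable section

namespace FreeToK

/-! ### The multilinear part of the free Lie ring -/

section LeftNormed

variable {α L : Type} [LieRing L] (x : α → L)

/-- The left-normed bracket `[…[[y, x_{u₁}], x_{u₂}], …, x_{u_k}]`. -/
def bracketFold (y : L) (u : List α) : L := u.foldl (fun y a => ⁅y, x a⁆) y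

lemma bracketFold_cons (y : L) (a : α) (u : List α) :
    bracketFold x y (a :: u) = bracketFold x ⁅y, x a⁆ u := rfl

lemma bracketFold_append (y : L) (u v : List α) :
    bracketFold x y (u ++ v) = bracketFold x (bracketFold x y u) v := List.foldl_append

lemma bracketFold_concat (y : L) (u : List α) (a : α) :
    bracketFold x y (u ++ [a]) = ⁅bracketFold x y u, x a⁆ := bracketFold_append x y u [a]

lemma leftNormed_map_cons (a : α) (u : List α) :
    leftNormed ((a :: u).map x) = bracketFold x (x a) u := by
  rw [List.map_cons, leftNormed, List.foldl_map]
  rfl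

/-- The left-normed bracket, as an additive function of its first entry. -/
def bracketFoldHom (u : List α) : L →+ L where
  toFun y := bracketFold x y u
  map_zero' := by
    induction u with
    | nil => rfl
    | cons a u ih => rw [bracketFold_cons, zero_lie, ih]
  map_add' y z := by
    induction u generalizing y z with
    | nil => rfl
    | cons a u ih => rw [bracketFold_cons, add_lie, ih]; rfl

/-- The additive span of the left-normed brackets which begin with `y` and go on with the letters
of `u` in any order. -/
def bracketSpan (y : L) (u : List α) : AddSubgroup L :=
  AddSubgroup.closure {z | ∃ v : List α, v.Perm u ∧ bracketFold x y v = z}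

variable {x}

lemma bracketFold_mem_bracketSpan {y : L} {u v : List α} (h : v.Perm u) :
    bracketFold x y v ∈ bracketSpan x y u := AddSubgroup.subset_closure ⟨v, h, rfl⟩

lemma map_bracketFoldHom_mem {y z : L} {u : List α} (hz : z ∈ bracketSpan x y u) (v : List α) :
    bracketFold x z v ∈ bracketSpan x y (u ++ v) := by
  have h : bracketSpan x y u ≤ (bracketSpan x y (u ++ v)).comap (bracketFoldHom x v) := by
    rw [bracketSpan, AddSubgroup.closure_le]
    rintro _ ⟨t, ht, rfl⟩
    have h1 := bracketFold_mem_bracketSpan (x := x) (y := y) (ht.append_right v)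
    rwa [bracketFold_append] at h1
  exact h hz

/-- The Jacobi identity moves the last letter of the inner bracket outwards, either to the end or
next to `y`. -/
lemma lie_bracketFold_mem (b : α) (u : List α) (y : L) :
    ⁅y, bracketFold x (x b) u⁆ ∈ bracketSpan x y (b :: u) := by
  induction u using List.reverseRecOn generalizing y with
  | nil => exact bracketFold_mem_bracketSpan (u := [b]) (v := [b]) (List.Perm.refl _)
  | append_singleton u a ih =>
    have h1 : bracketFold x ⁅y, bracketFold x (x b) u⁆ [a] ∈ bracketSpan x y (b :: u ++ [a]) :=
      map_bracketFoldHom_mem (ih y) [a]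
    have h2 : bracketSpan x ⁅y, x a⁆ (b :: u) ≤ bracketSpan x y (b :: u ++ [a]) := by
      rw [bracketSpan, AddSubgroup.closure_le]
      rintro _ ⟨t, ht, rfl⟩
      rw [← bracketFold_cons]
      exact bracketFold_mem_bracketSpan ((ht.cons a).trans (List.perm_append_singleton a _).symm)
    have h3 : ⁅y, bracketFold x (x b) (u ++ [a])⁆ =
        bracketFold x ⁅y, bracketFold x (x b) u⁆ [a] - ⁅⁅y, x a⁆, bracketFold x (x b) u⁆ := by
      rw [bracketFold_concat, leibniz_lie, ← lie_skew _ ⁅y, x a⁆, sub_eq_add_neg]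
      rfl
    rw [h3]
    exact AddSubgroup.sub_mem _ h1 (h2 (ih _))

/-- Antisymmetry brings `a` to the front of the bracket which precedes it, and the Jacobi identity
rewrites the rest. -/
lemma leftNormed_mem_bracketSpan (a : α) (u v : List α) :
    leftNormed ((u ++ a :: v).map x) ∈ bracketSpan x (x a) (u ++ v) := by
  match u with
  | [] =>
    refine (leftNormed_map_cons x a v).symm ▸ ?_
    exact bracketFold_mem_bracketSpan (List.Perm.refl _)
  | b :: u =>
    have h1 : leftNormed ((b :: u ++ a :: v).map x) =
        bracketFold x (-⁅x a, bracketFold x (x b) u⁆) v := by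
      rw [List.cons_append, leftNormed_map_cons, bracketFold_append, bracketFold_cons, ← lie_skew]
    rw [h1]
    exact map_bracketFoldHom_mem (AddSubgroup.neg_mem _ (lie_bracketFold_mem b u (x a))) v

end LeftNormed

/-! ### Independence of left-normed brackets with a fixed first letter -/

section Independence

attribute [local instance] LieRing.ofAssociativeRing

variable {α : Type} [DecidableEq α] (R : Type) [CommRing R]

/-- The action of the free Lie algebra on noncommutative power series. -/
def seriesRep : FreeLieAlgebra R α →ₗ⁅R⁆ Module.End R (List α → R) :=
  FreeLieAlgebra.lift R (letterOp R)

lemma seriesRep_of (a : α) : seriesRep R (FreeLieAlgebra.of R a) = letterOp R a :=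
  FreeLieAlgebra.lift_of_apply _ _

/-- In `y a - a y` the second term contributes nothing at words beginning with `z`, because `a`
differs from `z`. Only the monomial `z u` remains. -/
lemma seriesRep_bracketFold {z : α} {u : List α} (hu : z ∉ u) (f : List α → R) (t : List α) :
    seriesRep R (bracketFold (FreeLieAlgebra.of R) (FreeLieAlgebra.of R z) u) f (z :: t) =
      u.foldr (fun a g => letterOp R a g) f t := by
  induction u using List.reverseRecOn generalizing f with
  | nil =>
    change seriesRep R (FreeLieAlgebra.of R z) f (z :: t) = f t
    rw [seriesRep_of, letterOp_cons, if_pos rfl]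
  | append_singleton u a ih =>
    simp only [List.mem_append, List.mem_singleton, not_or] at hu
    rw [bracketFold_concat, LieHom.map_lie, Ring.lie_def, seriesRep_of, LinearMap.sub_apply,
      Pi.sub_apply, Module.End.mul_apply, Module.End.mul_apply, letterOp_cons, if_neg hu.2,
      sub_zero, ih hu.1, List.foldr_append]
    rfl

lemma foldr_letterOp_unitSeries (u t : List α) :
    u.foldr (fun a g => letterOp R a g) (unitSeries α R) t = if t = u then 1 else 0 := by
  induction u generalizing t with
  | nil => cases t <;> simp [unitSeries]
  | cons a u ih =>
    rw [List.foldr_cons]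
    cases t with
    | nil => rw [letterOp_nil, if_neg (by simp)]
    | cons b t =>
      rw [letterOp_cons, ih]
      simp only [List.cons.injEq]
      split_ifs <;> simp_all

/-- The coefficients of an element of the free Lie algebra at the words which begin with `z`. -/
def firstCoeff (z : α) (J : Set (List α)) : FreeLieAlgebra R α →ₗ[R] (J → R) where
  toFun y u := seriesRep R y (unitSeries α R) (z :: u.1)
  map_add' y y' := by
    funext u
    rw [map_add]
    rfl
  map_smul' r y := by
    funext u
    rw [map_smul]
    rfl

lemma linearIndependent_bracketFold (z : α) (J : Set (List α)) (hJ : ∀ u ∈ J, z ∉ u) :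
    LinearIndependent R fun u : J =>
      bracketFold (FreeLieAlgebra.of R) (FreeLieAlgebra.of R z) u.1 := by
  refine LinearIndependent.of_comp (firstCoeff R z J) ?_
  have h : (firstCoeff R z J ∘ fun u : J =>
      bracketFold (FreeLieAlgebra.of R) (FreeLieAlgebra.of R z) u.1) =
      fun u => Pi.single u 1 := by
    funext u v
    change seriesRep R _ (unitSeries α R) (z :: v.1) = _
    rw [seriesRep_bracketFold R (hJ u.1 u.2), foldr_letterOp_unitSeries, Pi.single_apply]
    simp only [Subtype.ext_iff]
  rw [h]
  exact Pi.linearIndependent_single_one J R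

end Independence

/-! ### A basis of the multilinear part -/

section LieMultilinear

lemma perm_finRange_of_perm {m : ℕ} {u v : List (Fin (m + 1))}
    (h : (u ++ 0 :: v).Perm (List.finRange (m + 1))) :
    (u ++ v).Perm ((List.finRange m).map Fin.succ) := by
  rw [List.finRange_succ] at h
  exact (List.perm_cons 0).1 (List.perm_middle.symm.trans h)

/-- The words in all letters but the first one, each of which occurs once. -/
def tailWords (m : ℕ) : Set (List (Fin (m + 1))) :=
  Set.ofPred fun u => u.Perm ((List.finRange m).map Fin.succ)

lemma zero_notMem_of_mem_tailWords {m : ℕ} {u : List (Fin (m + 1))} (hu : u ∈ tailWords m) :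
    0 ∉ u := by
  intro h
  have h1 : u.Perm ((List.finRange m).map Fin.succ) := hu
  simp [h1.mem_iff] at h

lemma lieMultilinear_eq (m : ℕ) : LieMultilinear (m + 1) =
    Submodule.span ℤ (Set.range fun u : tailWords m =>
      bracketFold (FreeLieAlgebra.of ℤ) (FreeLieAlgebra.of ℤ 0) u.1) := by
  apply le_antisymm
  · rw [LieMultilinear, Submodule.span_le]
    rintro _ ⟨σ, rfl⟩
    have hσ : (List.ofFn σ).Perm (List.finRange (m + 1)) := by
      refine (List.perm_ext_iff_of_nodup (List.nodup_ofFn.2 σ.injective)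
        (List.nodup_finRange _)).2 fun a => ?_
      simp only [List.mem_finRange, iff_true, List.mem_ofFn]
      exact σ.surjective a
    obtain ⟨u, v, huv⟩ := List.append_of_mem (hσ.mem_iff.2 (List.mem_finRange 0))
    have h := leftNormed_mem_bracketSpan (x := FreeLieAlgebra.of ℤ) 0 u v
    rw [← huv, List.map_ofFn] at h
    rw [huv] at hσ
    have hle : bracketSpan (FreeLieAlgebra.of ℤ) (FreeLieAlgebra.of ℤ 0) (u ++ v) ≤
        (Submodule.span ℤ (Set.range fun u : tailWords m =>
          bracketFold (FreeLieAlgebra.of ℤ) (FreeLieAlgebra.of ℤ 0) u.1)).toAddSubgroup := by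
      rw [bracketSpan, AddSubgroup.closure_le]
      rintro _ ⟨t, ht, rfl⟩
      exact Submodule.subset_span ⟨⟨t, ht.trans (perm_finRange_of_perm hσ)⟩, rfl⟩
    exact hle h
  · rw [Submodule.span_le]
    rintro _ ⟨⟨u, hu⟩, rfl⟩
    have h : (0 :: u).Perm (List.finRange (m + 1)) := by
      rw [List.finRange_succ]
      exact List.Perm.cons 0 hu
    obtain ⟨σ, hσ⟩ := exists_ofFn_perm h
    refine Submodule.subset_span ⟨σ, ?_⟩
    change leftNormed (List.ofFn (FreeLieAlgebra.of ℤ ∘ σ)) = _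
    rw [← List.map_ofFn, ← hσ, leftNormed_map_cons]

theorem lieMultilinear_equiv (m : ℕ) :
    Nonempty (LieMultilinear (m + 1) ≃+ (Fin m.factorial → ℤ)) := by
  have hlen : ((List.finRange m).map Fin.succ).length.factorial = m.factorial := by simp
  let e : tailWords m ≃ Fin m.factorial := (permListEquiv
    ((List.nodup_finRange m).map (Fin.succ_injective m))).trans (finCongr hlen)
  have : Fintype (tailWords m) := Fintype.ofEquiv _ e.symm
  let b := Module.Basis.span
    (linearIndependent_bracketFold ℤ 0 (tailWords m) fun _ => zero_notMem_of_mem_tailWords)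
  exact ⟨(LinearEquiv.ofEq _ _ (lieMultilinear_eq m)).toAddEquiv.trans
    (b.equivFun.trans (LinearEquiv.funCongrLeft ℤ ℤ e.symm)).toAddEquiv⟩

end LieMultilinear

end FreeToK

end

theorem mainTheorem9 :
    -- in degree `n`, `ρ` is the quotient map `F_n → K_n`
    (∀ n : ℕ, ∃ (e : FreeGroup (Fin n) ≃* FreeToK.FS1 _⦋n⦌)
      (e' : FreeToK.ReducedFreeGroup n ≃* FreeToK.KS1 _⦋n⦌),
      (∀ i : Fin n, e (FreeGroup.of i) =
        FreeToK.gen FreeToK.circlePt (FreeToK.circleSimplex n i.succ.castSucc)) ∧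
      ∀ w : FreeGroup (Fin n),
        e' (w : FreeToK.ReducedFreeGroup n) = (FreeToK.rho.app (op ⦋n⦌)).hom (e w)) ∧
    -- `ρ` is a surjection and a fibration, and its kernel is free in each degree
    (∀ n : ℕ, Function.Surjective (FreeToK.rho.app (op ⦋n⦌)).hom) ∧
    FreeToK.IsKanFibration FreeToK.rho ∧
    (∀ n : ℕ, IsFreeGroup (FreeToK.GammaS1 _⦋n⦌)) ∧
    -- `π_n K[S¹] ≅ Lie(n) ≅ H_{n-1}(P_n; ℤ)`, free abelian of rank `(n - 1)!`
    (∀ n : ℕ, 1 ≤ n →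
      Nonempty (FreeToK.HomotopyGroup FreeToK.KS1 n ≃* Multiplicative (FreeToK.LieMultilinear n)) ∧
      Nonempty (FreeToK.LieMultilinear n ≃+ (Fin (n - 1).factorial → ℤ)) ∧
      Nonempty (groupHomology (Rep.trivial ℤ (FreeToK.PureBraidGroup n) ℤ) (n - 1) ≃+
        FreeToK.LieMultilinear n)) ∧
    -- `π_*(ρ)` is an isomorphism in degrees `1` and `2` and zero above
    Function.Bijective (FreeToK.homotopyMap FreeToK.rho 1) ∧
    Function.Bijective (FreeToK.homotopyMap FreeToK.rho 2) ∧
    (∀ n : ℕ, 2 < n → ∀ x, FreeToK.homotopyMap FreeToK.rho n x = 1) ∧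
    -- the short exact sequences `0 → Lie(n+1) → π_n Γ[S¹] → π_n F[S¹] → 0`
    (∀ n : ℕ, 2 < n →
      ∃ j : Multiplicative (FreeToK.LieMultilinear (n + 1)) →*
          FreeToK.HomotopyGroup FreeToK.GammaS1 n,
        Function.Injective j ∧
        j.range = (FreeToK.homotopyMap (FreeToK.kernelι FreeToK.rho) n).ker ∧
        Function.Surjective (FreeToK.homotopyMap (FreeToK.kernelι FreeToK.rho) n)) := by
  have hLie : ∀ n : ℕ, 1 ≤ n →
      Nonempty (FreeToK.LieMultilinear n ≃+ (Fin (n - 1).factorial → ℤ)) := by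
    intro n hn
    obtain ⟨m, rfl⟩ : ∃ m, n = m + 1 := ⟨n - 1, by omega⟩
    exact FreeToK.lieMultilinear_equiv m
  -- Both sides are free abelian of rank `n!`; the isomorphism is chosen through bases.
  have hK : ∀ n : ℕ, Nonempty (FreeToK.HomotopyGroup FreeToK.KS1 (n + 1) ≃*
      Multiplicative (FreeToK.LieMultilinear (n + 1))) := by
    intro n
    obtain ⟨e⟩ := FreeToK.homotopyGroup_reduced_equiv n
    obtain ⟨e'⟩ := FreeToK.lieMultilinear_equiv n
    exact ⟨e.trans (AddEquiv.toMultiplicative e'.symm)⟩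
  refine ⟨fun n => ⟨FreeToK.freeEquiv n, FreeToK.reducedEquiv n, FreeToK.freeEquiv_of,
      FreeToK.reducedEquiv_mk⟩, FreeToK.rho_surjective,
    FreeToK.isKanFibration_of_surjective _ FreeToK.rho_surjective, FreeToK.isFreeGroup_gammaS1,
    fun n hn => ⟨?_, hLie n hn, ?_⟩, FreeToK.homotopyMap_rho_one_bijective,
    FreeToK.homotopyMap_rho_two_bijective, fun n hn => FreeToK.homotopyMap_rho_eq_one hn,
    fun n hn => ?_⟩
  · obtain ⟨m, rfl⟩ : ∃ m, n = m + 1 := ⟨n - 1, by omega⟩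
    exact hK m
  · obtain ⟨e⟩ := FreeToK.homology_pureBraid n hn
    obtain ⟨e'⟩ := hLie n hn
    exact ⟨e.trans e'.symm⟩
  · obtain ⟨δ, h1, h2, h3⟩ := FreeToK.exists_exact_of_cycles FreeToK.rho_surjective
      (fun _ => FreeToK.rho_eq_one_of_mem_cycles hn)
      (fun _ => FreeToK.rho_eq_one_of_mem_cycles (by omega : 2 < n + 1))
    obtain ⟨e⟩ := hK n
    obtain ⟨e'⟩ := FreeToK.homotopyGroup_reduced_equiv_cycles (n + 1)
    -- The connecting map starts at the cycles of `K[S¹]` in degree `n + 1`, which coincide with the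
    -- homotopy group and hence with `Lie(n + 1)` up to isomorphism.
    refine ⟨δ.comp (e.symm.trans e').toMonoidHom, h1.comp (e.symm.trans e').injective, ?_, h3⟩
    rw [← h2]
    ext x
    constructor
    · rintro ⟨y, rfl⟩
      exact ⟨_, rfl⟩
    · rintro ⟨y, rfl⟩
      exact ⟨(e.symm.trans e').symm y, congrArg δ ((e.symm.trans e').apply_symm_apply y)⟩
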